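/- Let $M$ be a smooth, paracompact (Hausdorff) manifold and let $G$ be a connected Lie group acting smoothly and properly on $M$, with action $\Phi_g(m)=g\cdot m$ and Lie algebra $\mathfrak g$. For $m\in M$ let $\mathcal V(m)=\{\xi_M(m)\mid \xi\in\mathfrak g\}\subseteq T_mM$ be the span of the fundamental vector fields. For a tangent distribution $\Delta$, its smooth annihilator $\Delta^\circ$ consists at $m$ of the values $\alpha(m)$ of the smooth one-forms $\alpha$, defined near $m$, that vanish on all smooth local sections of $\Delta$; the smooth annihilator of a codistribution is defined in the same way. Put $$\mathcal V^\circ_G(m)=\{\alpha(m)\mid \alpha \text{ a } G\text{-invariant smooth section of } \mathcal V^\circ \text{ on a } G\text{-invariant open neighbourhood of } m\}.$$ Let $P$ be a stratum of $M$, i.e. a connected component of an orbit type set $M_{(H)}=\{m\in M\mid G_m \text{ is conjugate to } H\}$, and let $\iota_P:P\hookrightarrow M$ be the inclusion. Then $P$ is $G$-invariant and, with the subspace topology, has the structure of a smooth embedded submanifold of $M$. Let $\mathcal V_P\subseteq TP$ be the vertical distribution of the induced action of $G$ on $P$, and $(\mathcal V_P)^\circ\subseteq T^*P$ its smooth annihilator.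 Then: 1. $\iota_P^*(\mathcal V^\circ_G)=(\mathcal V_P)^\circ$, that is, $\iota_P^*(\mathcal V^\circ_G(p))=(\mathcal V_P)^\circ(p)$ for all $p\in P$. 2. $\mathcal V^\circ_G|_P$ is a smooth vector subbundle of $T^*M|_P$, $(\mathcal V_P)^\circ$ is a smooth vector subbundle of $T^*P$, and $\iota_P^*:\mathcal V^\circ_G|_P\to(\mathcal V_P)^\circ$ is an isomorphism of smooth vector bundles over $P$. 3. For every $G$-invariant Riemannian metric $\rho$ on $M$, with $TP^\perp\subseteq TM|_P$ the $\rho$-orthogonal complement of $TP$, the smooth annihilator of $\mathcal V^\circ_G|_P$ in $TM|_P$ is $$(\mathcal V^\circ_G|_P)^\circ=\mathcal V|_P\oplus TP^\perp.$$ -/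

import Mathlib

open Manifold Bundle Topology
open scoped ContDiff

noncomputable section

/-! ### Smooth vector fields and one-forms along a map

Local sections of `TM` and `T*M`, and of their pullbacks along a map `f : N → M` (for the
inclusion of a submanifold, these are the sections of `TM|_N` and `T*M|_N`; for the identity they
are ordinary vector fields and one-forms). -/

section Sections

variable {E : Type*} [NormedAddCommGroup E] [NormedSpace ℝ E] {H : Type*} [TopologicalSpace H]
  (I : ModelWithCorners ℝ E H) {M : Type*} [TopologicalSpace M] [ChartedSpace H M]
  {E' : Type*} [NormedAddCommGroup E'] [NormedSpace ℝ E'] {H' : Type*} [TopologicalSpace H']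
  (J : ModelWithCorners ℝ E' H') {N : Type*} [TopologicalSpace N] [ChartedSpace H' N]

/-- The fibre `T*_m M` of the cotangent bundle. -/
abbrev CotangentSpace (m : M) : Type _ := TangentSpace I m →L[ℝ] Bundle.Trivial M ℝ m

variable [IsManifold I ∞ M]

/-- `X` is a smooth section over `U ⊆ N` of the pullback of `TM` along `f`. -/
def SmoothFieldOn (f : N → M) (X : ∀ q, TangentSpace I (f q)) (U : Set N) : Prop :=
  ContMDiffOn J (I.prod 𝓘(ℝ, E)) ∞
    (fun q => TotalSpace.mk' E (E := fun m : M => TangentSpace I m) (f q) (X q)) U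

/-- `α` is a smooth section over `U ⊆ N` of the pullback of `T*M` along `f`. -/
def SmoothFormOn (f : N → M) (α : ∀ q, CotangentSpace I (f q)) (U : Set N) : Prop :=
  ContMDiffOn J (I.prod 𝓘(ℝ, E →L[ℝ] ℝ)) ∞
    (fun q => TotalSpace.mk' (E →L[ℝ] ℝ) (E := fun m : M => CotangentSpace I m) (f q) (α q)) U

/-- The smooth annihilator `Δ°` of a tangent distribution `Δ` on `M`: the values of those smooth
local one-forms that vanish on every smooth local section of `Δ`. -/
def smoothAnnihilator (Δ : ∀ m : M, Submodule ℝ (TangentSpace I m)) (m : M) :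
    Submodule ℝ (CotangentSpace I m) where
  carrier := {a | ∃ U : Set M, IsOpen U ∧ m ∈ U ∧ ∃ α : ∀ x : M, CotangentSpace I x,
    SmoothFormOn I I (fun x : M => x) α U ∧
    (∀ (W : Set M) (X : ∀ x : M, TangentSpace I x), IsOpen W →
      SmoothFieldOn I I (fun x : M => x) X W → (∀ x ∈ W, X x ∈ Δ x) →
      ∀ x ∈ U ∩ W, α x (X x) = 0) ∧
    α m = a}
  zero_mem' := by
    refine ⟨Set.univ, isOpen_univ, trivial, fun _ => 0, ?_, fun _ _ _ _ _ _ _ => rfl, rfl⟩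
    exact (contMDiff_zeroSection ℝ (fun m : M => CotangentSpace I m)).contMDiffOn
  add_mem' := by
    rintro a b ⟨U, hU, hmU, α, hα, hα', rfl⟩ ⟨V, hV, hmV, β, hβ, hβ', rfl⟩
    refine ⟨U ∩ V, hU.inter hV, ⟨hmU, hmV⟩, fun x => α x + β x, ?_, ?_, rfl⟩
    · exact ContMDiffOn.add_section (hα.mono Set.inter_subset_left)
        (hβ.mono Set.inter_subset_right)
    · intro W X hW hX hXΔ x hx
      have h1 := hα' W X hW hX hXΔ x ⟨hx.1.1, hx.2⟩
      have h2 := hβ' W X hW hX hXΔ x ⟨hx.1.2, hx.2⟩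
      change α x (X x) + β x (X x) = 0
      rw [h1, h2, add_zero]
  smul_mem' := by
    rintro c a ⟨U, hU, hmU, α, hα, hα', rfl⟩
    refine ⟨U, hU, hmU, fun x => c • α x, ?_, ?_, rfl⟩
    · exact ContMDiffOn.const_smul_section hα
    · intro W X hW hX hXΔ x hx
      have h1 := hα' W X hW hX hXΔ x hx
      change c • α x (X x) = 0
      rw [h1, smul_zero]

/-- The smooth annihilator `C°`, inside the pullback of `TM` along `f : N → M`, of a family `C` of
subspaces of the pullback of `T*M`: the values of those smooth local sections of the pullback of
`TM` on which every smooth local section of `C` vanishes. -/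
def smoothCoannihilator (f : N → M) (C : ∀ q, Submodule ℝ (CotangentSpace I (f q))) (q : N) :
    Set (TangentSpace I (f q)) :=
  {v | ∃ U : Set N, IsOpen U ∧ q ∈ U ∧ ∃ X : ∀ x : N, TangentSpace I (f x),
    SmoothFieldOn I J f X U ∧
    (∀ (W : Set N) (α : ∀ x : N, CotangentSpace I (f x)), IsOpen W →
      SmoothFormOn I J f α W → (∀ x ∈ W, α x ∈ C x) → ∀ x ∈ U ∩ W, α x (X x) = 0) ∧
    X q = v}

/-- The family `C` of subspaces of the pullback of `T*M` along `f : N → M` is a smooth vector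
subbundle: for some `r`, it has smooth local frames of length `r` near every point of `N`. -/
def IsSmoothSubbundle (f : N → M) (C : ∀ q, Submodule ℝ (CotangentSpace I (f q))) : Prop :=
  ∃ r : ℕ, ∀ q : N, ∃ U : Set N, IsOpen U ∧ q ∈ U ∧
    ∃ σ : Fin r → ∀ x : N, CotangentSpace I (f x),
      (∀ i, SmoothFormOn I J f (σ i) U) ∧
      ∀ x ∈ U, LinearIndependent ℝ (fun i => σ i x) ∧
        Submodule.span ℝ (Set.range fun i => σ i x) = C x

/-- Pullback of covectors at `q` along `f : N → M`, that is `a ↦ a ∘ T_q f`. -/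
def pullbackCovector (f : N → M) (q : N) : CotangentSpace I (f q) →ₗ[ℝ] CotangentSpace J q where
  toFun a := a.comp (mfderiv J I f q)
  map_add' _ _ := rfl
  map_smul' _ _ := rfl

/-- Pullback of covectors along `f : N → M` restricts to an isomorphism of smooth vector bundles
over `N` from the subbundle `C` of the pullback of `T*M` to the subbundle `D` of `T*N`:
both are smooth subbundles, the map is a linear bijection on every fibre, and both it and its
inverse take smooth local sections to smooth local sections. -/
def IsPullbackBundleIso [IsManifold J ∞ N] (f : N → M)
    (C : ∀ q, Submodule ℝ (CotangentSpace I (f q)))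
    (D : ∀ q : N, Submodule ℝ (CotangentSpace J q)) : Prop :=
  IsSmoothSubbundle I J f C ∧ IsSmoothSubbundle J J (fun q : N => q) D ∧
  (∀ q, Set.BijOn (pullbackCovector I J f q) (C q) (D q)) ∧
  ∀ (U : Set N) (σ : ∀ q, CotangentSpace I (f q)), IsOpen U → (∀ q ∈ U, σ q ∈ C q) →
    (SmoothFormOn I J f σ U ↔
      SmoothFormOn J J (fun q : N => q) (fun q => pullbackCovector I J f q (σ q)) U)

/-- The orthogonal complement `(T_q N)^⊥ ⊆ T_{f q} M` of the image of `T_q N` under `T_q f`, with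
respect to the Riemannian metric `ρ` on `M`. -/
def normalSpace (ρ : ContMDiffRiemannianMetric I ∞ E (fun m : M => TangentSpace I m))
    (f : N → M) (q : N) : Submodule ℝ (TangentSpace I (f q)) where
  carrier := {v | ∀ w : TangentSpace J q, ρ.inner (f q) (mfderiv J I f q w) v = 0}
  zero_mem' := fun _ => map_zero _
  add_mem' := by
    intro a b ha hb w
    rw [map_add, ha w, hb w, add_zero]
  smul_mem' := by
    intro c a ha w
    rw [map_smul, ha w, smul_zero]

end Sections

/-! ### Group actions -/

section Actions

variable {EG : Type*} [NormedAddCommGroup EG] [NormedSpace ℝ EG] {HG : Type*} [TopologicalSpace HG]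
  (IG : ModelWithCorners ℝ EG HG) (G : Type*) [TopologicalSpace G] [ChartedSpace HG G] [Group G]
  {E : Type*} [NormedAddCommGroup E] [NormedSpace ℝ E] {H : Type*} [TopologicalSpace H]
  (I : ModelWithCorners ℝ E H) {M : Type*} [TopologicalSpace M] [ChartedSpace H M] [MulAction G M]

/-- The value at `m` of the fundamental vector field `ξ_M`, as a linear function of `ξ`: the
derivative at the identity of the orbit map `g ↦ g • m`. (Its values live in the tangent space at
`1 • m = m`.) -/
def fundamentalField (m : M) : GroupLieAlgebra IG G →L[ℝ] TangentSpace I m :=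
  mfderiv IG I (fun g : G => g • m) 1

/-- The vertical distribution `𝒱(m) = {ξ_M(m) | ξ ∈ 𝔤}`. -/
def verticalSpace (m : M) : Submodule ℝ (TangentSpace I m) :=
  LinearMap.range (fundamentalField IG G I m).toLinearMap

/-- `𝒱°_G(m) = {α(m) | α ∈ Γ(𝒱°)^G}`: the values at `m` of the `G`-invariant smooth local sections
of the smooth annihilator `𝒱°`, defined on `G`-invariant open sets. -/
def invariantVerticalAnnihilator [IsManifold I ∞ M] (m : M) :
    Submodule ℝ (CotangentSpace I m) where
  carrier := {a | ∃ U : Set M, IsOpen U ∧ m ∈ U ∧ (∀ (g : G), ∀ x ∈ U, g • x ∈ U) ∧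
    ∃ α : ∀ x : M, CotangentSpace I x,
      SmoothFormOn I I (fun x : M => x) α U ∧
      (∀ x ∈ U, α x ∈ smoothAnnihilator I (fun y : M => verticalSpace IG G I y) x) ∧
      (∀ (g : G), ∀ x ∈ U, pullbackCovector I I (fun y : M => g • y) x (α (g • x)) = α x) ∧
      α m = a}
  zero_mem' := by
    refine ⟨Set.univ, isOpen_univ, trivial, fun _ _ _ => trivial, fun _ => 0, ?_,
      fun _ _ => Submodule.zero_mem _, fun _ _ _ => map_zero _, rfl⟩
    exact (contMDiff_zeroSection ℝ (fun m : M => CotangentSpace I m)).contMDiffOn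
  add_mem' := by
    rintro a b ⟨U, hU, hmU, hUG, α, hα, hα', hαG, rfl⟩ ⟨V, hV, hmV, hVG, β, hβ, hβ', hβG, rfl⟩
    refine ⟨U ∩ V, hU.inter hV, ⟨hmU, hmV⟩, fun g x hx => ⟨hUG g x hx.1, hVG g x hx.2⟩,
      fun x => α x + β x, ?_, fun x hx => Submodule.add_mem _ (hα' x hx.1) (hβ' x hx.2), ?_, rfl⟩
    · exact ContMDiffOn.add_section (hα.mono Set.inter_subset_left)
        (hβ.mono Set.inter_subset_right)
    · intro g x hx
      rw [map_add, hαG g x hx.1, hβG g x hx.2]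
  smul_mem' := by
    rintro c a ⟨U, hU, hmU, hUG, α, hα, hα', hαG, rfl⟩
    refine ⟨U, hU, hmU, hUG, fun x => c • α x, ContMDiffOn.const_smul_section hα,
      fun x hx => Submodule.smul_mem _ c (hα' x hx), ?_, rfl⟩
    intro g x hx
    rw [map_smul, hαG g x hx]

/-- The Riemannian metric `ρ` is `G`-invariant: every `g ∈ G` acts by isometries. -/
def IsInvariantMetric [IsManifold I ∞ M]
    (ρ : ContMDiffRiemannianMetric I ∞ E (fun m : M => TangentSpace I m)) : Prop :=
  ∀ (g : G) (m : M) (v w : TangentSpace I m),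
    ρ.inner (g • m) (mfderiv I I (fun y : M => g • y) m v) (mfderiv I I (fun y : M => g • y) m w)
      = ρ.inner m v w

end Actions

/-! ### Orbit types -/

section OrbitType

variable {G : Type*} [Group G] (M : Type*) [MulAction G M]

/-- The orbit type set `M_(K)` of the points whose isotropy group is conjugate to `K`. -/
def orbitTypeSet (K : Subgroup G) : Set M :=
  {m | ∃ g : G, MulAction.stabilizer G m = K.map (MulAut.conj g).toMonoidHom}

variable {M}

theorem smul_mem_orbitTypeSet (K : Subgroup G) (g : G) {m : M} (hm : m ∈ orbitTypeSet M K) :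
    g • m ∈ orbitTypeSet M K := by
  obtain ⟨h, hh⟩ := hm
  refine ⟨g * h, ?_⟩
  rw [MulAction.stabilizer_smul_eq_stabilizer_map_conj, hh, Subgroup.map_map]
  congr 1
  ext x
  simp

/-- The connected component of the orbit type set `M_(K)` through `m`. As `G` is connected, this is
a `G`-invariant subset of `M`, and so carries the induced action of `G`. -/
def orbitTypeStratum [TopologicalSpace G] [ConnectedSpace G] [TopologicalSpace M]
    [ContinuousSMul G M] (K : Subgroup G) (m : M) : SubMulAction G M where
  carrier := connectedComponentIn (orbitTypeSet M K) m
  smul_mem' := by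
    intro g x hx
    have hxF : x ∈ orbitTypeSet M K := connectedComponentIn_subset _ _ hx
    rw [connectedComponentIn_eq hx]
    have hc : IsPreconnected (Set.range fun h : G => h • x) :=
      isPreconnected_range (continuous_id.smul continuous_const)
    refine hc.subset_connectedComponentIn ⟨1, one_smul G x⟩ ?_ ⟨g, rfl⟩
    rintro _ ⟨h, rfl⟩
    exact smul_mem_orbitTypeSet K h hxF

end OrbitType

end

/-! Fix p in the stratum. Write H for its isotropy group, V for the tangent space of the orbit (the
range of `infAct`), and T for the space of vectors v with hv - v ∈ V for all h ∈ H
(`fixedModVertical`). The theorem comes down to describing the tangent space of P and the fibre of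
𝒱°_G at p in terms of the representation of H, and then averaging over H, which is compact because
the action is proper.

Tangent space. Averaging a chart over H makes H act linearly near p (`exists_linearizing_chart`).
Together with a constant rank normal form of the orbit map (`exists_orbitStraightening`) this gives
a slice chart (`exists_isSliceChart`): nearby points can be moved into a transversal, and only
elements of H map points of the transversal into it. The isotropy group of a point of the
transversal is contained in H, and it is conjugate to H only if it equals H
(`stabilizer_smul_eq_of_le`). So in the slice chart the orbit type set is the linear subspace T
(`IsSliceChart.mem_orbitTypeSet_iff`). Hence P is an embedded submanifold with T_pP = T.

Covectors. The fibre of 𝒱°_G at p consists of the H-invariant covectors vanishing on V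
(`basicCovectors`). Such a covector a is the differential at p of an invariant function: read a in
the slice chart and spread it along orbits (`IsSliceChart.exists_invariant_function`).

Averaging. Restriction to T maps these covectors bijectively onto the functionals on T that vanish
on V. It is onto because b extends as b ∘ avg, and injective because an invariant covector is
determined by its values on fixed vectors, which lie in T. This is statement 1 and the fibrewise
part of statement 2. The rank dim T - dim V is constant on P, so differentials of invariant
functions that form a basis at one point form a frame nearby, and dual vector fields read off smooth
coefficients. For statement 3, an invariant metric represents an invariant covector by a vector
fixed by H, hence in T; so these covectors vanish on the complement of T, while on T they separate
vectors modulo V. Dual fields extend a vector of the pointwise annihilator to a smooth section. -/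

/-! ### Inverse function theorem and maps with zero derivative -/

section Calculus

variable {E : Type*} [NormedAddCommGroup E] [NormedSpace ℝ E]
  {F : Type*} [NormedAddCommGroup F] [NormedSpace ℝ F]
  {M : Type*} [TopologicalSpace M] [ChartedSpace E M]

/-- The inverse function theorem for a smooth map between normed spaces: on a neighbourhood of a
point where the derivative is invertible, the map is a diffeomorphism onto an open set. -/
theorem exists_openPartialHomeomorph_of_contDiffOn [CompleteSpace E] {f : E → F} {W : Set E} {p : E}
    (hW : IsOpen W) (hp : p ∈ W) (hf : ContDiffOn ℝ ∞ f W) (L : E ≃L[ℝ] F)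
    (hL : HasFDerivAt f (L : E →L[ℝ] F) p) :
    ∃ e : OpenPartialHomeomorph E F, p ∈ e.source ∧ e.source ⊆ W ∧ (∀ x, e x = f x) ∧
      ContDiffOn ℝ ∞ e.symm e.target := by
  have hfp : ContDiffAt ℝ ∞ f p := hf.contDiffAt (hW.mem_nhds hp)
  let e₀ := hfp.toOpenPartialHomeomorph f hL (by simp)
  have hcont : ContinuousOn (fderiv ℝ f) W := hf.continuousOn_fderiv_of_isOpen hW (by simp)
  -- At this point the inverse is only known to be smooth at the image of `p`. Restricting to the
  -- open set where the derivative stays invertible makes it smooth on the whole target.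
  have hO : IsOpen (W ∩ fderiv ℝ f ⁻¹' (Set.range ((↑) : (E ≃L[ℝ] F) → E →L[ℝ] F))) :=
    hcont.isOpen_inter_preimage hW ContinuousLinearEquiv.isOpen
  refine ⟨e₀.restrOpen _ hO, ?_, ?_, fun x => rfl, ?_⟩
  · refine ⟨hfp.mem_toOpenPartialHomeomorph_source hL (by simp), hp, L, hL.fderiv.symm⟩
  · intro x hx
    exact hx.2.1
  · intro y hy
    have hy' := (e₀.restrOpen _ hO).map_target hy
    obtain ⟨-, hyW, L', hL'⟩ := hy'
    refine ContDiffAt.contDiffWithinAt ?_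
    refine (e₀.restrOpen _ hO).contDiffAt_symm (f₀' := L') hy ?_ ?_
    · rw [hL']
      exact ((hf.contDiffAt (hW.mem_nhds hyW)).differentiableAt (by simp)).hasFDerivAt
    · exact hf.contDiffAt (hW.mem_nhds hyW)

/-- The inverse function theorem for a smooth map from a manifold to a normed space. -/
theorem exists_openPartialHomeomorph_of_contMDiffOn [CompleteSpace E] [IsManifold 𝓘(ℝ, E) ∞ M]
    {f : M → F} {W : Set M} {p : M}
    (hW : IsOpen W) (hp : p ∈ W) (hf : ContMDiffOn 𝓘(ℝ, E) 𝓘(ℝ, F) ∞ f W) (L : E ≃L[ℝ] F)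
    (hL : HasMFDerivAt 𝓘(ℝ, E) 𝓘(ℝ, F) f p (L : E →L[ℝ] F)) :
    ∃ e : OpenPartialHomeomorph M F, p ∈ e.source ∧ e.source ⊆ W ∧ (∀ x ∈ e.source, e x = f x) ∧
      ContMDiffOn 𝓘(ℝ, E) 𝓘(ℝ, F) ∞ e e.source ∧
      ContMDiffOn 𝓘(ℝ, F) 𝓘(ℝ, E) ∞ e.symm e.target := by
  let c := chartAt E p
  have hpc : p ∈ c.source := mem_chart_source E p
  have hO : IsOpen (c.target ∩ c.symm ⁻¹' W) := c.isOpen_inter_preimage_symm hW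
  have hfc : ContDiffOn ℝ ∞ (f ∘ c.symm) (c.target ∩ c.symm ⁻¹' W) := by
    rw [← contMDiffOn_iff_contDiffOn]
    exact hf.comp ((contMDiffOn_chart_symm (I := 𝓘(ℝ, E)) (x := p)).mono Set.inter_subset_left)
      Set.inter_subset_right
  have hd : HasFDerivAt (f ∘ c.symm) (L : E →L[ℝ] F) (c p) := by
    have h := hL.2
    simp only [writtenInExtChartAt, extChartAt, mfld_simps] at h
    exact hasFDerivWithinAt_univ.1 h
  obtain ⟨e, he, heW, hef, hes⟩ := exists_openPartialHomeomorph_of_contDiffOn hO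
    (show c p ∈ _ from ⟨c.map_source hpc, by
      rw [Set.mem_preimage, c.left_inv hpc]; exact hp⟩) hfc L hd
  have heq : ∀ x ∈ (c.trans e).source, (c.trans e) x = f x := fun x hx => by
    rw [OpenPartialHomeomorph.trans_source] at hx
    rw [OpenPartialHomeomorph.coe_trans, Function.comp_apply, hef, Function.comp_apply,
      c.left_inv hx.1]
  have hsub : (c.trans e).source ⊆ W := fun x hx => by
    rw [OpenPartialHomeomorph.trans_source] at hx
    have := (heW hx.2).2
    rwa [Set.mem_preimage, c.left_inv hx.1] at this
  refine ⟨c.trans e, ?_, hsub, heq, ?_, ?_⟩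
  · rw [OpenPartialHomeomorph.trans_source]
    exact ⟨hpc, he⟩
  · exact (hf.mono hsub).congr heq
  · rw [OpenPartialHomeomorph.coe_trans_symm, OpenPartialHomeomorph.trans_target]
    exact (contMDiffOn_chart_symm (I := 𝓘(ℝ, E)) (x := p)).comp
      ((contMDiffOn_iff_contDiffOn.2 hes).mono Set.inter_subset_left) Set.inter_subset_right

/-- A map into a manifold whose derivative vanishes on a preconnected open set is constant there. -/
theorem eq_of_hasMFDerivAt_zero [IsManifold 𝓘(ℝ, E) ∞ M] {f : F → M} {s : Set F} (hs : IsOpen s)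
    (hs' : IsPreconnected s)
    (hf : ∀ x ∈ s, HasMFDerivAt 𝓘(ℝ, F) 𝓘(ℝ, E) f x (0 : F →L[ℝ] E)) {x y : F}
    (hx : x ∈ s) (hy : y ∈ s) : f x = f y := by
  have hloc : ∀ x ∈ s, ∀ᶠ y in 𝓝 x, f y = f x := by
    intro x hx
    let e := extChartAt 𝓘(ℝ, E) (f x)
    have h1 : ∀ᶠ y in 𝓝 x, y ∈ s ∧ f y ∈ e.source :=
      Filter.Eventually.and (hs.mem_nhds hx)
        ((hf x hx).continuousAt.preimage_mem_nhds (extChartAt_source_mem_nhds (f x)))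
    obtain ⟨ε, hε, hball⟩ := Metric.eventually_nhds_iff_ball.1 h1
    have hd : ∀ y ∈ Metric.ball x ε, HasFDerivAt (e ∘ f) (0 : F →L[ℝ] E) y := by
      intro y hy
      have h2 := (mdifferentiableAt_extChartAt (I := 𝓘(ℝ, E)) (x := f x) (y := f y)
        (by simpa [e] using (hball y hy).2)).hasMFDerivAt
      have h3 := h2.comp y (hf y (hball y hy).1)
      exact h3.hasFDerivAt.congr_fderiv (ContinuousLinearMap.comp_zero _)
    filter_upwards [Metric.ball_mem_nhds x hε] with y hy
    have h5 : e (f y) = e (f x) :=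
      Metric.isOpen_ball.is_const_of_fderiv_eq_zero (convex_ball x ε).isPreconnected
        (fun z hz => (hd z hz).differentiableAt.differentiableWithinAt)
        (fun z hz => (hd z hz).fderiv) hy (Metric.mem_ball_self hε)
    exact e.injOn (hball y hy).2 (hball x (Metric.mem_ball_self hε)).2 h5
  have : PreconnectedSpace s := isPreconnected_iff_preconnectedSpace.1 hs'
  have hlc : IsLocallyConstant (s.domRestrict f) := by
    rw [IsLocallyConstant.iff_eventually_eq]
    rintro ⟨x, hx⟩
    exact (continuous_subtype_val.tendsto (⟨x, hx⟩ : s)).eventually (hloc x hx)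
  exact hlc.apply_eq_of_preconnectedSpace (⟨x, hx⟩ : s) ⟨y, hy⟩

end Calculus

/-! ### Differentiation under the integral over a compact space -/

section ParametricIntegral

open MeasureTheory

universe u

variable {A : Type*} [NormedAddCommGroup A] [NormedSpace ℝ A]
  {G : Type*} [TopologicalSpace G] [ChartedSpace A G]
  {X : Type*} [TopologicalSpace X] [CompactSpace X] [MeasurableSpace X] [BorelSpace X]
  {E : Type u} [NormedAddCommGroup E] [NormedSpace ℝ E]

theorem contMDiffAt_param_right {F : Type*} [NormedAddCommGroup F] [NormedSpace ℝ F]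
    {f : G → E → F} {g : G} {u : E}
    (hf : ContMDiffAt (𝓘(ℝ, A).prod 𝓘(ℝ, E)) 𝓘(ℝ, F) ∞ (Function.uncurry f) (g, u)) :
    ContDiffAt ℝ ∞ (f g) u := by
  rw [← contMDiffAt_iff_contDiffAt]
  exact ContMDiffAt.comp u (g := Function.uncurry f) (f := fun v => (g, v)) hf
    (contMDiffAt_const.prodMk contMDiffAt_id)

variable [IsManifold 𝓘(ℝ, A) ∞ G]

/-- Joint smoothness passes to the partial derivative in the vector variable, which is what lets the
induction in `contDiffOn_integral_param` continue. -/
theorem contMDiffAt_fderiv_param {F : Type*} [NormedAddCommGroup F] [NormedSpace ℝ F]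
    {f : G → E → F} {g : G} {u : E}
    (hf : ContMDiffAt (𝓘(ℝ, A).prod 𝓘(ℝ, E)) 𝓘(ℝ, F) ∞ (Function.uncurry f) (g, u)) :
    ContMDiffAt (𝓘(ℝ, A).prod 𝓘(ℝ, E)) 𝓘(ℝ, E →L[ℝ] F) ∞
      (Function.uncurry fun g u => fderiv ℝ (f g) u) (g, u) := by
  have h := ContMDiffAt.mfderiv (J := 𝓘(ℝ, A).prod 𝓘(ℝ, E)) (I := 𝓘(ℝ, E)) (I' := 𝓘(ℝ, F))
    (x₀ := (g, u)) (m := ∞) (n := ∞)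
    (fun q : G × E => f q.1) (fun q : G × E => q.2) ?_ contMDiffAt_snd (by simp)
  · simp only [inTangentCoordinates_model_space, mfderiv_eq_fderiv] at h
    exact h
  · have : ContMDiffAt ((𝓘(ℝ, A).prod 𝓘(ℝ, E)).prod 𝓘(ℝ, E)) (𝓘(ℝ, A).prod 𝓘(ℝ, E)) ∞
        (fun z : (G × E) × E => (z.1.1, z.2)) ((g, u), u) :=
      contMDiffAt_fst.fst.prodMk contMDiffAt_snd
    exact ContMDiffAt.comp ((g, u), u) (g := Function.uncurry f) hf this

/-- Differentiation under the integral sign over a compact space: the integral of a smoothly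
parametrized function is differentiable, and its derivative is the integral of the derivative. -/
theorem hasFDerivAt_integral_param [FiniteDimensional ℝ E] {F : Type*} [NormedAddCommGroup F] [NormedSpace ℝ F]
    [FiniteDimensional ℝ F] (μ : Measure X) [IsFiniteMeasure μ] {j : X → G} (hj : Continuous j)
    {U : Set E} (hU : IsOpen U) {f : G → E → F}
    (hf : ∀ x, ∀ u ∈ U, ContMDiffAt (𝓘(ℝ, A).prod 𝓘(ℝ, E)) 𝓘(ℝ, F) ∞ (Function.uncurry f) (j x, u))
    {u : E} (hu : u ∈ U) :
    HasFDerivAt (fun v => ∫ x, f (j x) v ∂μ) (∫ x, fderiv ℝ (f (j x)) u ∂μ) u := by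
  have hc : ∀ v ∈ U, Continuous fun x => f (j x) v := fun v hv => by
    rw [continuous_iff_continuousAt]
    intro x
    exact ContinuousAt.comp (g := Function.uncurry f) (f := fun x => (j x, v))
      (hf x v hv).continuousAt (hj.continuousAt.prodMk continuousAt_const)
  have hc' : ∀ v ∈ U, Continuous fun x => fderiv ℝ (f (j x)) v := fun v hv => by
    rw [continuous_iff_continuousAt]
    intro x
    exact ContinuousAt.comp (g := Function.uncurry fun g u => fderiv ℝ (f g) u)
      (f := fun x => (j x, v))
      (contMDiffAt_fderiv_param (hf x v hv)).continuousAt (hj.continuousAt.prodMk continuousAt_const)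
  obtain ⟨C, hC⟩ := isCompact_univ.exists_bound_of_continuousOn (hc' u hu).continuousOn
  -- By compactness of `X` the bound at `u`, relaxed by 1, holds uniformly for nearby parameters; it
  -- is the dominating constant.
  have hmem : ∀ᶠ v in 𝓝 u, ∀ x ∈ (Set.univ : Set X), ‖fderiv ℝ (f (j x)) v‖ < C + 1 := by
    refine isCompact_univ.eventually_forall_of_forall_eventually fun x _ => ?_
    have h1 : ContinuousAt (fun z : E × X => ‖fderiv ℝ (f (j z.2)) z.1‖) (u, x) := by
      refine ContinuousAt.norm ?_
      exact ContinuousAt.comp (g := Function.uncurry fun g u => fderiv ℝ (f g) u)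
        (f := fun z : E × X => (j z.2, z.1)) (x := (u, x))
        (contMDiffAt_fderiv_param (hf x u hu)).continuousAt
        ((hj.continuousAt.comp continuousAt_snd).prodMk continuousAt_fst)
    exact h1.eventually_lt continuousAt_const (by linarith [hC x trivial] : _ < C + 1)
  refine hasFDerivAt_integral_of_dominated_of_fderiv_le
    (F := fun v x => f (j x) v) (F' := fun v x => fderiv ℝ (f (j x)) v)
    (bound := fun _ => C + 1) (Filter.inter_mem hmem (hU.mem_nhds hu)) ?_ ?_ ?_ ?_ ?_ ?_
  · filter_upwards [hU.mem_nhds hu] with v hv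
    exact (hc v hv).aestronglyMeasurable
  · exact (hc u hu).integrable_of_hasCompactSupport (HasCompactSupport.of_compactSpace _)
  · exact (hc' u hu).aestronglyMeasurable
  · exact Filter.Eventually.of_forall fun x v hv => (hv.1 x trivial).le
  · exact integrable_const _
  · exact Filter.Eventually.of_forall fun x v hv =>
      ((contMDiffAt_param_right (hf x v hv.2)).differentiableAt (by simp)).hasFDerivAt

/-- The integral over a compact space of a smoothly parametrized smooth function is smooth. -/
theorem contDiffOn_integral_param [FiniteDimensional ℝ E] {F : Type u} [NormedAddCommGroup F] [NormedSpace ℝ F]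
    [FiniteDimensional ℝ F] (μ : Measure X) [IsFiniteMeasure μ] {j : X → G} (hj : Continuous j)
    {U : Set E} (hU : IsOpen U) {f : G → E → F}
    (hf : ∀ x, ∀ u ∈ U, ContMDiffAt (𝓘(ℝ, A).prod 𝓘(ℝ, E)) 𝓘(ℝ, F) ∞
      (Function.uncurry f) (j x, u)) :
    ContDiffOn ℝ ∞ (fun v => ∫ x, f (j x) v ∂μ) U := by
  rw [contDiffOn_infty]
  intro n
  -- The target must vary because derivatives take values in `E →L[ℝ] F`; this is why `F` shares the
  -- universe of `E`.
  induction n generalizing F with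
  | zero =>
    refine contDiffOn_zero.2 fun u hu => ?_
    exact (hasFDerivAt_integral_param μ hj hU hf hu).continuousAt.continuousWithinAt
  | succ n ih =>
    rw [Nat.cast_succ, contDiffOn_succ_iff_fderiv_of_isOpen hU]
    refine ⟨fun u hu => (hasFDerivAt_integral_param μ hj hU hf
      hu).differentiableAt.differentiableWithinAt, by simp, ?_⟩
    refine ContDiffOn.congr (ih (f := fun g u => fderiv ℝ (f g) u)
      fun x u hu => contMDiffAt_fderiv_param (hf x u hu)) fun u hu => ?_
    exact (hasFDerivAt_integral_param μ hj hU hf hu).fderiv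

end ParametricIntegral

/-- The chain rule for base points that are only propositionally equal, such as `1 • m` and `m`.
Derivatives are maps of model spaces, so nothing has to be transported between tangent spaces. -/
theorem hasMFDerivAt_comp_of_eq {E₁ E₂ E₃ : Type*} [NormedAddCommGroup E₁] [NormedSpace ℝ E₁]
    [NormedAddCommGroup E₂] [NormedSpace ℝ E₂] [NormedAddCommGroup E₃] [NormedSpace ℝ E₃]
    {M₁ M₂ M₃ : Type*} [TopologicalSpace M₁] [ChartedSpace E₁ M₁] [TopologicalSpace M₂]
    [ChartedSpace E₂ M₂] [TopologicalSpace M₃] [ChartedSpace E₃ M₃] {f : M₁ → M₂} {g : M₂ → M₃}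
    {x : M₁} {y : M₂} {g' : E₂ →L[ℝ] E₃} {f' : E₁ →L[ℝ] E₂}
    (hg : HasMFDerivAt 𝓘(ℝ, E₂) 𝓘(ℝ, E₃) g y g') (hf : HasMFDerivAt 𝓘(ℝ, E₁) 𝓘(ℝ, E₂) f x f')
    (h : f x = y) :
    HasMFDerivAt 𝓘(ℝ, E₁) 𝓘(ℝ, E₃) (g ∘ f) x (g'.comp f') := by
  subst h
  exact HasMFDerivAt.comp x hg hf

/-! ### The infinitesimal action and homogeneity of orbit maps -/

section Action

variable {A : Type*} [NormedAddCommGroup A] [NormedSpace ℝ A]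
  {G : Type*} [TopologicalSpace G] [ChartedSpace A G] [Group G]
  {E : Type*} [NormedAddCommGroup E] [NormedSpace ℝ E]
  {M : Type*} [TopologicalSpace M] [ChartedSpace E M] [MulAction G M]
  [ContMDiffSMul 𝓘(ℝ, A) 𝓘(ℝ, E) ∞ G M]

theorem contMDiff_orbitMap (m : M) : ContMDiff 𝓘(ℝ, A) 𝓘(ℝ, E) ∞ (fun g : G => g • m) :=
  contMDiff_id.smul (I := 𝓘(ℝ, A)) contMDiff_const

theorem contMDiff_smulMap (A : Type*) [NormedAddCommGroup A] [NormedSpace ℝ A]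
    {G : Type*} [TopologicalSpace G] [ChartedSpace A G] [Group G]
    {E : Type*} [NormedAddCommGroup E] [NormedSpace ℝ E]
    {M : Type*} [TopologicalSpace M] [ChartedSpace E M] [MulAction G M]
    [ContMDiffSMul 𝓘(ℝ, A) 𝓘(ℝ, E) ∞ G M] (g : G) : ContMDiff 𝓘(ℝ, E) 𝓘(ℝ, E) ∞ (fun m : M => g • m) :=
  ContMDiffSMul.contMDiff_const_smul (I := 𝓘(ℝ, A)) g

/-- The infinitesimal action at `m`, as a map between model spaces. -/
noncomputable def infAct (A : Type*) [NormedAddCommGroup A] [NormedSpace ℝ A]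
    (G : Type*) [TopologicalSpace G] [ChartedSpace A G] [Group G]
    (E : Type*) [NormedAddCommGroup E] [NormedSpace ℝ E]
    {M : Type*} [TopologicalSpace M] [ChartedSpace E M] [MulAction G M] (m : M) : A →L[ℝ] E :=
  fundamentalField 𝓘(ℝ, A) G 𝓘(ℝ, E) m

theorem hasMFDerivAt_orbitMap_one (m : M) :
    HasMFDerivAt 𝓘(ℝ, A) 𝓘(ℝ, E) (fun g : G => g • m) 1 (infAct A G E m) :=
  ((contMDiff_orbitMap m).mdifferentiable (by simp) 1).hasMFDerivAt

variable [LieGroup 𝓘(ℝ, A) ∞ G]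

/-- The derivative at `m` of the action of `g`, as an isomorphism of the model space. -/
noncomputable def smulDeriv (A : Type*) [NormedAddCommGroup A] [NormedSpace ℝ A]
    {G : Type*} [TopologicalSpace G] [ChartedSpace A G] [Group G] [LieGroup 𝓘(ℝ, A) ∞ G]
    (E : Type*) [NormedAddCommGroup E] [NormedSpace ℝ E]
    {M : Type*} [TopologicalSpace M] [ChartedSpace E M] [MulAction G M]
    [ContMDiffSMul 𝓘(ℝ, A) 𝓘(ℝ, E) ∞ G M] (g : G) (m : M) : E ≃L[ℝ] E :=
  (Diffeomorph.smul 𝓘(ℝ, A) 𝓘(ℝ, E) ∞ g : M ≃ₘ^∞⟮𝓘(ℝ, E), 𝓘(ℝ, E)⟯ M).mfderivToContinuousLinearEquiv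
    (by simp) m

theorem hasMFDerivAt_smulMap (g : G) (m : M) :
    HasMFDerivAt 𝓘(ℝ, E) 𝓘(ℝ, E) (fun y : M => g • y) m (smulDeriv A E g m : E →L[ℝ] E) :=
  ((contMDiff_smulMap A g).mdifferentiable (by simp) m).hasMFDerivAt

/-- From k • m = g • ((g⁻¹ k) • m): at every `g` the derivative is the infinitesimal action composed
with isomorphisms on both sides, so the orbit map has constant rank. -/
theorem hasMFDerivAt_orbitMap (m : M) (g : G) :
    HasMFDerivAt 𝓘(ℝ, A) 𝓘(ℝ, E) (fun k : G => k • m) g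
      ((smulDeriv A E g m : E →L[ℝ] E).comp
        ((infAct A G E m).comp (smulDeriv A A g⁻¹ g : A →L[ℝ] A))) := by
  have h1 : HasMFDerivAt 𝓘(ℝ, A) 𝓘(ℝ, A) (fun k : G => g⁻¹ • k) g (smulDeriv A A g⁻¹ g : A →L[ℝ] A) :=
    hasMFDerivAt_smulMap g⁻¹ g
  have h2 := hasMFDerivAt_comp_of_eq (y := (1 : G)) (hasMFDerivAt_orbitMap_one (A := A) (E := E) m)
    h1 (by simp)
  have h3 := hasMFDerivAt_comp_of_eq (y := m) (hasMFDerivAt_smulMap (A := A) (E := E) g m)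
    h2 (by simp)
  refine h3.congr_of_eventuallyEq (Filter.Eventually.of_forall fun k => ?_)
  simp [smul_smul]

/-- Differentiate g • (k • m) = (g k g⁻¹) • (g • m) at k = 1; `Ad` is the derivative of conjugation.
-/
theorem smulDeriv_infAct (g : G) (m : M) :
    ∃ Ad : A →L[ℝ] A, ∀ ξ, smulDeriv A E g m (infAct A G E m ξ) = infAct A G E (g • m) (Ad ξ) := by
  have hc : ContMDiff 𝓘(ℝ, A) 𝓘(ℝ, A) ∞ (fun k : G => g * k * g⁻¹) :=
    (contMDiff_const.mul contMDiff_id).mul contMDiff_const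
  have h1 := (hc.mdifferentiable (by simp) 1).hasMFDerivAt
  have h2 := hasMFDerivAt_comp_of_eq (y := (1 : G))
    (hasMFDerivAt_orbitMap_one (A := A) (E := E) (g • m)) h1 (by simp)
  have h3 := hasMFDerivAt_comp_of_eq (y := m) (hasMFDerivAt_smulMap (A := A) (E := E) g m)
    (hasMFDerivAt_orbitMap_one (A := A) (G := G) (E := E) m) (by simp)
  refine ⟨mfderiv 𝓘(ℝ, A) 𝓘(ℝ, A) (fun k : G => g * k * g⁻¹) 1, fun ξ => ?_⟩
  have h4 := h3.congr_of_eventuallyEq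
    (f₁ := (fun k : G => k • g • m) ∘ fun k => g * k * g⁻¹)
    (Filter.Eventually.of_forall fun k => by simp [smul_smul])
  have h5 := hasMFDerivAt_unique h4 h2
  exact DFunLike.congr_fun h5 ξ

/-- In `hasMFDerivAt_orbitMap` the factor applied first is left translation by g⁻¹, which does not
depend on the point; so an inclusion of kernels at 1 propagates to every `g`. -/
theorem ker_orbitMap_le {p q : M}
    (h : (infAct A G E p).ker ≤ (infAct A G E q).ker) (g : G) :
    (mfderiv 𝓘(ℝ, A) 𝓘(ℝ, E) (fun k : G => k • p) g : A →L[ℝ] E).ker ≤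
      (mfderiv 𝓘(ℝ, A) 𝓘(ℝ, E) (fun k : G => k • q) g : A →L[ℝ] E).ker := by
  rw [(hasMFDerivAt_orbitMap p g).mfderiv, (hasMFDerivAt_orbitMap q g).mfderiv]
  intro v hv
  have h1 : smulDeriv A E g p (infAct A G E p (smulDeriv A A g⁻¹ g v)) = 0 := hv
  have h2 := h (LinearMap.mem_ker.2 (by simpa using h1) : smulDeriv A A g⁻¹ g v ∈ _)
  change smulDeriv A E g q (infAct A G E q (smulDeriv A A g⁻¹ g v)) = 0
  rw [show infAct A G E q (smulDeriv A A g⁻¹ g v) = 0 from h2, map_zero]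

theorem finrank_ker_orbitMap (p : M) (g : G) :
    Module.finrank ℝ (mfderiv 𝓘(ℝ, A) 𝓘(ℝ, E) (fun k : G => k • p) g : A →L[ℝ] E).ker =
      Module.finrank ℝ (infAct A G E p).ker := by
  rw [(hasMFDerivAt_orbitMap p g).mfderiv]
  refine LinearEquiv.finrank_eq (LinearEquiv.ofSubmodules (smulDeriv A A g⁻¹ g).toLinearEquiv _ _ ?_)
  ext v
  simp only [LinearMap.mem_ker]
  constructor
  · rintro ⟨w, hw, rfl⟩
    have h1 : smulDeriv A E g p (infAct A G E p (smulDeriv A A g⁻¹ g w)) = 0 := hw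
    simpa using h1
  · intro hv
    refine ⟨(smulDeriv A A g⁻¹ g).symm v, ?_, by simp⟩
    change smulDeriv A E g p (infAct A G E p (smulDeriv A A g⁻¹ g _)) = 0
    simpa using hv

theorem finrank_range_infAct_le [FiniteDimensional ℝ E] (g : G) (p : M) :
    Module.finrank ℝ (infAct A G E p).range ≤ Module.finrank ℝ (infAct A G E (g • p)).range := by
  obtain ⟨Ad, hAd⟩ := smulDeriv_infAct (A := A) (E := E) g p
  rw [← LinearEquiv.finrank_map_eq (smulDeriv A E g p).toLinearEquiv]
  refine Submodule.finrank_mono ?_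
  rintro _ ⟨_, ⟨ξ, rfl⟩, rfl⟩
  exact ⟨Ad ξ, (hAd ξ).symm⟩

theorem finrank_range_infAct_smul [FiniteDimensional ℝ E] (g : G) (p : M) :
    Module.finrank ℝ (infAct A G E (g • p)).range = Module.finrank ℝ (infAct A G E p).range := by
  refine le_antisymm ?_ (finrank_range_infAct_le g p)
  have h := finrank_range_infAct_le (A := A) (E := E) g⁻¹ (g • p)
  rwa [inv_smul_smul] at h

theorem finrank_ker_infAct_smul [FiniteDimensional ℝ A] [FiniteDimensional ℝ E] (g : G) (p : M) :
    Module.finrank ℝ (infAct A G E (g • p)).ker = Module.finrank ℝ (infAct A G E p).ker := by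
  have h1 := LinearMap.finrank_range_add_finrank_ker (infAct A G E (g • p)).toLinearMap
  have h2 := LinearMap.finrank_range_add_finrank_ker (infAct A G E p).toLinearMap
  have h3 := finrank_range_infAct_smul (A := A) (E := E) g p
  omega

variable [IsManifold 𝓘(ℝ, E) ∞ M]

/-- A path of elements fixing `p` moves no point `q` whose infinitesimal isotropy contains
that of `p`. -/
theorem smul_eq_smul_of_stabilizer_path {F : Type*} [NormedAddCommGroup F] [NormedSpace ℝ F]
    {s : Set F} (hs : IsOpen s) (hs' : IsPreconnected s) {γ : F → G}
    (hγ : ContMDiffOn 𝓘(ℝ, F) 𝓘(ℝ, A) ∞ γ s) {p q : M}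
    (hγp : ∀ y ∈ s, mfderiv 𝓘(ℝ, F) 𝓘(ℝ, E) (fun y => γ y • p) y = (0 : F →L[ℝ] E))
    (h : (infAct A G E p).ker ≤ (infAct A G E q).ker) {y z : F} (hy : y ∈ s)
    (hz : z ∈ s) : γ y • q = γ z • q := by
  refine eq_of_hasMFDerivAt_zero (E := E) (f := fun y => γ y • q) hs hs' (fun x hx => ?_) hy hz
  have h1 := ((hγ.contMDiffAt (hs.mem_nhds hx)).mdifferentiableAt (by simp)).hasMFDerivAt
  have hq := ((contMDiff_orbitMap (A := A) (E := E) q).mdifferentiable (by simp)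
    (γ x)).hasMFDerivAt.comp x h1
  have hp := ((contMDiff_orbitMap (A := A) (E := E) p).mdifferentiable (by simp)
    (γ x)).hasMFDerivAt.comp x h1
  have hp' := hp.mfderiv.symm.trans (hγp x hx)
  refine HasMFDerivAt.congr_mfderiv hq (ContinuousLinearMap.ext fun v => ?_)
  have h2 := ker_orbitMap_le h (γ x)
    (LinearMap.mem_ker.2 (DFunLike.congr_fun hp' v :))
  exact LinearMap.mem_ker.1 h2

end Action

/-- A linear map between finite-dimensional spaces has a reflexive generalized inverse. -/
theorem exists_reflexive_inverse {A E : Type*} [NormedAddCommGroup A] [NormedSpace ℝ A]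
    [NormedAddCommGroup E] [NormedSpace ℝ E] [FiniteDimensional ℝ E] (f : A →L[ℝ] E) :
    ∃ l : E →L[ℝ] A, (∀ v, f (l (f v)) = f v) ∧ ∀ w, l (f (l w)) = l w := by
  obtain ⟨r, hr⟩ := f.toLinearMap.rangeRestrict.exists_rightInverse_of_surjective
    f.toLinearMap.range_rangeRestrict
  obtain ⟨l, hl⟩ := r.exists_extend
  have h1 : ∀ v, f (l (f v)) = f v := fun v => by
    have h2 := DFunLike.congr_fun hl (f.toLinearMap.rangeRestrict v)
    have h3 := congrArg Subtype.val (DFunLike.congr_fun hr (f.toLinearMap.rangeRestrict v))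
    simp only [LinearMap.comp_apply, Submodule.subtype_apply, LinearMap.codRestrict_apply,
      LinearMap.id_apply, LinearMap.rangeRestrict] at h2 h3
    rw [← h2] at h3
    exact h3
  -- `l` itself is only known to satisfy f l f = f; replacing it by l f l gives the second identity
  -- as well.
  refine ⟨LinearMap.toContinuousLinearMap (l ∘ₗ f.toLinearMap ∘ₗ l), fun v => ?_, fun w => ?_⟩
  · simp [h1]
  · simp [h1]

theorem hasFDerivAt_clm_sub {E F : Type*} [NormedAddCommGroup E] [NormedSpace ℝ E]
    [NormedAddCommGroup F] [NormedSpace ℝ F] (l : E →L[ℝ] F) (c x : E) :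
    HasFDerivAt (fun u => l (u - c)) l x :=
  (l.hasFDerivAt.comp x ((hasFDerivAt_id x).sub_const c)).congr_fderiv l.comp_id

/-! ### Constant rank normal form of the orbit map -/

section Straightening

variable {A : Type*} [NormedAddCommGroup A] [NormedSpace ℝ A] [FiniteDimensional ℝ A]
  {G : Type*} [TopologicalSpace G] [ChartedSpace A G] [Group G] [LieGroup 𝓘(ℝ, A) ∞ G]
  {E : Type*} [NormedAddCommGroup E] [NormedSpace ℝ E] [FiniteDimensional ℝ E]
  {M : Type*} [TopologicalSpace M] [ChartedSpace E M] [MulAction G M]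
  [ContMDiffSMul 𝓘(ℝ, A) 𝓘(ℝ, E) ∞ G M] [IsManifold 𝓘(ℝ, E) ∞ M]

variable (A E) in
/-- Coordinates on `G` near `1` straightening the orbit map `g ↦ g • p`: in these coordinates it
factors through a linear projection `pr` whose kernel is the infinitesimal isotropy of `p`, and the
induced map on the image of `pr` is injective. -/
structure OrbitStraightening (p : M) (θ : OpenPartialHomeomorph G A) (pr : A →L[ℝ] A) : Prop where
  idem : ∀ z, pr (pr z) = pr z
  ker_eq : pr.ker = (infAct A G E p).ker
  one_mem : (1 : G) ∈ θ.source
  map_one : θ 1 = 0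
  target_eq : ∃ ε > 0, θ.target = Metric.ball 0 ε
  contMDiffOn_symm : ContMDiffOn 𝓘(ℝ, A) 𝓘(ℝ, A) ∞ θ.symm θ.target
  hasMFDerivAt_symm : HasMFDerivAt 𝓘(ℝ, A) 𝓘(ℝ, A) θ.symm 0 (ContinuousLinearMap.id ℝ A)
  smul_eq_iff : ∀ z ∈ θ.target, ∀ z' ∈ θ.target, θ.symm z • p = θ.symm z' • p ↔ pr z = pr z'

variable (A E) in
-- This is the constant rank theorem for the orbit map. The projection is l ∘ `infAct`, with `l` a
-- reflexive inverse of the infinitesimal action.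
theorem exists_orbitStraightening (p : M) :
    ∃ (θ : OpenPartialHomeomorph G A) (pr : A →L[ℝ] A), OrbitStraightening A E p θ pr := by
  obtain ⟨l, hl1, hl2⟩ := exists_reflexive_inverse (infAct A G E p)
  let pr : A →L[ℝ] A := l.comp (infAct A G E p)
  have hidem : ∀ z, pr (pr z) = pr z := fun z => congrArg l (hl1 z)
  have hker : pr.ker = (infAct A G E p).ker := by
    ext z
    simp only [LinearMap.mem_ker]
    constructor
    · intro h
      have h' : infAct A G E p (l (infAct A G E p z)) = infAct A G E p 0 :=
        congrArg (infAct A G E p) h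
      rwa [hl1, map_zero] at h'
    · intro h
      change l (infAct A G E p z) = 0
      rw [show infAct A G E p z = 0 from h, map_zero]
  let φ := chartAt E p
  let c := chartAt A (1 : G)
  let W : Set G := c.source ∩ (fun g : G => g • p) ⁻¹' φ.source
  have ho : ContMDiff 𝓘(ℝ, A) 𝓘(ℝ, E) ∞ (fun g : G => g • p) := contMDiff_orbitMap p
  have hW : IsOpen W := c.open_source.inter (φ.open_source.preimage ho.continuous)
  have h1W : (1 : G) ∈ W :=
    ⟨mem_chart_source A 1, by
      simpa only [Set.mem_preimage, one_smul] using mem_chart_source E p⟩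
  let X : G → A := fun g => l (φ (g • p) - φ p)
  -- `X` supplies the coordinates in the image of `pr`, the chart of `G` those in its kernel. Since
  -- l ∘ infAct ∘ l = l, the `pr`-component of `f` is exactly `X`, and the derivative of `f` at 1 is
  -- pr + (1 - pr).
  let f : G → A := fun g => X g + ((c g - c 1) - pr (c g - c 1))
  have hφo : ContMDiffOn 𝓘(ℝ, A) 𝓘(ℝ, E) ∞ (fun g : G => φ (g • p)) W :=
    (contMDiffOn_chart (I := 𝓘(ℝ, E)) (x := p)).comp ho.contMDiffOn Set.inter_subset_right
  have hcW : ContMDiffOn 𝓘(ℝ, A) 𝓘(ℝ, A) ∞ c W :=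
    (contMDiffOn_chart (I := 𝓘(ℝ, A)) (x := (1 : G))).mono Set.inter_subset_left
  have hXs : ContMDiffOn 𝓘(ℝ, A) 𝓘(ℝ, A) ∞ X W :=
    l.contMDiff.comp_contMDiffOn (hφo.sub contMDiffOn_const)
  have hfs : ContMDiffOn 𝓘(ℝ, A) 𝓘(ℝ, A) ∞ f W :=
    hXs.add ((hcW.sub contMDiffOn_const).sub
      (pr.contMDiff.comp_contMDiffOn (hcW.sub contMDiffOn_const)))
  have hprX : ∀ g, pr (f g) = X g := fun g => by
    have : pr (X g) = X g := hl2 _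
    simp only [f, map_add, map_sub, hidem, this]
    abel
  have hf1 : f 1 = 0 := by simp [f, X]
  have hdf : HasMFDerivAt 𝓘(ℝ, A) 𝓘(ℝ, A) f 1 (ContinuousLinearMap.id ℝ A) := by
    have h1 : HasMFDerivAt 𝓘(ℝ, E) 𝓘(ℝ, E) (extChartAt 𝓘(ℝ, E) p) p
        (ContinuousLinearMap.id ℝ E) := by
      have := (mdifferentiableAt_extChartAt (I := 𝓘(ℝ, E)) (mem_chart_source E p)).hasMFDerivAt
      rwa [mfderiv_extChartAt_self] at this
    have h2 : HasMFDerivAt 𝓘(ℝ, A) 𝓘(ℝ, A) (extChartAt 𝓘(ℝ, A) (1 : G)) 1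
        (ContinuousLinearMap.id ℝ A) := by
      have := (mdifferentiableAt_extChartAt (I := 𝓘(ℝ, A)) (mem_chart_source A (1 : G))).hasMFDerivAt
      rwa [mfderiv_extChartAt_self] at this
    have h3 := hasMFDerivAt_comp_of_eq h1 (hasMFDerivAt_orbitMap_one (A := A) (G := G) (E := E) p)
      (one_smul G p)
    have h4 : HasFDerivAt (fun u : E => l (u - φ p)) l (φ p) :=
      hasFDerivAt_clm_sub l _ _
    have h5 : HasFDerivAt (fun v : A => (v - c 1) - pr (v - c 1))
        (ContinuousLinearMap.id ℝ A - pr) (c 1) :=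
      ((hasFDerivAt_id _).sub_const _).sub (hasFDerivAt_clm_sub pr _ _)
    have h6 := hasMFDerivAt_comp_of_eq h4.hasMFDerivAt h3 (by simp [φ, extChartAt])
    have h7 := hasMFDerivAt_comp_of_eq h5.hasMFDerivAt h2 (by simp [c, extChartAt])
    have h8 := h6.add h7
    have h9 : (l.comp ((ContinuousLinearMap.id ℝ E).comp (infAct A G E p))) +
        (ContinuousLinearMap.id ℝ A - pr).comp (ContinuousLinearMap.id ℝ A) =
        ContinuousLinearMap.id ℝ A := by
      ext z
      simp [pr]
    exact (h8.congr_mfderiv h9).congr_of_eventuallyEq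
      (Filter.Eventually.of_forall fun g => by simp [f, X, extChartAt, φ, c])
  obtain ⟨e, he1, heW, hef, hes, hes'⟩ := exists_openPartialHomeomorph_of_contMDiffOn hW h1W hfs
    (ContinuousLinearEquiv.refl ℝ A) hdf
  have h0t : (0 : A) ∈ e.target := by
    have := e.map_source he1
    rwa [hef 1 he1, hf1] at this
  -- A ball is convex, so two target points with the same image under `pr` are joined by a segment
  -- inside the target.
  obtain ⟨ε, hε, hball⟩ := Metric.isOpen_iff.1 e.open_target 0 h0t
  have he0 : e.symm 0 = 1 := by
    rw [← hf1, ← hef 1 he1, e.left_inv he1]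
  let θ := (e.symm.restrOpen (Metric.ball 0 ε) Metric.isOpen_ball).symm
  have htgt : θ.target = Metric.ball 0 ε := by
    change e.target ∩ Metric.ball 0 ε = _
    exact Set.inter_eq_right.2 hball
  have hsymm : ∀ z, θ.symm z = e.symm z := fun z => rfl
  have hte : θ.target ⊆ e.target := htgt ▸ hball
  -- Here constant rank enters. `X` factors through the orbit map, which gives one inclusion of
  -- kernels; both kernels have the dimension of ker `pr`, so they coincide.
  have hdker : ∀ z ∈ e.target, ∀ v : A,
      (mfderiv 𝓘(ℝ, A) 𝓘(ℝ, A) X (e.symm z) : A →L[ℝ] A) v = 0 →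
      (mfderiv 𝓘(ℝ, A) 𝓘(ℝ, E) (fun k : G => k • p) (e.symm z) : A →L[ℝ] E) v = 0 := by
    intro z hz
    set g := e.symm z with hg
    have hgs : g ∈ e.source := e.map_target hz
    have hgW : g ∈ W := heW hgs
    have hDe : e.MDifferentiable 𝓘(ℝ, A) 𝓘(ℝ, A) :=
      ⟨hes.mdifferentiableOn (by simp), hes'.mdifferentiableOn (by simp)⟩
    let De : A →L[ℝ] A := mfderiv 𝓘(ℝ, A) 𝓘(ℝ, A) e g
    have hinj : Function.Injective De.toLinearMap := hDe.mfderiv_injective hgs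
    have hX1 : HasMFDerivAt 𝓘(ℝ, A) 𝓘(ℝ, A) X g
        (pr.comp De) := by
      have := hasMFDerivAt_comp_of_eq (x := g) pr.hasFDerivAt.hasMFDerivAt
        (hDe.mdifferentiableAt hgs).hasMFDerivAt rfl
      refine this.congr_of_eventuallyEq ?_
      filter_upwards [e.open_source.mem_nhds hgs] with k hk
      rw [Function.comp_apply, hef k hk, hprX]
    let D : A →L[ℝ] E := mfderiv 𝓘(ℝ, A) 𝓘(ℝ, E) (fun k : G => k • p) g
    let DX : A →L[ℝ] A := mfderiv 𝓘(ℝ, A) 𝓘(ℝ, A) X g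
    have hle : D.ker ≤ DX.ker := by
      have hφd := ((contMDiffOn_chart (I := 𝓘(ℝ, E)) (x := p)).contMDiffAt
        (φ.open_source.mem_nhds hgW.2)).mdifferentiableAt (n := ∞) (by simp) |>.hasMFDerivAt
      have h1 := hasMFDerivAt_comp_of_eq hφd (ho.mdifferentiable (by simp) g).hasMFDerivAt rfl
      have h4 : HasFDerivAt (fun u : E => l (u - φ p)) l (φ (g • p)) :=
        hasFDerivAt_clm_sub l _ _
      have h2 := hasMFDerivAt_comp_of_eq h4.hasMFDerivAt h1 rfl
      let Dφ : E →L[ℝ] E := mfderiv 𝓘(ℝ, E) 𝓘(ℝ, E) φ (g • p)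
      have h3 : DX = l.comp (Dφ.comp D) := h2.mfderiv
      intro v hv
      rw [h3]
      rw [LinearMap.mem_ker] at hv ⊢
      change l (Dφ (D v)) = 0
      rw [show D v = 0 from hv, map_zero, map_zero]
    have hfin : Module.finrank ℝ DX.ker ≤ Module.finrank ℝ D.ker := by
      rw [show Module.finrank ℝ D.ker = Module.finrank ℝ pr.ker by
        rw [hker]; exact finrank_ker_orbitMap p g]
      rw [(Submodule.equivMapOfInjective De.toLinearMap hinj DX.ker).finrank_eq]
      refine Submodule.finrank_mono ?_
      rintro _ ⟨v, hv, rfl⟩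
      have h5 : DX v = 0 := hv
      rw [show DX = _ from hX1.mfderiv] at h5
      exact h5
    have heq := Submodule.eq_of_le_of_finrank_le hle hfin
    intro v hv
    have : v ∈ D.ker := heq ▸ (LinearMap.mem_ker.2 hv)
    exact this
  refine ⟨θ, pr, hidem, hker, ?_, ?_, ⟨ε, hε, htgt⟩, ?_, ?_, ?_⟩
  · have h0 : (0 : A) ∈ θ.target := by rw [htgt]; exact Metric.mem_ball_self hε
    have := θ.map_target h0
    rwa [hsymm, he0] at this
  · change e 1 = 0
    rw [hef 1 he1, hf1]
  · exact hes'.mono hte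
  · have h1 := ((hes'.contMDiffAt (e.open_target.mem_nhds h0t)).mdifferentiableAt
      (by simp)).hasMFDerivAt
    have h2 := (hdf.congr_of_eventuallyEq (f₁ := e)
      (Filter.eventuallyEq_of_mem (e.open_source.mem_nhds he1) hef))
    have h3 := hasMFDerivAt_comp_of_eq h2 h1 he0
    have h4 : HasMFDerivAt 𝓘(ℝ, A) 𝓘(ℝ, A) (e ∘ e.symm) (0 : A) (ContinuousLinearMap.id ℝ A) := by
      refine (hasMFDerivAt_id (0 : A)).congr_of_eventuallyEq ?_
      filter_upwards [e.open_target.mem_nhds h0t] with z hz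
      simp [e.right_inv hz]
    have h5 := hasMFDerivAt_unique h3 h4
    exact h1.congr_mfderiv h5
  · intro z hz z' hz'
    have hpz : ∀ z ∈ θ.target, pr z = X (e.symm z) := fun z hz => by
      rw [← hprX, ← hef _ (e.map_target (hte hz)), e.right_inv (hte hz)]
    constructor
    · intro h
      rw [hpz z hz, hpz z' hz']
      simp only [X]
      rw [hsymm, hsymm] at h
      rw [h]
    · intro h
      let s : Set ℝ := AffineMap.lineMap z z' ⁻¹' (θ.target)
      have hs : IsOpen s := θ.open_target.preimage AffineMap.lineMap_continuous
      have hsc : Convex ℝ s := by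
        simp only [s, htgt]
        exact (convex_ball _ _).affine_preimage _
      have hlin : ContDiff ℝ ∞ (AffineMap.lineMap z z' : ℝ → A) := by
        simp only [AffineMap.coe_lineMap, vsub_eq_sub, vadd_eq_add]
        fun_prop
      have hγ : ContMDiffOn 𝓘(ℝ, ℝ) 𝓘(ℝ, A) ∞ (fun t : ℝ => e.symm (AffineMap.lineMap z z' t)) s :=
        hes'.comp hlin.contMDiff.contMDiffOn (fun t ht => hte ht)
      -- Along the segment `pr`, hence `X`, is constant, so by `hdker` the point moved along the
      -- orbit has zero velocity.
      have key := smul_eq_smul_of_stabilizer_path (E := E) hs hsc.isPreconnected hγ (p := p) (q := p)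
        ?_ le_rfl (y := 0) (z := 1) (by simpa [s] using hz) (by simpa [s] using hz')
      · simpa [hsymm] using key
      · intro t ht
        have hγd := ((hγ.contMDiffAt (hs.mem_nhds ht)).mdifferentiableAt (by simp)).hasMFDerivAt
        have h1 := hasMFDerivAt_comp_of_eq ((ho.mdifferentiable (by simp) _).hasMFDerivAt) hγd rfl
        have hXd := ((hXs.contMDiffAt (hW.mem_nhds (heW (e.map_target (hte ht))))).mdifferentiableAt
          (by simp)).hasMFDerivAt
        have h2 := hasMFDerivAt_comp_of_eq hXd hγd rfl
        have h3 : HasMFDerivAt 𝓘(ℝ, ℝ) 𝓘(ℝ, A)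
            (X ∘ fun t : ℝ => e.symm (AffineMap.lineMap z z' t)) t (0 : ℝ →L[ℝ] A) := by
          refine (hasMFDerivAt_const (pr z) t).congr_of_eventuallyEq ?_
          filter_upwards [hs.mem_nhds ht] with r hr
          rw [Function.comp_apply, ← hpz _ hr]
          simp [AffineMap.lineMap_apply, h]
        have h4 := hasMFDerivAt_unique h2 h3
        refine h1.mfderiv.trans (ContinuousLinearMap.ext fun v => ?_)
        exact hdker _ (hte ht) _ (DFunLike.congr_fun h4 v)

end Straightening

section

variable {A : Type*} [NormedAddCommGroup A] [NormedSpace ℝ A]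
  {G : Type*} [TopologicalSpace G] [ChartedSpace A G] [Group G]
  {E : Type*} [NormedAddCommGroup E] [NormedSpace ℝ E]
  {M : Type*} [TopologicalSpace M] [ChartedSpace E M] [MulAction G M]

namespace OrbitStraightening

variable {p : M} {θ : OpenPartialHomeomorph G A} {pr : A →L[ℝ] A}

theorem zero_mem (h : OrbitStraightening A E p θ pr) : (0 : A) ∈ θ.target :=
  h.map_one ▸ θ.map_source h.one_mem

theorem symm_zero (h : OrbitStraightening A E p θ pr) : θ.symm 0 = 1 := by
  rw [← h.map_one, θ.left_inv h.one_mem]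

end OrbitStraightening

end

/-! ### Isotropy groups and infinitesimal isotropy -/

section Isotropy

variable {A : Type*} [NormedAddCommGroup A] [NormedSpace ℝ A] [FiniteDimensional ℝ A]
  {G : Type*} [TopologicalSpace G] [ChartedSpace A G] [Group G] [LieGroup 𝓘(ℝ, A) ∞ G]
  {E : Type*} [NormedAddCommGroup E] [NormedSpace ℝ E] [FiniteDimensional ℝ E]
  {M : Type*} [TopologicalSpace M] [ChartedSpace E M] [MulAction G M]
  [ContMDiffSMul 𝓘(ℝ, A) 𝓘(ℝ, E) ∞ G M] [IsManifold 𝓘(ℝ, E) ∞ M]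

variable (A E) in
/-- The infinitesimal isotropy is monotone in the isotropy group. -/
theorem ker_infAct_le_of_stabilizer_le {p q : M}
    (h : MulAction.stabilizer G p ≤ MulAction.stabilizer G q) :
    (infAct A G E p).ker ≤ (infAct A G E q).ker := by
  obtain ⟨θ, pr, hθ⟩ := exists_orbitStraightening A (G := G) E p
  intro ζ hζ
  rw [← hθ.ker_eq, LinearMap.mem_ker] at hζ
  have hζ' : pr ζ = 0 := hζ
  -- The curve t ↦ θ⁻¹(tζ) has velocity ζ at 1 and, as pr ζ = 0, stays in the isotropy group of `p`,
  -- hence in that of `q`.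
  have h1 : HasFDerivAt (fun t : ℝ => t • ζ) (ContinuousLinearMap.toSpanSingleton ℝ ζ) 0 :=
    (ContinuousLinearMap.toSpanSingleton ℝ ζ).hasFDerivAt
  have h2 := hasMFDerivAt_comp_of_eq hθ.hasMFDerivAt_symm h1.hasMFDerivAt (zero_smul ℝ ζ)
  have h3 := hasMFDerivAt_comp_of_eq (hasMFDerivAt_orbitMap_one (A := A) (G := G) (E := E) q) h2
    (by simp [hθ.symm_zero])
  have h4 : HasMFDerivAt 𝓘(ℝ, ℝ) 𝓘(ℝ, E)
      ((fun g : G => g • q) ∘ (θ.symm ∘ fun t : ℝ => t • ζ)) 0 (0 : ℝ →L[ℝ] E) := by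
    refine (hasMFDerivAt_const q (0 : ℝ)).congr_of_eventuallyEq ?_
    have : ∀ᶠ t : ℝ in 𝓝 0, t • ζ ∈ θ.target := by
      refine h1.continuousAt.preimage_mem_nhds (θ.open_target.mem_nhds ?_)
      simpa using hθ.zero_mem
    filter_upwards [this] with t ht
    have h5 := (hθ.smul_eq_iff _ ht 0 hθ.zero_mem).2 (by simp [hζ'])
    rw [hθ.symm_zero, one_smul] at h5
    exact h (MulAction.mem_stabilizer_iff.2 h5)
  have h5 := DFunLike.congr_fun (hasMFDerivAt_unique h3 h4) (1 : ℝ)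
  have h6 : infAct A G E q ((1 : ℝ) • ζ) = 0 := h5
  rwa [one_smul] at h6

variable (A E) in
/-- Elements near `1` of the isotropy group of `p` fix every point whose infinitesimal isotropy
contains that of `p`. -/
theorem exists_nhds_one_forall_smul_eq (p : M) :
    ∃ O ∈ 𝓝 (1 : G), ∀ g ∈ O, g • p = p → ∀ q : M,
      (infAct A G E p).ker ≤ (infAct A G E q).ker → g • q = q := by
  obtain ⟨θ, pr, hθ⟩ := exists_orbitStraightening A (G := G) E p
  obtain ⟨ε, hε, htgt⟩ := hθ.target_eq
  refine ⟨θ.source, θ.open_source.mem_nhds hθ.one_mem, fun g hg hgp q hq => ?_⟩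
  have hz := θ.map_source hg
  have hpz : pr (θ g) = 0 := by
    have := (hθ.smul_eq_iff _ hz 0 hθ.zero_mem).1
      (by rw [θ.left_inv hg, hθ.symm_zero, hgp, one_smul])
    simpa using this
  -- The segment from 0 to `θ g` lies in ker `pr`, so it describes a path from 1 to `g` inside the
  -- isotropy group of `p`.
  let s : Set ℝ := (fun t : ℝ => t • θ g) ⁻¹' θ.target
  have hs : IsOpen s := θ.open_target.preimage (by fun_prop)
  have hsc : Convex ℝ s := by
    simp only [s, htgt]
    exact (convex_ball (0 : A) ε).linear_preimage (LinearMap.toSpanSingleton ℝ A (θ g))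
  have hlin : ContDiff ℝ ∞ (fun t : ℝ => t • θ g) := by fun_prop
  have hγ : ContMDiffOn 𝓘(ℝ, ℝ) 𝓘(ℝ, A) ∞ (fun t : ℝ => θ.symm (t • θ g)) s :=
    hθ.contMDiffOn_symm.comp hlin.contMDiff.contMDiffOn (fun t ht => ht)
  have key := smul_eq_smul_of_stabilizer_path (E := E) hs hsc.isPreconnected hγ (p := p) (q := q)
    (fun t ht => ?_) hq (y := 1) (z := 0) (by simpa [s] using hz) (by simpa [s] using hθ.zero_mem)
  · simpa [θ.left_inv hg, hθ.symm_zero] using key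
  · have h3 : HasMFDerivAt 𝓘(ℝ, ℝ) 𝓘(ℝ, E) (fun t : ℝ => θ.symm (t • θ g) • p) t
        (0 : ℝ →L[ℝ] E) := by
      refine (hasMFDerivAt_const p t).congr_of_eventuallyEq ?_
      filter_upwards [hs.mem_nhds ht] with r hr
      have h5 := (hθ.smul_eq_iff _ hr 0 hθ.zero_mem).2 (by simp [hpz])
      rwa [hθ.symm_zero, one_smul] at h5
    exact h3.mfderiv

theorem isCompact_stabilizer {G M : Type*} [TopologicalSpace G] [Group G] [TopologicalSpace M]
    [MulAction G M] [ProperSMul G M] (p : M) : IsCompact (MulAction.stabilizer G p : Set G) := by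
  have h := (ProperSMul.isProperMap_smul_pair (G := G) (X := M)).isCompact_preimage
    (isCompact_singleton (x := (p, p)))
  convert! h.image continuous_fst using 1
  ext g
  simp

/-- An isotropy group of a proper action is not conjugate to a proper subgroup of itself. -/
theorem stabilizer_smul_eq_of_le (A : Type*) [NormedAddCommGroup A] [NormedSpace ℝ A] [FiniteDimensional ℝ A]
    {G : Type*} [TopologicalSpace G] [ChartedSpace A G] [Group G] [LieGroup 𝓘(ℝ, A) ∞ G]
    (E : Type*) [NormedAddCommGroup E] [NormedSpace ℝ E] [FiniteDimensional ℝ E]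
    {M : Type*} [TopologicalSpace M] [ChartedSpace E M] [MulAction G M]
    [ContMDiffSMul 𝓘(ℝ, A) 𝓘(ℝ, E) ∞ G M] [IsManifold 𝓘(ℝ, E) ∞ M] [ProperSMul G M]
    {p : M} {k : G}
    (h : MulAction.stabilizer G (k • p) ≤ MulAction.stabilizer G p) :
    MulAction.stabilizer G (k • p) = MulAction.stabilizer G p := by
  have := topologicalGroup_of_lieGroup (G := G) 𝓘(ℝ, A) ∞
  -- The conjugates `S i` descend with the same index at every step. If their intersection has
  -- finite index in `S 0`, that common index must be 1.
  let S : ℕ → Subgroup G := fun i => MulAction.stabilizer G (k ^ i • p)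
  have hS : ∀ i, S (i + 1) = (S i).map (MulAut.conj k).toMonoidHom := fun i => by
    simp only [S]
    rw [pow_succ', mul_smul, MulAction.stabilizer_smul_eq_stabilizer_map_conj]
  have hmono : ∀ i, S (i + 1) ≤ S i := by
    intro i
    induction i with
    | zero => simpa [S] using h
    | succ i ih =>
      rw [hS (i + 1), hS i]
      exact Subgroup.map_mono (hS i ▸ ih)
  have hle : ∀ i, S i ≤ S 0 := fun i => (antitone_nat_of_succ_le hmono) (Nat.zero_le i)
  -- Conjugate isotropy groups have infinitesimal isotropy of equal dimension, so the inclusion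
  -- along the chain is an equality.
  have hker : ∀ i, (infAct A G E p).ker ≤ (infAct A G E (k ^ i • p)).ker := fun i => by
    have h1 := ker_infAct_le_of_stabilizer_le A E (p := k ^ i • p) (q := p) (by simpa [S] using hle i)
    exact (Submodule.eq_of_le_of_finrank_le h1 (finrank_ker_infAct_smul _ _).ge).ge
  obtain ⟨O, hO, hOS⟩ := exists_nhds_one_forall_smul_eq A (G := G) E p
  let J : Subgroup G := ⨅ i, S i
  -- By `hker`, elements of `S 0` near 1 fix all the points `k ^ i • p`. So `J` is open in the
  -- compact group `S 0`.
  have hJ : J.relIndex (S 0) ≠ 0 := by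
    have hcomp : CompactSpace (S 0) := isCompact_iff_compactSpace.1 (isCompact_stabilizer _)
    have hopen : IsOpen (J.subgroupOf (S 0) : Set (S 0)) := by
      refine Subgroup.isOpen_of_mem_nhds _ (g := 1) ?_
      filter_upwards [continuous_subtype_val.continuousAt.preimage_mem_nhds
        (show O ∈ 𝓝 ((1 : S 0) : G) from hO)] with g hg
      refine Subgroup.mem_subgroupOf.2 (Subgroup.mem_iInf.2 fun i => ?_)
      refine hOS g hg ?_ _ (hker i)
      simpa [S] using g.2
    have : Finite ((S 0) ⧸ J.subgroupOf (S 0)) := Subgroup.quotient_finite_of_isOpen _ hopen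
    exact Subgroup.index_ne_zero_of_finite
  have hindex : ∀ i, (S i).relIndex (S 0) = (S 1).relIndex (S 0) ^ i := by
    intro i
    induction i with
    | zero => simp
    | succ i ih =>
      have h1 : (S (i + 1)).relIndex (S i) = (S 1).relIndex (S 0) := by
        clear ih
        induction i with
        | zero => rfl
        | succ i ih =>
          rw [← ih, hS (i + 1), hS i]
          exact Subgroup.relIndex_map_map_of_injective _ _ (MulAut.conj k).injective
      rw [pow_succ', ← ih, ← h1, Subgroup.relIndex_mul_relIndex _ _ _ (hmono i) (hle i)]
  have hbound : ∀ i, (S 1).relIndex (S 0) ^ i ≤ J.relIndex (S 0) := fun i => by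
    rw [← hindex, ← Subgroup.relIndex_mul_relIndex J (S i) (S 0) (iInf_le _ i) (hle i)]
    refine Nat.le_mul_of_pos_left _ (Nat.pos_of_ne_zero fun h0 => hJ ?_)
    rw [← Subgroup.relIndex_mul_relIndex J (S i) (S 0) (iInf_le _ i) (hle i), h0, zero_mul]
  have hne : (S 1).relIndex (S 0) ≠ 0 := fun h0 => hJ (by
    rw [← Subgroup.relIndex_mul_relIndex J (S 1) (S 0) (iInf_le _ 1) (hle 1), h0, mul_zero])
  have hone : (S 1).relIndex (S 0) = 1 := by
    by_contra hne1
    have h2 : 1 < (S 1).relIndex (S 0) := by omega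
    have := (Nat.lt_pow_self h2 (n := J.relIndex (S 0))).trans_le (hbound _)
    exact lt_irrefl _ this
  refine le_antisymm h ?_
  have := Subgroup.relIndex_eq_one.1 hone
  simpa [S] using this

/-- If the isotropy group of `q` is conjugate to that of `p` and contained in it, they agree. -/
theorem stabilizer_eq_of_le_of_conj (A : Type*) [NormedAddCommGroup A] [NormedSpace ℝ A] [FiniteDimensional ℝ A]
    {G : Type*} [TopologicalSpace G] [ChartedSpace A G] [Group G] [LieGroup 𝓘(ℝ, A) ∞ G]
    (E : Type*) [NormedAddCommGroup E] [NormedSpace ℝ E] [FiniteDimensional ℝ E]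
    {M : Type*} [TopologicalSpace M] [ChartedSpace E M] [MulAction G M]
    [ContMDiffSMul 𝓘(ℝ, A) 𝓘(ℝ, E) ∞ G M] [IsManifold 𝓘(ℝ, E) ∞ M] [ProperSMul G M]
    {p q : M} {k : G}
    (hk : MulAction.stabilizer G q = (MulAction.stabilizer G p).map (MulAut.conj k).toMonoidHom)
    (h : MulAction.stabilizer G q ≤ MulAction.stabilizer G p) :
    MulAction.stabilizer G q = MulAction.stabilizer G p := by
  rw [← MulAction.stabilizer_smul_eq_stabilizer_map_conj] at hk
  rw [hk] at h ⊢
  exact stabilizer_smul_eq_of_le A E h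

variable (A E) in
/-- Points with conjugate isotropy groups have orbits of the same dimension. -/
theorem finrank_range_infAct_eq_of_conj {p q : M} {k : G}
    (hk : MulAction.stabilizer G q = (MulAction.stabilizer G p).map (MulAut.conj k).toMonoidHom) :
    Module.finrank ℝ (infAct A G E q).range = Module.finrank ℝ (infAct A G E p).range := by
  rw [← MulAction.stabilizer_smul_eq_stabilizer_map_conj] at hk
  have h1 : (infAct A G E q).ker = (infAct A G E (k • p)).ker :=
    le_antisymm (ker_infAct_le_of_stabilizer_le A E hk.le) (ker_infAct_le_of_stabilizer_le A E hk.ge)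
  have h2 := LinearMap.finrank_range_add_finrank_ker (infAct A G E q).toLinearMap
  have h3 := LinearMap.finrank_range_add_finrank_ker (infAct A G E p).toLinearMap
  have h4 := finrank_ker_infAct_smul (A := A) (E := E) k p
  rw [h1] at h2
  omega

end Isotropy

/-! ### Haar measure and invariant neighbourhoods for compact groups -/

section Averaging

open MeasureTheory

theorem exists_isMulLeftInvariant_isProbabilityMeasure (H : Type*) [Group H] [TopologicalSpace H]
    [IsTopologicalGroup H] [CompactSpace H] [MeasurableSpace H] [BorelSpace H] :
    ∃ μ : Measure H, IsProbabilityMeasure μ ∧ μ.IsMulLeftInvariant := by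
  refine ⟨Measure.haarMeasure ⊤, ⟨?_⟩, inferInstance⟩
  simpa using Measure.haarMeasure_self (K₀ := (⊤ : TopologicalSpace.PositiveCompacts H))

/-- Every neighbourhood of a fixed point of a compact group contains an invariant one. -/
theorem exists_isOpen_invariant {G M : Type*} [TopologicalSpace G] [Group G] [TopologicalSpace M]
    [MulAction G M] [ContinuousSMul G M] {H : Subgroup G} (hH : IsCompact (H : Set G))
    {W : Set M} (hW : IsOpen W) {p : M} (hp : ∀ h ∈ H, h • p ∈ W) :
    ∃ W' ⊆ W, IsOpen W' ∧ p ∈ W' ∧ ∀ h ∈ H, ∀ x ∈ W', h • x ∈ W' := by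
  refine ⟨{x | ∀ h ∈ H, h • x ∈ W}, fun x hx => ?_, ?_, hp, fun h hh x hx k hk => ?_⟩
  · simpa using hx 1 H.one_mem
  · rw [isOpen_iff_eventually]
    intro x hx
    refine hH.eventually_forall_of_forall_eventually fun h hh => ?_
    exact (continuous_snd.smul continuous_fst).continuousAt.preimage_mem_nhds
      (hW.mem_nhds (hx h hh))
  · rw [smul_smul]
    exact hx _ (H.mul_mem hk hh)

end Averaging

/-! ### Bochner linearization at a point with compact isotropy -/

section Linearization

universe u

variable {A : Type*} [NormedAddCommGroup A] [NormedSpace ℝ A]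
  {G : Type*} [TopologicalSpace G] [ChartedSpace A G] [Group G]
  {E : Type u} [NormedAddCommGroup E] [NormedSpace ℝ E]
  {M : Type*} [TopologicalSpace M] [ChartedSpace E M] [MulAction G M]
  [ContMDiffSMul 𝓘(ℝ, A) 𝓘(ℝ, E) ∞ G M]

variable (E) in
/-- The action written in the chart at `p`. -/
noncomputable def actInChart (p : M) (g : G) (u : E) : E :=
  chartAt E p (g • (chartAt E p).symm u) - chartAt E p p

theorem contMDiffAt_actInChart [IsManifold 𝓘(ℝ, E) ∞ M] {p : M} {g : G} {u : E} (hu : u ∈ (chartAt E p).target)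
    (hg : g • (chartAt E p).symm u ∈ (chartAt E p).source) :
    ContMDiffAt (𝓘(ℝ, A).prod 𝓘(ℝ, E)) 𝓘(ℝ, E) ∞ (Function.uncurry (actInChart E p)) (g, u) := by
  have h1 : ContMDiffAt 𝓘(ℝ, E) 𝓘(ℝ, E) ∞ (chartAt E p).symm u :=
    (contMDiffOn_chart_symm (I := 𝓘(ℝ, E)) (x := p)).contMDiffAt
      ((chartAt E p).open_target.mem_nhds hu)
  have h2 : ContMDiffAt (𝓘(ℝ, A).prod 𝓘(ℝ, E)) 𝓘(ℝ, E) ∞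
      (fun z : G × E => z.1 • (chartAt E p).symm z.2) (g, u) :=
    contMDiffAt_fst.smul (I := 𝓘(ℝ, A)) (ContMDiffAt.comp (g, u) h1 contMDiffAt_snd)
  have h3 : ContMDiffAt 𝓘(ℝ, E) 𝓘(ℝ, E) ∞ (chartAt E p) (g • (chartAt E p).symm u) :=
    (contMDiffOn_chart (I := 𝓘(ℝ, E)) (x := p)).contMDiffAt
      ((chartAt E p).open_source.mem_nhds hg)
  exact (ContMDiffAt.comp (g, u) (g := chartAt E p) h3 h2).sub contMDiffAt_const

variable [LieGroup 𝓘(ℝ, A) ∞ G]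

theorem smulDeriv_mul_apply {p : M} (g : G) {h : G} (hh : h ∈ MulAction.stabilizer G p) (v : E) :
    smulDeriv A E (g * h) p v = smulDeriv A E g p (smulDeriv A E h p v) := by
  have h1 := hasMFDerivAt_comp_of_eq (hasMFDerivAt_smulMap (A := A) (E := E) g p)
    (hasMFDerivAt_smulMap (A := A) (E := E) h p) hh
  have h2 := h1.congr_of_eventuallyEq (f₁ := fun y : M => (g * h) • y)
    (Filter.Eventually.of_forall fun y => by simp [mul_smul])
  exact DFunLike.congr_fun (hasMFDerivAt_unique (hasMFDerivAt_smulMap (A := A) (E := E) (g * h) p)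
    h2) v

theorem smulDeriv_one_apply (p : M) (v : E) : smulDeriv A E (1 : G) p v = v := by
  have h2 := (hasMFDerivAt_id p).congr_of_eventuallyEq (I := 𝓘(ℝ, E)) (f₁ := fun y : M => (1 : G) • y)
    (Filter.Eventually.of_forall fun y => by simp)
  exact DFunLike.congr_fun (hasMFDerivAt_unique (hasMFDerivAt_smulMap (A := A) (E := E) (1 : G) p)
    h2) v

theorem smulDeriv_apply_inv {p : M} {h : G} (hh : h ∈ MulAction.stabilizer G p) (v : E) :
    smulDeriv A E h p (smulDeriv A E h⁻¹ p v) = v := by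
  rw [← smulDeriv_mul_apply _ (inv_mem hh), mul_inv_cancel, smulDeriv_one_apply]

variable [IsManifold 𝓘(ℝ, E) ∞ M]

theorem hasMFDerivAt_chartAt_self (p : M) :
    HasMFDerivAt 𝓘(ℝ, E) 𝓘(ℝ, E) (chartAt E p) p (ContinuousLinearMap.id ℝ E) := by
  have := (mdifferentiableAt_extChartAt (I := 𝓘(ℝ, E)) (mem_chart_source E p)).hasMFDerivAt
  rw [mfderiv_extChartAt_self] at this
  exact this.congr_of_eventuallyEq (Filter.Eventually.of_forall fun x => by simp [extChartAt])

theorem hasMFDerivAt_chartAt_symm_self (p : M) :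
    HasMFDerivAt 𝓘(ℝ, E) 𝓘(ℝ, E) (chartAt E p).symm (chartAt E p p)
      (ContinuousLinearMap.id ℝ E) := by
  have h1 := ((contMDiffOn_chart_symm (I := 𝓘(ℝ, E)) (x := p) (n := ∞)).contMDiffAt
      ((chartAt E p).open_target.mem_nhds (mem_chart_target E p))).mdifferentiableAt
      (by simp) |>.hasMFDerivAt
  have h3 := hasMFDerivAt_comp_of_eq (hasMFDerivAt_chartAt_self p) h1
    ((chartAt E p).left_inv (mem_chart_source E p))
  have h4 : HasMFDerivAt 𝓘(ℝ, E) 𝓘(ℝ, E) (chartAt E p ∘ (chartAt E p).symm) (chartAt E p p)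
      (ContinuousLinearMap.id ℝ E) := by
    refine (hasMFDerivAt_id _).congr_of_eventuallyEq ?_
    filter_upwards [(chartAt E p).open_target.mem_nhds (mem_chart_target E p)] with z hz
    simp [(chartAt E p).right_inv hz]
  have h5 := hasMFDerivAt_unique h3 h4
  exact h1.congr_mfderiv h5

theorem hasFDerivAt_actInChart {p : M} {h : G} (hh : h ∈ MulAction.stabilizer G p) :
    HasFDerivAt (actInChart E p h) (smulDeriv A E h p : E →L[ℝ] E) (chartAt E p p) := by
  have h1 := hasMFDerivAt_comp_of_eq (hasMFDerivAt_smulMap (A := A) (E := E) h p)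
    (hasMFDerivAt_chartAt_symm_self (E := E) p) ((chartAt E p).left_inv (mem_chart_source E p))
  have h2 := hasMFDerivAt_comp_of_eq (hasMFDerivAt_chartAt_self (E := E) p) h1
    (by simpa [(chartAt E p).left_inv (mem_chart_source E p)] using hh)
  exact h2.hasFDerivAt.sub_const _

/-- On the isotropy group the derivative can be read in the single chart at `p`, where it depends
smoothly on the group element. The isotropy representation can therefore be averaged. -/
theorem continuousOn_smulDeriv (p : M) :
    ContinuousOn (fun h : G => (smulDeriv A E h p : E →L[ℝ] E)) (MulAction.stabilizer G p) := by
  have h1 : ContinuousOn (fun h : G => fderiv ℝ (actInChart E p h) (chartAt E p p))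
      (MulAction.stabilizer G p) := by
    intro h hh
    have h2 := contMDiffAt_fderiv_param (A := A) (contMDiffAt_actInChart (p := p) (g := h)
      (mem_chart_target E p) (by
        rw [(chartAt E p).left_inv (mem_chart_source E p), show h • p = p from hh]
        exact mem_chart_source E p))
    exact (ContinuousAt.comp (f := fun h : G => (h, chartAt E p p)) (x := h) h2.continuousAt
      (continuousAt_id.prodMk continuousAt_const)).continuousWithinAt
  exact h1.congr fun h hh => (hasFDerivAt_actInChart hh).fderiv.symm

open MeasureTheory in
variable (A E) in
/-- Near a point with compact isotropy group, the action of the isotropy group is linear in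
suitable coordinates. -/
theorem exists_linearizing_chart [FiniteDimensional ℝ E] [ContinuousSMul G M] {p : M}
    (hc : IsCompact (MulAction.stabilizer G p : Set G)) :
    ∃ ψ : OpenPartialHomeomorph M E, p ∈ ψ.source ∧ ψ p = 0 ∧
      ContMDiffOn 𝓘(ℝ, E) 𝓘(ℝ, E) ∞ ψ ψ.source ∧
      ContMDiffOn 𝓘(ℝ, E) 𝓘(ℝ, E) ∞ ψ.symm ψ.target ∧
      HasMFDerivAt 𝓘(ℝ, E) 𝓘(ℝ, E) ψ p (ContinuousLinearMap.id ℝ E) ∧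
      ∀ h ∈ MulAction.stabilizer G p, ∀ x ∈ ψ.source,
        h • x ∈ ψ.source ∧ ψ (h • x) = smulDeriv A E h p (ψ x) := by
  have := topologicalGroup_of_lieGroup (G := G) 𝓘(ℝ, A) ∞
  let H := MulAction.stabilizer G p
  have : CompactSpace H := isCompact_iff_compactSpace.1 hc
  let _ : MeasurableSpace H := borel H
  have : BorelSpace H := ⟨rfl⟩
  obtain ⟨μ, hμ, hμi⟩ := exists_isMulLeftInvariant_isProbabilityMeasure H
  let φ := chartAt E p
  have hpφ : p ∈ φ.source := mem_chart_source E p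
  obtain ⟨W, hWφ, hW, hpW, hWH⟩ := exists_isOpen_invariant (H := H) hc φ.open_source (p := p)
    (fun h hh => by rw [show h • p = p from hh]; exact hpφ)
  let U : Set E := φ.target ∩ φ.symm ⁻¹' W
  have hU : IsOpen U := φ.isOpen_inter_preimage_symm hW
  have hφU : ∀ x ∈ W, φ x ∈ U := fun x hx =>
    ⟨φ.map_source (hWφ hx), by rw [Set.mem_preimage, φ.left_inv (hWφ hx)]; exact hx⟩
  -- Bochner's integrand: act by h⁻¹ in the chart, then by the linear part of h. Taking the linear
  -- part in the fixed chart at `p` makes it jointly smooth near the isotropy group; `smulDeriv` is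
  -- identified with it only on that group.
  let f : G → E → E := fun g u => fderiv ℝ (actInChart E p g) (φ p) (actInChart E p g⁻¹ u)
  have hf : ∀ h : H, ∀ u ∈ U, ContMDiffAt (𝓘(ℝ, A).prod 𝓘(ℝ, E)) 𝓘(ℝ, E) ∞
      (Function.uncurry f) ((h : G), u) := by
    intro h u hu
    have h1 := contMDiffAt_fderiv_param (A := A) (contMDiffAt_actInChart (p := p) (g := (h : G))
      (mem_chart_target E p) (by
        rw [φ.left_inv hpφ, show (h : G) • p = p from h.2]
        exact hpφ))
    have h2 := contMDiffAt_actInChart (A := A) (p := p) (g := (h : G)⁻¹) hu.1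
      (hWφ (hWH _ (inv_mem h.2) _ hu.2))
    have h3 : ContMDiffAt (𝓘(ℝ, A).prod 𝓘(ℝ, E)) (𝓘(ℝ, A).prod 𝓘(ℝ, E)) ∞
        (fun z : G × E => (z.1, φ p)) ((h : G), u) := contMDiffAt_fst.prodMk contMDiffAt_const
    have h4 : ContMDiffAt (𝓘(ℝ, A).prod 𝓘(ℝ, E)) (𝓘(ℝ, A).prod 𝓘(ℝ, E)) ∞
        (fun z : G × E => (z.1⁻¹, z.2)) ((h : G), u) :=
      (contMDiffAt_fst.inv).prodMk contMDiffAt_snd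
    exact (ContMDiffAt.comp ((h : G), u) h1 h3).clm_apply (ContMDiffAt.comp ((h : G), u) h2 h4)
  have hfH : ∀ (h : H) u, f h u = smulDeriv A E (h : G) p (actInChart E p (h : G)⁻¹ u) :=
    fun h u => by
      simp only [f]
      rw [(hasFDerivAt_actInChart (A := A) h.2).fderiv]
      rfl
  let ψ' : E → E := fun u => ∫ h : H, f h u ∂μ
  have hψ' : ContDiffOn ℝ ∞ ψ' U := contDiffOn_integral_param μ continuous_subtype_val hU hf
  have hdψ' : HasFDerivAt ψ' (ContinuousLinearMap.id ℝ E) (φ p) := by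
    have h1 := hasFDerivAt_integral_param μ continuous_subtype_val hU hf (hφU p hpW)
    -- At the fixed point each integrand has derivative h ∘ h⁻¹ = id, and `μ` has total mass 1.
    have h2 : ∀ h : H, fderiv ℝ (f h) (φ p) = ContinuousLinearMap.id ℝ E := fun h => by
      have h3 : f h = (smulDeriv A E (h : G) p : E →L[ℝ] E) ∘ actInChart E p (h : G)⁻¹ :=
        funext (hfH h)
      rw [h3]
      refine ((smulDeriv A E (h : G) p : E →L[ℝ] E).hasFDerivAt.comp (φ p)
        (hasFDerivAt_actInChart (A := A) (inv_mem h.2))).fderiv.trans ?_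
      ext v
      exact smulDeriv_apply_inv h.2 v
    simp only [h2, integral_const, probReal_univ, one_smul] at h1
    exact h1
  have hψeq : ∀ h ∈ H, ∀ x ∈ W, ψ' (φ (h • x)) = smulDeriv A E h p (ψ' (φ x)) := by
    intro h hh x hx
    -- Substituting hk for k cancels `h` inside the chart and leaves its linear part as a factor
    -- outside.
    have h1 : ψ' (φ (h • x)) = ∫ k : H, f ((⟨h, hh⟩ * k : H) : G) (φ (h • x)) ∂μ :=
      (integral_mul_left_eq_self (fun k : H => f k (φ (h • x))) (⟨h, hh⟩ : H)).symm
    rw [h1]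
    change _ = (smulDeriv A E h p : E →L[ℝ] E) (∫ k : H, f k (φ x) ∂μ)
    rw [← ContinuousLinearMap.integral_comp_comm]
    · refine integral_congr_ae (Filter.Eventually.of_forall fun k => ?_)
      simp only [hfH]
      rw [Subgroup.coe_mul, smulDeriv_mul_apply _ k.2]
      simp only [ContinuousLinearEquiv.coe_coe]
      congr 2
      simp only [actInChart]
      rw [φ.left_inv (hWφ hx), φ.left_inv (hWφ (hWH h hh x hx))]
      simp [smul_smul]
    · refine Continuous.integrable_of_hasCompactSupport ?_ (HasCompactSupport.of_compactSpace _)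
      rw [continuous_iff_continuousAt]
      intro k
      exact ContinuousAt.comp (g := Function.uncurry f) (f := fun k : H => ((k : G), φ x))
        (hf k (φ x) (hφU x hx)).continuousAt
        (continuous_subtype_val.continuousAt.prodMk continuousAt_const)
  have hψs : ContMDiffOn 𝓘(ℝ, E) 𝓘(ℝ, E) ∞ (ψ' ∘ φ) W :=
    (contMDiffOn_iff_contDiffOn.2 hψ').comp ((contMDiffOn_chart (I := 𝓘(ℝ, E)) (x := p)).mono hWφ)
      hφU
  have hdψ : HasMFDerivAt 𝓘(ℝ, E) 𝓘(ℝ, E) (ψ' ∘ φ) p (ContinuousLinearMap.id ℝ E) :=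
    hasMFDerivAt_comp_of_eq hdψ'.hasMFDerivAt (hasMFDerivAt_chartAt_self p) rfl
  obtain ⟨e, hpe, heW, hef, hes, hes'⟩ := exists_openPartialHomeomorph_of_contMDiffOn hW hpW hψs
    (ContinuousLinearEquiv.refl ℝ E) hdψ
  obtain ⟨W', hW'e, hW', hpW', hW'H⟩ := exists_isOpen_invariant (H := H) hc e.open_source (p := p)
    (fun h hh => by rw [show h • p = p from hh]; exact hpe)
  have hsrc : (e.restrOpen W' hW').source = W' := by
    rw [OpenPartialHomeomorph.restrOpen_source, Set.inter_eq_right.2 hW'e]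
  refine ⟨e.restrOpen W' hW', ?_, ?_, ?_, ?_, ?_, ?_⟩
  · rw [hsrc]; exact hpW'
  · change e p = 0
    rw [hef p hpe]
    have h0 : ∀ h : H, f h (φ p) = 0 := fun h => by
      have h1 : (h : G)⁻¹ • p = p := inv_mem h.2
      rw [hfH, actInChart, φ.left_inv hpφ, h1, sub_self, map_zero]
    simp [ψ', h0]
  · exact hes.mono (by rw [hsrc]; exact hW'e)
  · exact hes'.mono Set.inter_subset_left
  · exact hdψ.congr_of_eventuallyEq
      (Filter.eventuallyEq_of_mem (e.open_source.mem_nhds hpe) hef)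
  · intro h hh x hx
    rw [hsrc] at hx ⊢
    refine ⟨hW'H h hh x hx, ?_⟩
    change e (h • x) = smulDeriv A E h p (e x)
    rw [hef _ (hW'e (hW'H h hh x hx)), hef _ (hW'e hx)]
    exact hψeq h hh x (heW (hW'e hx))

end Linearization

/-! ### Averaging representations of compact groups -/

section AverageRep

open MeasureTheory

/-- Averaging a continuous representation of a compact group. -/
theorem exists_average {H : Type*} [Group H] [TopologicalSpace H] [IsTopologicalGroup H]
    [CompactSpace H] {F : Type*} [NormedAddCommGroup F] [NormedSpace ℝ F] [FiniteDimensional ℝ F]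
    (ρ : H → F →L[ℝ] F) (hρ : Continuous ρ) (hmul : ∀ h k v, ρ (h * k) v = ρ h (ρ k v)) :
    ∃ avg : F →L[ℝ] F, (∀ h v, ρ h (avg v) = avg v) ∧ (∀ h v, avg (ρ h v) = avg v) ∧
      ∀ (S : Submodule ℝ F) (v : F), (∀ h, ρ h v - v ∈ S) → avg v - v ∈ S := by
  let _ : MeasurableSpace H := borel H
  have : BorelSpace H := ⟨rfl⟩
  obtain ⟨μ, hμ, hμi⟩ := exists_isMulLeftInvariant_isProbabilityMeasure H
  have hintegrable : ∀ {F' : Type _} [NormedAddCommGroup F'] [NormedSpace ℝ F'] [FiniteDimensional ℝ F']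
      {f : H → F'}, Continuous f → Integrable f μ := fun hf =>
    hf.integrable_of_hasCompactSupport (HasCompactSupport.of_compactSpace _)
  have hinv : Continuous fun h => ρ h⁻¹ := hρ.comp continuous_inv
  let avg : F →L[ℝ] F := ∫ h, ρ h ∂μ
  -- Left invariance gives ρ h ∘ avg = avg and avg' ∘ ρ h = avg'. Computing avg' ∘ avg in both ways
  -- yields avg' = avg, so right invariance of `μ` is not needed.
  let avg' : F →L[ℝ] F := ∫ h, ρ h⁻¹ ∂μ
  have h1 : ∀ v, avg v = ∫ h, ρ h v ∂μ := fun v =>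
    ContinuousLinearMap.integral_apply (hintegrable hρ) v
  have h1' : ∀ v, avg' v = ∫ h, ρ h⁻¹ v ∂μ := fun v =>
    ContinuousLinearMap.integral_apply (hintegrable hinv) v
  have hv : ∀ v, Integrable (fun h => ρ h v) μ := fun v =>
    hintegrable (hρ.clm_apply continuous_const)
  have h2 : ∀ h v, ρ h (avg v) = avg v := fun h v => by
    rw [h1, ← ContinuousLinearMap.integral_comp_comm _ (hv v)]
    simp only [← hmul]
    exact integral_mul_left_eq_self (fun k => ρ k v) h
  have h3 : ∀ h v, avg' (ρ h v) = avg' v := fun h v => by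
    rw [h1', h1', ← integral_mul_left_eq_self (fun k => ρ k⁻¹ (ρ h v)) h]
    simp only [← hmul]
    simp
  have h4 : ∀ v, avg' v = avg v := fun v => by
    have h5 : avg' (avg v) = avg v := by
      rw [h1' (avg v)]
      simp [h2]
    have h6 : avg' (avg v) = avg' v := by
      rw [h1, ← ContinuousLinearMap.integral_comp_comm _ (hv v)]
      simp [h3]
    rw [← h6, h5]
  refine ⟨avg, h2, fun h v => by rw [← h4, h3, h4], fun S v hS => ?_⟩
  obtain ⟨q, hq⟩ := S.exists_isCompl
  -- `L` has kernel `S` and stands for the quotient by `S`, in which every ρ h v has the class of v.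
  let L : F →L[ℝ] q := LinearMap.toContinuousLinearMap (q.projectionOnto S hq.symm)
  have hL : ∀ w, L w = 0 ↔ w ∈ S := fun w => Submodule.projectionOnto_apply_eq_zero_iff hq.symm
  rw [← hL, map_sub, h1, ← ContinuousLinearMap.integral_comp_comm _ (hv v)]
  have h7 : ∀ h, L (ρ h v) = L v := fun h => by
    rw [← sub_eq_zero, ← map_sub, hL]
    exact hS h
  simp [h7]

/-- An invariant subspace of a representation of a compact group is the image of an equivariant
projection. -/
theorem exists_equivariant_projection {H : Type*} [Group H] [TopologicalSpace H]
    [IsTopologicalGroup H]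
    [CompactSpace H] {F : Type*} [NormedAddCommGroup F] [NormedSpace ℝ F] [FiniteDimensional ℝ F]
    (ρ : H → F →L[ℝ] F) (hρ : Continuous ρ) (hmul : ∀ h k v, ρ (h * k) v = ρ h (ρ k v))
    (hone : ∀ v, ρ 1 v = v) (V : Submodule ℝ F) (hV : ∀ h, ∀ v ∈ V, ρ h v ∈ V) :
    ∃ Q : F →L[ℝ] F, (∀ v, Q v ∈ V) ∧ (∀ v ∈ V, Q v = v) ∧ ∀ h v, Q (ρ h v) = ρ h (Q v) := by
  obtain ⟨q, hq⟩ := V.exists_isCompl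
  let Q₀ : F →L[ℝ] F := LinearMap.toContinuousLinearMap (V.subtype ∘ₗ V.projectionOnto q hq)
  have hQ₀ : ∀ v, Q₀ v ∈ V := fun v => (V.projectionOnto q hq v).2
  have hQ₀' : ∀ v ∈ V, Q₀ v = v := fun v hv => by
    have := Submodule.projectionOnto_apply_left hq ⟨v, hv⟩
    exact congrArg Subtype.val this
  let σ : H → (F →L[ℝ] F) →L[ℝ] (F →L[ℝ] F) := fun h =>
    (ContinuousLinearMap.compL ℝ F F F (ρ h)).comp
      ((ContinuousLinearMap.compL ℝ F F F).flip (ρ h⁻¹))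
  have hσ : ∀ h T v, σ h T v = ρ h (T (ρ h⁻¹ v)) := fun h T v => rfl
  have hσc : Continuous σ := by
    have h1 : Continuous fun h => ρ h⁻¹ := hρ.comp continuous_inv
    exact ((ContinuousLinearMap.compL ℝ F F F).continuous.comp hρ).clm_comp
      ((ContinuousLinearMap.compL ℝ F F F).flip.continuous.comp h1)
  obtain ⟨avg, ha1, -, ha3⟩ := exists_average σ hσc (fun h k T => by
    ext v
    simp only [hσ, mul_inv_rev, hmul])
  -- The projections onto `V` form the affine space `Q₀` + `S`, which conjugation by ρ preserves; so
  -- the average of `Q₀` is again a projection onto `V`.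
  let S : Submodule ℝ (F →L[ℝ] F) :=
    { carrier := {T | (∀ v, T v ∈ V) ∧ ∀ v ∈ V, T v = 0}
      zero_mem' := ⟨fun v => V.zero_mem, fun v _ => rfl⟩
      add_mem' := fun {a b} ha hb => ⟨fun v => V.add_mem (ha.1 v) (hb.1 v), fun v hv => by
        simp [ha.2 v hv, hb.2 v hv]⟩
      smul_mem' := fun c a ha => ⟨fun v => V.smul_mem c (ha.1 v), fun v hv => by
        simp [ha.2 v hv]⟩ }
  have hinv : ∀ h v, ρ h (ρ h⁻¹ v) = v := fun h v => by rw [← hmul, mul_inv_cancel, hone]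
  have hS : avg Q₀ - Q₀ ∈ S := ha3 S Q₀ fun h => by
    refine ⟨fun v => V.sub_mem (hV h _ (hQ₀ _)) (hQ₀ v), fun v hv => ?_⟩
    rw [sub_apply, hσ, hQ₀' _ (hV _ _ hv), hQ₀' _ hv, hinv, sub_self]
  refine ⟨avg Q₀, fun v => ?_, fun v hv => ?_, fun h v => ?_⟩
  · have := V.add_mem (hS.1 v) (hQ₀ v)
    simpa using this
  · have := hS.2 v hv
    rw [sub_apply, sub_eq_zero] at this
    rw [this, hQ₀' v hv]
  · have h1 := DFunLike.congr_fun (ha1 h Q₀) (ρ h v)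
    rw [hσ, ← hmul, inv_mul_cancel, hone] at h1
    exact h1.symm

end AverageRep

/-! ### The isotropy representation -/

section IsotropyRep

variable {A : Type*} [NormedAddCommGroup A] [NormedSpace ℝ A]
  {G : Type*} [TopologicalSpace G] [ChartedSpace A G] [Group G] [LieGroup 𝓘(ℝ, A) ∞ G]
  {E : Type*} [NormedAddCommGroup E] [NormedSpace ℝ E]
  {M : Type*} [TopologicalSpace M] [ChartedSpace E M] [MulAction G M]
  [ContMDiffSMul 𝓘(ℝ, A) 𝓘(ℝ, E) ∞ G M]

theorem smulDeriv_mem_range_infAct {p : M} {h : G} (hh : h ∈ MulAction.stabilizer G p) {v : E}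
    (hv : v ∈ (infAct A G E p).range) : smulDeriv A E h p v ∈ (infAct A G E p).range := by
  obtain ⟨Ad, hAd⟩ := smulDeriv_infAct (A := A) (E := E) h p
  obtain ⟨ξ, rfl⟩ := hv
  refine ⟨Ad ξ, ?_⟩
  rw [show h • p = p from hh] at hAd
  exact (hAd ξ).symm

variable (A G E) in
/-- The vectors at `p` that are fixed by the isotropy group modulo the tangent space of the
orbit. -/
noncomputable def fixedModVertical (p : M) : Submodule ℝ E where
  carrier := {v | ∀ h ∈ MulAction.stabilizer G p,
    smulDeriv A E h p v - v ∈ (infAct A G E p).range}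
  zero_mem' := fun h _ => by simp
  add_mem' := fun {a b} ha hb h hh => by
    have := Submodule.add_mem _ (ha h hh) (hb h hh)
    rwa [sub_add_sub_comm, ← map_add] at this
  smul_mem' := fun c a ha h hh => by
    have := Submodule.smul_mem _ c (ha h hh)
    rwa [smul_sub, ← map_smul] at this

theorem range_infAct_le_fixedModVertical (p : M) :
    (infAct A G E p).range ≤ fixedModVertical A G E p := fun _ hv _ hh =>
  Submodule.sub_mem _ (smulDeriv_mem_range_infAct hh hv) hv

variable [IsManifold 𝓘(ℝ, E) ∞ M] [FiniteDimensional ℝ E]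

/-- The last clause is applied with two choices of `S`. With the vertical space, it says that
averaging moves a vector of `fixedModVertical` only vertically; with the kernel of an invariant
covector, that the covector does not notice averaging. -/
theorem exists_average_stabilizer {p : M} (hc : IsCompact (MulAction.stabilizer G p : Set G)) :
    ∃ avg : E →L[ℝ] E,
      (∀ h ∈ MulAction.stabilizer G p, ∀ v, smulDeriv A E h p (avg v) = avg v) ∧
      (∀ h ∈ MulAction.stabilizer G p, ∀ v, avg (smulDeriv A E h p v) = avg v) ∧
      ∀ (S : Submodule ℝ E) (v : E),
        (∀ h ∈ MulAction.stabilizer G p, smulDeriv A E h p v - v ∈ S) → avg v - v ∈ S := by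
  have := topologicalGroup_of_lieGroup (G := G) 𝓘(ℝ, A) ∞
  have : CompactSpace (MulAction.stabilizer G p) := isCompact_iff_compactSpace.1 hc
  obtain ⟨avg, h1, h2, h3⟩ := exists_average
    (fun h : MulAction.stabilizer G p => (smulDeriv A E (h : G) p : E →L[ℝ] E))
    (continuousOn_iff_continuous_domRestrict.1 (continuousOn_smulDeriv p))
    (fun h k v => smulDeriv_mul_apply (h : G) k.2 v)
  exact ⟨avg, fun h hh => h1 ⟨h, hh⟩, fun h hh => h2 ⟨h, hh⟩,
    fun S v hS => h3 S v fun h => hS h h.2⟩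

/-- The kernel of `Q` is an invariant complement to the orbit directions; the slice is modelled on
it. -/
theorem exists_vertical_projection {p : M} (hc : IsCompact (MulAction.stabilizer G p : Set G)) :
    ∃ Q : E →L[ℝ] E, (∀ v, Q v ∈ (infAct A G E p).range) ∧
      (∀ v ∈ (infAct A G E p).range, Q v = v) ∧
      ∀ h ∈ MulAction.stabilizer G p, ∀ v, Q (smulDeriv A E h p v) = smulDeriv A E h p (Q v) := by
  have := topologicalGroup_of_lieGroup (G := G) 𝓘(ℝ, A) ∞
  have : CompactSpace (MulAction.stabilizer G p) := isCompact_iff_compactSpace.1 hc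
  obtain ⟨Q, h1, h2, h3⟩ := exists_equivariant_projection
    (fun h : MulAction.stabilizer G p => (smulDeriv A E (h : G) p : E →L[ℝ] E))
    (continuousOn_iff_continuous_domRestrict.1 (continuousOn_smulDeriv p))
    (fun h k v => smulDeriv_mul_apply (h : G) k.2 v) (fun v => smulDeriv_one_apply p v)
    (infAct A G E p).range (fun h v hv => smulDeriv_mem_range_infAct h.2 hv)
  exact ⟨Q, h1, h2, fun h hh => h3 ⟨h, hh⟩⟩

end IsotropyRep

/-- For a proper action, elements that move points near `p` to points near `p` are close to the
isotropy group of `p`. -/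
theorem exists_nhds_of_stabilizer_subset {G M : Type*} [TopologicalSpace G] [Group G]
    [TopologicalSpace M] [MulAction G M] [ProperSMul G M] {p : M} {O : Set G} (hO : IsOpen O)
    (hp : (MulAction.stabilizer G p : Set G) ⊆ O) :
    ∃ W : Set M, IsOpen W ∧ p ∈ W ∧ ∀ (g : G), ∀ x ∈ W, g • x ∈ W → g ∈ O := by
  -- A proper map is closed, so the pairs (g • x, x) with g ∉ O form a closed set, and this set
  -- misses (p, p).
  have h1 := (ProperSMul.isProperMap_smul_pair (G := G) (X := M)).isClosedMap (Oᶜ ×ˢ Set.univ)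
    (hO.isClosed_compl.prod isClosed_univ)
  have h2 : (p, p) ∈ ((fun gx : G × M => (gx.1 • gx.2, gx.2)) '' (Oᶜ ×ˢ Set.univ))ᶜ := by
    rintro ⟨⟨g, x⟩, ⟨hg, -⟩, hgx⟩
    simp only [Prod.mk.injEq] at hgx
    obtain ⟨h3, rfl⟩ := hgx
    exact hg (hp h3)
  obtain ⟨u, v, hu, hv, hpu, hpv, huv⟩ := isOpen_prod_iff.1 h1.isOpen_compl p p h2
  refine ⟨u ∩ v, hu.inter hv, ⟨hpu, hpv⟩, fun g x hx hgx => ?_⟩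
  by_contra hg
  exact huv (Set.mk_mem_prod hgx.1 hx.2) ⟨(g, x), ⟨hg, trivial⟩, rfl⟩

/-! ### Existence of slice charts -/

section Slice

universe u

variable {A : Type*} [NormedAddCommGroup A] [NormedSpace ℝ A] [FiniteDimensional ℝ A]
  {G : Type*} [TopologicalSpace G] [ChartedSpace A G] [Group G] [LieGroup 𝓘(ℝ, A) ∞ G]
  {E : Type u} [NormedAddCommGroup E] [NormedSpace ℝ E] [FiniteDimensional ℝ E]
  {M : Type*} [TopologicalSpace M] [ChartedSpace E M] [MulAction G M]
  [ContMDiffSMul 𝓘(ℝ, A) 𝓘(ℝ, E) ∞ G M] [IsManifold 𝓘(ℝ, E) ∞ M]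

variable (A E) in
/-- A slice at `p`: coordinates `Ψ` near `p` in which a point with coordinate `v` is moved, by some
element of the group, to a point of a transversal `S` whose coordinate agrees with `v` up to a
vector tangent to the orbit; elements mapping `S` to `S` lie in the isotropy group of `p`, which
acts linearly on `S`. -/
structure IsSliceChart (p : M) (Ψ : OpenPartialHomeomorph M E) (S : Set M) (y : M → E) : Prop where
  mem_source : p ∈ Ψ.source
  map_self : Ψ p = 0
  contMDiffOn : ContMDiffOn 𝓘(ℝ, E) 𝓘(ℝ, E) ∞ Ψ Ψ.source
  contMDiffOn_symm : ContMDiffOn 𝓘(ℝ, E) 𝓘(ℝ, E) ∞ Ψ.symm Ψ.target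
  hasMFDerivAt : HasMFDerivAt 𝓘(ℝ, E) 𝓘(ℝ, E) Ψ p (ContinuousLinearMap.id ℝ E)
  exists_smul : ∀ x ∈ Ψ.source, ∃ g : G, g • x ∈ S ∧ Ψ x - y (g • x) ∈ (infAct A G E p).range
  mem_stabilizer : ∀ s ∈ S, ∀ g : G, g • s ∈ S → g ∈ MulAction.stabilizer G p
  map_smul : ∀ h ∈ MulAction.stabilizer G p, ∀ s ∈ S, y (h • s) = smulDeriv A E h p (y s)
  smul_eq_of_map_eq : ∀ h ∈ MulAction.stabilizer G p, ∀ s ∈ S, y (h • s) = y s → h • s = s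
  disjoint : ∀ h ∈ MulAction.stabilizer G p, ∀ s ∈ S,
    smulDeriv A E h p (y s) - y s ∈ (infAct A G E p).range → smulDeriv A E h p (y s) = y s

variable (A E) in
-- The map Θ(v) = θ⁻¹(lam v) • ψ⁻¹(v - Qv) takes the point of the linear transversal ker Q with
-- coordinate v - Qv and moves it along its orbit by the amount Qv. It is a local diffeomorphism at
-- 0, and its inverse is the slice chart.
theorem exists_isSliceChart [ProperSMul G M] (p : M) :
    ∃ (Ψ : OpenPartialHomeomorph M E) (S : Set M) (y : M → E),
      IsSliceChart A (G := G) E p Ψ S y := by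
  have := topologicalGroup_of_lieGroup (G := G) 𝓘(ℝ, A) ∞
  have hc : IsCompact (MulAction.stabilizer G p : Set G) := isCompact_stabilizer p
  obtain ⟨ψ, hpψ, hψp, hψs, hψs', hdψ, hψH⟩ := exists_linearizing_chart A E hc
  obtain ⟨θ, pr, hθ⟩ := exists_orbitStraightening A (G := G) E p
  obtain ⟨Q, hQV, hQid, hQH⟩ := exists_vertical_projection (A := A) (E := E) hc
  obtain ⟨l, hl, -⟩ := exists_reflexive_inverse (infAct A G E p)
  set f := infAct A G E p with hf
  -- Chosen so that `infAct` ∘ `lam` = `Q`; the outer `pr` places its values in the complement of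
  -- the isotropy algebra selected by the straightening.
  let lam : E →L[ℝ] A := pr.comp (l.comp Q)
  have hfpr : ∀ z, f (pr z) = f z := fun z => by
    have h1 : pr z - z ∈ f.ker := by
      rw [← hθ.ker_eq, LinearMap.mem_ker]
      exact (map_sub pr _ _).trans (by rw [hθ.idem, sub_self])
    rw [← sub_eq_zero, ← map_sub]
    exact h1
  have hflam : ∀ v, f (lam v) = Q v := fun v => by
    obtain ⟨ξ, hξ⟩ := hQV v
    change f (pr (l (Q v))) = Q v
    rw [hfpr, ← hξ]
    exact hl ξ
  have hprlam : ∀ v, pr (lam v) = lam v := fun v => hθ.idem _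
  have hprf : ∀ z, f z = 0 → pr z = 0 := fun z hz => by
    have : z ∈ pr.ker := by rw [hθ.ker_eq]; exact hz
    exact this
  have hQf : ∀ ζ, Q (f ζ) = f ζ := fun ζ => hQid _ ⟨ζ, rfl⟩
  have hlamf : ∀ ζ n, pr ζ = ζ → Q n = 0 → lam (f ζ + n) = ζ := fun ζ n hζ hn => by
    have h1 : f (lam (f ζ + n) - ζ) = 0 := by
      rw [map_sub, hflam, map_add, hn, add_zero, hQf ζ, sub_self]
    have h2 := hprf _ h1
    rwa [map_sub, hprlam, hζ, sub_eq_zero] at h2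
  have hQQ : ∀ v, Q (Q v) = Q v := fun v => hQid _ (hQV v)
  let Θ : E → M := fun v => θ.symm (lam v) • ψ.symm (v - Q v)
  let D₀ : Set E := lam ⁻¹' θ.target ∩ (fun v => v - Q v) ⁻¹' ψ.target
  have hD₀ : IsOpen D₀ := (θ.open_target.preimage lam.continuous).inter
    (ψ.open_target.preimage (by fun_prop))
  have h0ψ : (0 : E) ∈ ψ.target := hψp ▸ ψ.map_source hpψ
  have hψ0 : ψ.symm 0 = p := by rw [← hψp, ψ.left_inv hpψ]
  have h0D₀ : (0 : E) ∈ D₀ := ⟨by simpa using hθ.zero_mem, by simpa using h0ψ⟩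
  have hΘ0 : Θ 0 = p := by simp [Θ, hθ.symm_zero, hψ0]
  have hsub : ContMDiff 𝓘(ℝ, E) 𝓘(ℝ, E) ∞ (fun v : E => v - Q v) :=
    contMDiff_id.sub Q.contMDiff
  have hΘs : ContMDiffOn 𝓘(ℝ, E) 𝓘(ℝ, E) ∞ Θ D₀ :=
    (hθ.contMDiffOn_symm.comp lam.contMDiff.contMDiffOn (fun v hv => hv.1)).smul (I := 𝓘(ℝ, A))
      (hψs'.comp hsub.contMDiffOn (fun v hv => hv.2))
  let D : Set E := D₀ ∩ Θ ⁻¹' ψ.source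
  have hD : IsOpen D := hΘs.continuousOn.isOpen_inter_preimage hD₀ ψ.open_source
  have h0D : (0 : E) ∈ D := ⟨h0D₀, by rw [Set.mem_preimage, hΘ0]; exact hpψ⟩
  let Ξ : E → E := fun v => ψ (Θ v)
  have hΞs : ContDiffOn ℝ ∞ Ξ D := contMDiffOn_iff_contDiffOn.1
    (hψs.comp (hΘs.mono Set.inter_subset_left) Set.inter_subset_right)
  have hΞ0 : Ξ 0 = 0 := by simp only [Ξ, hΘ0, hψp]
  have hdΞ : HasFDerivAt Ξ (ContinuousLinearMap.id ℝ E) 0 := by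
    have h1 := ((hΞs.contDiffAt (hD.mem_nhds h0D)).differentiableAt (by simp)).hasFDerivAt
    -- The derivative at 0 is computed separately on the image of `Q`, where only the group factor
    -- moves, and on ker `Q`, where Ξ is the identity.
    have h2 : HasFDerivAt (Ξ ∘ Q) Q 0 := by
      have h3 := hasMFDerivAt_comp_of_eq (x := (0 : E)) hθ.hasMFDerivAt_symm
        (lam.comp Q).hasFDerivAt.hasMFDerivAt (by simp)
      have h4 := hasMFDerivAt_comp_of_eq (hasMFDerivAt_orbitMap_one (A := A) (G := G) (E := E) p)
        h3 (by simp [hθ.symm_zero])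
      have h5 := hasMFDerivAt_comp_of_eq hdψ h4 (by simp [hθ.symm_zero])
      refine (h5.hasFDerivAt.congr_fderiv ?_).congr_of_eventuallyEq
        (Filter.Eventually.of_forall fun v => ?_)
      · exact ContinuousLinearMap.ext fun v : E => (hflam (Q v)).trans (hQQ v)
      · simp [Ξ, Θ, hQQ, hψ0]
    have hN : HasFDerivAt (fun v : E => v - Q v) (ContinuousLinearMap.id ℝ E - Q) 0 :=
      (hasFDerivAt_id _).sub Q.hasFDerivAt
    have h3 : HasFDerivAt (Ξ ∘ fun v => v - Q v) (ContinuousLinearMap.id ℝ E - Q) 0 := by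
      refine hN.congr_of_eventuallyEq ?_
      filter_upwards [hD₀.mem_nhds h0D₀] with v hv
      have h4 : lam (v - Q v) = 0 := by
        change pr (l (Q (v - Q v))) = 0
        rw [map_sub, hQQ, sub_self, map_zero, map_zero]
      simp only [Function.comp_apply, Ξ, Θ, h4, hθ.symm_zero, one_smul, map_sub, hQQ, sub_self,
        sub_zero]
      exact ψ.right_inv hv.2
    have h4 := (HasFDerivAt.comp (0 : E) (by simpa using h1) Q.hasFDerivAt).unique h2
    have h5 := (HasFDerivAt.comp (0 : E) (by simpa using h1) hN).unique h3
    refine h1.congr_fderiv ?_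
    ext v
    have h6 := DFunLike.congr_fun h4 v
    have h7 := DFunLike.congr_fun h5 v
    simp only [ContinuousLinearMap.comp_apply, sub_apply, ContinuousLinearMap.id_apply,
      map_sub] at h6 h7
    rw [h6, sub_left_inj] at h7
    exact h7
  obtain ⟨e, h0e, heD, heΞ, hes'⟩ := exists_openPartialHomeomorph_of_contDiffOn hD h0D hΞs
    (ContinuousLinearEquiv.refl ℝ E) hdΞ
  -- neighbourhoods on which translates of the transversal meet it only trivially
  have hcont : ContinuousAt (fun z : A × M => f z.1 + ψ z.2) (0, p) :=
    (f.continuous.continuousAt.comp continuousAt_fst).add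
      (ContinuousAt.comp (g := ψ) (x := ((0 : A), p)) (ψ.continuousAt hpψ) continuousAt_snd)
  have hnh : (fun z : A × M => f z.1 + ψ z.2) ⁻¹' e.source ∈ 𝓝 ((0 : A), p) :=
    hcont.preimage_mem_nhds (e.open_source.mem_nhds (by simpa [hψp] using h0e))
  obtain ⟨O₁, W₁, hO₁, h0O₁, hW₁, hpW₁, hOW⟩ := mem_nhds_prod_iff'.1 hnh
  obtain ⟨W₂, hW₂sub, hW₂, hpW₂, hW₂H⟩ := exists_isOpen_invariant hc (hW₁.inter ψ.open_source)
    (p := p) (fun h hh => by rw [show h • p = p from hh]; exact ⟨hpW₁, hpψ⟩)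
  have hinj : ∀ ζ ∈ O₁, pr ζ = ζ → ∀ s ∈ W₂, ∀ s' ∈ W₂, Q (ψ s) = 0 → Q (ψ s') = 0 →
      θ.symm ζ • s = s' → ζ = 0 := by
    intro ζ hζ hprζ s hs s' hs' hQs hQs' hss'
    have h1 : f ζ + ψ s ∈ e.source := hOW (Set.mk_mem_prod hζ (hW₂sub hs).1)
    have h2 : ψ s' ∈ e.source := by
      have : f 0 + ψ s' ∈ e.source := hOW (Set.mk_mem_prod h0O₁ (hW₂sub hs').1)
      rwa [map_zero, zero_add] at this
    have hΘ1 : ∀ ζ, pr ζ = ζ → ∀ s ∈ W₂, Q (ψ s) = 0 → Θ (f ζ + ψ s) = θ.symm ζ • s := by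
      intro ζ hζ s hs hQ
      simp only [Θ]
      rw [hlamf ζ _ hζ hQ, map_add, hQf ζ, hQ, add_zero, add_sub_cancel_left,
        ψ.left_inv (hW₂sub hs).2]
    have h3 := hΘ1 ζ hprζ s hs hQs
    have h4 := hΘ1 0 (map_zero _) s' hs' hQs'
    rw [map_zero, zero_add, hθ.symm_zero, one_smul] at h4
    have h5 : f ζ + ψ s = ψ s' := by
      refine e.injOn h1 h2 ?_
      rw [heΞ, heΞ]
      simp only [Ξ]
      rw [h3, h4, hss']
    have h6 := congrArg Q h5
    rw [map_add, hQf ζ, hQs, hQs', add_zero] at h6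
    rw [← hprζ]
    exact hprf ζ h6
  let O₂ : Set G := θ.source ∩ θ ⁻¹' (pr ⁻¹' (θ.target ∩ O₁))
  have hO₂ : IsOpen O₂ := θ.isOpen_inter_preimage
    ((θ.open_target.inter hO₁).preimage pr.continuous)
  have h1O₂ : (1 : G) ∈ O₂ := ⟨hθ.one_mem, by
    simp only [Set.mem_preimage, hθ.map_one, map_zero]
    exact ⟨hθ.zero_mem, h0O₁⟩⟩
  -- Products of an isotropy element with an element close to 1. By properness they contain every
  -- element that moves a point near `p` to a point near `p`.
  let O₃ : Set G := ⋃ h ∈ MulAction.stabilizer G p, (fun g => h⁻¹ * g) ⁻¹' O₂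
  have hO₃ : IsOpen O₃ := isOpen_biUnion fun h _ => hO₂.preimage (by fun_prop)
  have hHO₃ : (MulAction.stabilizer G p : Set G) ⊆ O₃ := fun h hh =>
    Set.mem_biUnion hh (by simpa using h1O₂)
  obtain ⟨W₃, hW₃, hpW₃, hW₃O⟩ := exists_nhds_of_stabilizer_subset hO₃ hHO₃
  have hslice : ∀ s ∈ W₂ ∩ W₃, ∀ s' ∈ W₂ ∩ W₃, Q (ψ s) = 0 → Q (ψ s') = 0 →
      ∀ g : G, g • s = s' → g ∈ MulAction.stabilizer G p := by
    intro s hs s' hs' hQs hQs' g hg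
    have h1 : g ∈ O₃ := hW₃O g s hs.2 (hg ▸ hs'.2)
    simp only [O₃, Set.mem_iUnion] at h1
    obtain ⟨h, hh, h2⟩ := h1
    set g₁ := h⁻¹ * g with hg₁
    have hQinv : ∀ h ∈ MulAction.stabilizer G p, ∀ s ∈ W₂, Q (ψ s) = 0 → Q (ψ (h • s)) = 0 :=
      fun h hh s hs hQ => by
        rw [(hψH h hh s (hW₂sub hs).2).2, hQH h hh, hQ, map_zero]
    -- θ⁻¹(ζ) moves `p` exactly as `g₁` does, so `g₁` is θ⁻¹(ζ) times an isotropy element. The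
    -- latter is absorbed into `s`, and `hinj` forces ζ = 0.
    let ζ := pr (θ g₁)
    have hζt : ζ ∈ θ.target := h2.2.1
    have h3 : θ.symm ζ • p = g₁ • p := by
      have := (hθ.smul_eq_iff ζ hζt (θ g₁) (θ.map_source h2.1)).2 (hθ.idem _)
      rwa [θ.left_inv h2.1] at this
    have h4 : (θ.symm ζ)⁻¹ * g₁ ∈ MulAction.stabilizer G p := by
      rw [MulAction.mem_stabilizer_iff, mul_smul, ← h3, inv_smul_smul]
    have h5 : ζ = 0 := by
      refine hinj ζ h2.2.2 (hθ.idem _) (((θ.symm ζ)⁻¹ * g₁) • s) (hW₂H _ h4 _ hs.1) (h⁻¹ • s')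
        (hW₂H _ (inv_mem hh) _ hs'.1) (hQinv _ h4 _ hs.1 hQs) (hQinv _ (inv_mem hh) _ hs'.1 hQs') ?_
      rw [smul_smul, mul_inv_cancel_left, hg₁, mul_smul, hg]
    rw [h5, hθ.symm_zero, inv_one, one_mul] at h4
    have h6 := mul_mem hh h4
    rwa [hg₁, mul_inv_cancel_left] at h6
  let S : Set M := {s | s ∈ W₂ ∩ W₃ ∧ Q (ψ s) = 0}
  let B : Set E := D₀ ∩ (fun v => ψ.symm (v - Q v)) ⁻¹' (W₂ ∩ W₃)
  have hB : IsOpen B :=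
    ContinuousOn.isOpen_inter_preimage (hψs'.comp hsub.contMDiffOn (fun v hv => hv.2)).continuousOn
      hD₀ (hW₂.inter hW₃)
  have h0B : (0 : E) ∈ B := ⟨h0D₀, by simpa [hψ0] using ⟨hpW₂, hpW₃⟩⟩
  let e' := e.restrOpen B hB
  have he'src : e'.source = e.source ∩ B := OpenPartialHomeomorph.restrOpen_source _ _ _
  let Ψ := ψ.trans e'.symm
  have hΨsrc : Ψ.source = ψ.source ∩ ψ ⁻¹' e'.target := OpenPartialHomeomorph.trans_source _ _
  have hΨsymm : ∀ v ∈ e'.source, ψ.symm (e' v) = Θ v := fun v hv => by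
    rw [he'src] at hv
    rw [show e' v = ψ (Θ v) from heΞ v, ψ.left_inv (heD hv.1).2]
  have h0e' : (0 : E) ∈ e'.source := he'src ▸ ⟨h0e, h0B⟩
  have he'0 : e' 0 = 0 := (heΞ 0).trans hΞ0
  have hpΨ : p ∈ Ψ.source := by
    rw [hΨsrc]
    refine ⟨hpψ, ?_⟩
    rw [Set.mem_preimage, hψp, ← he'0]
    exact e'.map_source h0e'
  have hΨp : Ψ p = 0 := by
    change e'.symm (ψ p) = 0
    rw [hψp]
    nth_rewrite 1 [← he'0]
    exact e'.left_inv h0e'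
  have he's : ContDiffOn ℝ ∞ e'.symm e'.target := hes'.mono Set.inter_subset_left
  refine ⟨Ψ, S, ψ, hpΨ, hΨp, ?_, ?_, ?_, ?_, ?_, ?_, ?_, ?_⟩
  · rw [hΨsrc]
    exact (contMDiffOn_iff_contDiffOn.2 he's).comp (hψs.mono Set.inter_subset_left)
      Set.inter_subset_right
  · have h1 : Ψ.target = e'.source ∩ e' ⁻¹' ψ.target := OpenPartialHomeomorph.trans_target _ _
    rw [h1]
    refine hψs'.comp ?_ Set.inter_subset_right
    refine ((contMDiffOn_iff_contDiffOn.2 hΞs).congr fun v _ => heΞ v).mono ?_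
    exact fun v hv => heD (he'src ▸ hv.1).1
  · have h1 : HasFDerivAt e'.symm (ContinuousLinearMap.id ℝ E) 0 := by
      have h2 : (0 : E) ∈ e'.target := he'0 ▸ e'.map_source h0e'
      have h3 : e'.symm 0 = 0 := by
        nth_rewrite 1 [← he'0]
        exact e'.left_inv h0e'
      refine e'.hasFDerivAt_symm (f' := ContinuousLinearEquiv.refl ℝ E) h2 ?_
      rw [h3]
      exact hdΞ.congr_of_eventuallyEq (Filter.Eventually.of_forall heΞ)
    have h2 := hasMFDerivAt_comp_of_eq h1.hasMFDerivAt hdψ hψp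
    exact h2
  · intro x hx
    rw [hΨsrc] at hx
    let v := e'.symm (ψ x)
    have hv : v ∈ e'.source := e'.map_target hx.2
    have hxv : x = Θ v := by
      rw [← hΨsymm v hv, e'.right_inv hx.2, ψ.left_inv hx.1]
    have hvB : v ∈ B := (he'src ▸ hv : v ∈ e.source ∩ B).2
    have h1 : ψ (ψ.symm (v - Q v)) = v - Q v := ψ.right_inv hvB.1.2
    refine ⟨(θ.symm (lam v))⁻¹, ?_⟩
    rw [hxv, inv_smul_smul]
    refine ⟨⟨hvB.2, ?_⟩, ?_⟩
    · rw [h1, map_sub, hQQ, sub_self]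
    · rw [h1, ← hxv]
      change v - (v - Q v) ∈ _
      rw [sub_sub_cancel]
      exact hQV v
  · exact fun s hs g hg => hslice s hs.1 (g • s) hg.1 hs.2 hg.2 g rfl
  · exact fun h hh s hs => (hψH h hh s (hW₂sub hs.1.1).2).2
  · intro h hh s hs h1
    exact ψ.injOn (hψH h hh s (hW₂sub hs.1.1).2).1 (hW₂sub hs.1.1).2 h1
  · intro h hh s hs h1
    -- On `S` coordinates lie in the invariant complement ker `Q`, so the difference is both
    -- vertical and in ker `Q`, hence zero.
    have h2 := hQid _ h1
    rw [map_sub, hQH h hh, hs.2, map_zero, sub_zero] at h2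
    exact (sub_eq_zero.1 h2.symm)

end Slice

/-- The derivative of a map with values in a subspace has values in that subspace. -/
theorem mem_of_hasMFDerivAt_of_eventually_mem {F E : Type*} [NormedAddCommGroup F]
    [NormedSpace ℝ F] [NormedAddCommGroup E] [NormedSpace ℝ E] [FiniteDimensional ℝ E]
    {N : Type*} [TopologicalSpace N] [ChartedSpace F N] {f : N → E} {x : N} {D : F →L[ℝ] E}
    (hf : HasMFDerivAt 𝓘(ℝ, F) 𝓘(ℝ, E) f x D) {S : Submodule ℝ E} (hS : ∀ᶠ z in 𝓝 x, f z ∈ S)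
    (v : F) : D v ∈ S := by
  by_contra hv
  obtain ⟨a, hav, haS⟩ := Submodule.exists_le_ker_of_notMem hv
  let a' : E →L[ℝ] ℝ := LinearMap.toContinuousLinearMap a
  have h1 := hasMFDerivAt_comp_of_eq a'.hasFDerivAt.hasMFDerivAt hf rfl
  have h2 : HasMFDerivAt 𝓘(ℝ, F) 𝓘(ℝ, ℝ) (fun z => a' (f z)) x (0 : F →L[ℝ] ℝ) :=
    (hasMFDerivAt_const (0 : ℝ) x).congr_of_eventuallyEq (hS.mono fun z hz => haS hz)
  exact hav (DFunLike.congr_fun (hasMFDerivAt_unique h1 h2) v)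

/-! ### Orbit types and invariant functions in a slice chart -/

section Slice

universe u

variable {A : Type*} [NormedAddCommGroup A] [NormedSpace ℝ A] [FiniteDimensional ℝ A]
  {G : Type*} [TopologicalSpace G] [ChartedSpace A G] [Group G] [LieGroup 𝓘(ℝ, A) ∞ G]
  {E : Type u} [NormedAddCommGroup E] [NormedSpace ℝ E] [FiniteDimensional ℝ E]
  {M : Type*} [TopologicalSpace M] [ChartedSpace E M] [MulAction G M]
  [ContMDiffSMul 𝓘(ℝ, A) 𝓘(ℝ, E) ∞ G M] [IsManifold 𝓘(ℝ, E) ∞ M] [ProperSMul G M]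
  {p : M} {Ψ : OpenPartialHomeomorph M E} {S : Set M} {y : M → E}

/-- In a slice chart at `p`, the orbit type set through `p` is a linear subspace. -/
theorem IsSliceChart.mem_orbitTypeSet_iff (hΨ : IsSliceChart A (G := G) E p Ψ S y)
    {K : Subgroup G} (hp : p ∈ orbitTypeSet M K) {x : M} (hx : x ∈ Ψ.source) :
    x ∈ orbitTypeSet M K ↔ Ψ x ∈ fixedModVertical A G E p := by
  obtain ⟨g, hgS, hg⟩ := hΨ.exists_smul x hx
  have hle : MulAction.stabilizer G (g • x) ≤ MulAction.stabilizer G p := fun h hh =>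
    hΨ.mem_stabilizer _ hgS h (by rwa [show h • g • x = g • x from hh])
  have h1 : Ψ x ∈ fixedModVertical A G E p ↔ y (g • x) ∈ fixedModVertical A G E p := by
    have := range_infAct_le_fixedModVertical p hg
    exact ⟨fun h => by simpa using Submodule.sub_mem _ h this,
      fun h => by simpa using Submodule.add_mem _ this h⟩
  -- On the slice, being fixed modulo vertical vectors is the same as being fixed, by the `disjoint`
  -- clause, and the coordinate `y` detects fixed points.
  have h2 : y (g • x) ∈ fixedModVertical A G E p ↔
      MulAction.stabilizer G p ≤ MulAction.stabilizer G (g • x) := by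
    constructor
    · intro h k hk
      refine hΨ.smul_eq_of_map_eq k hk _ hgS ?_
      rw [hΨ.map_smul k hk _ hgS]
      exact hΨ.disjoint k hk _ hgS (h k hk)
    · intro h k hk
      rw [← hΨ.map_smul k hk _ hgS, show k • g • x = g • x from h hk, sub_self]
      exact Submodule.zero_mem _
  rw [h1, h2]
  obtain ⟨a, ha⟩ := hp
  constructor
  · intro hxK
    obtain ⟨b, hb⟩ := smul_mem_orbitTypeSet K g hxK
    -- The isotropy group of `g • x` is contained in that of `p` and conjugate to it, so the two are
    -- equal.
    refine (stabilizer_eq_of_le_of_conj A E (k := b * a⁻¹) ?_ hle).ge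
    rw [hb, ha, Subgroup.map_map]
    congr 1
    ext x
    simp [mul_assoc]
  · intro h
    have h3 : g • x ∈ orbitTypeSet M K := ⟨a, (le_antisymm hle h).trans ha⟩
    simpa using smul_mem_orbitTypeSet K g⁻¹ h3

/-- Moving a point into the slice changes its coordinate by a vertical vector, and two slice points
on one orbit differ by an isotropy element. The covector `a` sees neither change. -/
theorem IsSliceChart.apply_map_smul (hΨ : IsSliceChart A (G := G) E p Ψ S y) {a : E →L[ℝ] ℝ}
    (ha : ∀ v ∈ (infAct A G E p).range, a v = 0)
    (haH : ∀ h ∈ MulAction.stabilizer G p, ∀ v, a (smulDeriv A E h p v) = a v) {g : G} {x : M}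
    (hx : x ∈ Ψ.source) (hgx : g • x ∈ Ψ.source) : a (Ψ (g • x)) = a (Ψ x) := by
  obtain ⟨g₁, hS₁, h₁⟩ := hΨ.exists_smul x hx
  obtain ⟨g₂, hS₂, h₂⟩ := hΨ.exists_smul _ hgx
  have e₁ := ha _ h₁
  have e₂ := ha _ h₂
  rw [map_sub, sub_eq_zero] at e₁ e₂
  have h3 : g₂ • g • x = (g₂ * g * g₁⁻¹) • g₁ • x := by simp [mul_smul]
  rw [h3] at e₂ hS₂
  have h4 := hΨ.mem_stabilizer _ hS₁ _ hS₂
  rw [e₂, hΨ.map_smul _ h4 _ hS₁, haH _ h4, e₁]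

/-- A covector at `p` that is invariant under the isotropy group and vanishes on the orbit is the
differential of an invariant function. -/
theorem IsSliceChart.exists_invariant_function (hΨ : IsSliceChart A (G := G) E p Ψ S y)
    {a : E →L[ℝ] ℝ} (ha : ∀ v ∈ (infAct A G E p).range, a v = 0)
    (haH : ∀ h ∈ MulAction.stabilizer G p, ∀ v, a (smulDeriv A E h p v) = a v) :
    ∃ (U : Set M) (f : M → ℝ), IsOpen U ∧ p ∈ U ∧ (∀ (g : G), ∀ x ∈ U, g • x ∈ U) ∧
      ContMDiffOn 𝓘(ℝ, E) 𝓘(ℝ, ℝ) ∞ f U ∧ (∀ (g : G), ∀ x ∈ U, f (g • x) = f x) ∧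
      HasMFDerivAt 𝓘(ℝ, E) 𝓘(ℝ, ℝ) f p a := by
  classical
  let f : M → ℝ := fun x => if h : ∃ g : G, g • x ∈ Ψ.source then a (Ψ (h.choose • x)) else 0
  have hf : ∀ (g : G) (x : M), g • x ∈ Ψ.source → f x = a (Ψ (g • x)) := by
    intro g x hx
    have h : ∃ g : G, g • x ∈ Ψ.source := ⟨g, hx⟩
    simp only [f, dif_pos h]
    have h1 := h.choose_spec
    set g' := h.choose
    rw [show g' • x = (g' * g⁻¹) • g • x by simp [mul_smul]] at h1 ⊢
    exact hΨ.apply_map_smul ha haH hx h1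
  have hcont : ∀ g : G, Continuous fun x : M => g • x := fun g =>
    (contMDiff_smulMap (E := E) A g).continuous
  refine ⟨{x | ∃ g : G, g • x ∈ Ψ.source}, f, ?_, ⟨1, by simpa using hΨ.mem_source⟩, ?_, ?_, ?_, ?_⟩
  · rw [Set.ofPred_exists]
    exact isOpen_iUnion fun g => Ψ.open_source.preimage (hcont g)
  · rintro g x ⟨k, hk⟩
    exact ⟨k * g⁻¹, by simpa [mul_smul] using hk⟩
  · rintro x ⟨g, hg⟩
    refine ContMDiffAt.contMDiffWithinAt ?_
    have h1 : ContMDiffAt 𝓘(ℝ, E) 𝓘(ℝ, ℝ) ∞ (fun z => a (Ψ (g • z))) x :=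
      (a.contMDiff.contMDiffAt).comp x (ContMDiffAt.comp x
        (hΨ.contMDiffOn.contMDiffAt (Ψ.open_source.mem_nhds hg)) (contMDiff_smulMap A g x))
    refine h1.congr_of_eventuallyEq ?_
    filter_upwards [(Ψ.open_source.preimage (hcont g)).mem_nhds hg] with z hz using hf g z hz
  · rintro g x ⟨k, hk⟩
    have h1 : (k * g⁻¹) • g • x = k • x := by simp [mul_smul]
    rw [hf k x hk, hf (k * g⁻¹) (g • x) (by rwa [h1]), h1]
  · have h1 := hasMFDerivAt_comp_of_eq a.hasFDerivAt.hasMFDerivAt hΨ.hasMFDerivAt rfl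
    refine HasMFDerivAt.congr_of_eventuallyEq (f := a ∘ Ψ) h1 ?_
    filter_upwards [Ψ.open_source.mem_nhds hΨ.mem_source] with z hz
    simpa using hf 1 z (by simpa using hz)

variable (A E) in
theorem exists_invariant_function {a : E →L[ℝ] ℝ} (ha : ∀ v ∈ (infAct A G E p).range, a v = 0)
    (haH : ∀ h ∈ MulAction.stabilizer G p, ∀ v, a (smulDeriv A E h p v) = a v) :
    ∃ (U : Set M) (f : M → ℝ), IsOpen U ∧ p ∈ U ∧ (∀ (g : G), ∀ x ∈ U, g • x ∈ U) ∧
      ContMDiffOn 𝓘(ℝ, E) 𝓘(ℝ, ℝ) ∞ f U ∧ (∀ (g : G), ∀ x ∈ U, f (g • x) = f x) ∧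
      HasMFDerivAt 𝓘(ℝ, E) 𝓘(ℝ, ℝ) f p a := by
  obtain ⟨Ψ, S, y, hΨ⟩ := exists_isSliceChart A (G := G) E p
  exact hΨ.exists_invariant_function ha haH

/-- A smooth chart and its inverse have mutually inverse derivatives. -/
theorem OpenPartialHomeomorph.exists_hasMFDerivAt_equiv {Ψ : OpenPartialHomeomorph M E}
    (hs : ContMDiffOn 𝓘(ℝ, E) 𝓘(ℝ, E) ∞ Ψ Ψ.source)
    (hs' : ContMDiffOn 𝓘(ℝ, E) 𝓘(ℝ, E) ∞ Ψ.symm Ψ.target) {x : M} (hx : x ∈ Ψ.source) :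
    ∃ D : E ≃L[ℝ] E, HasMFDerivAt 𝓘(ℝ, E) 𝓘(ℝ, E) Ψ x (D : E →L[ℝ] E) ∧
      HasMFDerivAt 𝓘(ℝ, E) 𝓘(ℝ, E) Ψ.symm (Ψ x) (D.symm : E →L[ℝ] E) := by
  have h1 := ((hs.contMDiffAt (Ψ.open_source.mem_nhds hx)).mdifferentiableAt
    (by simp)).hasMFDerivAt
  have h2 := ((hs'.contMDiffAt (Ψ.open_target.mem_nhds (Ψ.map_source hx))).mdifferentiableAt
    (by simp)).hasMFDerivAt
  set d₁ : E →L[ℝ] E := mfderiv 𝓘(ℝ, E) 𝓘(ℝ, E) Ψ x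
  set d₂ : E →L[ℝ] E := mfderiv 𝓘(ℝ, E) 𝓘(ℝ, E) Ψ.symm (Ψ x)
  have h3 : d₂.comp d₁ = ContinuousLinearMap.id ℝ E := by
    refine hasMFDerivAt_unique (hasMFDerivAt_comp_of_eq h2 h1 rfl)
      ((hasMFDerivAt_id x).congr_of_eventuallyEq ?_)
    filter_upwards [Ψ.open_source.mem_nhds hx] with z hz using Ψ.left_inv hz
  have h4 : d₁.comp d₂ = ContinuousLinearMap.id ℝ E := by
    refine hasMFDerivAt_unique (hasMFDerivAt_comp_of_eq h1 h2 (Ψ.left_inv hx))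
      ((hasMFDerivAt_id (Ψ x)).congr_of_eventuallyEq ?_)
    filter_upwards [Ψ.open_target.mem_nhds (Ψ.map_source hx)] with z hz using Ψ.right_inv hz
  exact ⟨ContinuousLinearEquiv.equivOfInverse d₁ d₂ (fun v => DFunLike.congr_fun h3 v)
    (fun v => DFunLike.congr_fun h4 v), h1, h2⟩

/-- The tangent spaces of an orbit type set, in a slice chart. -/
theorem IsSliceChart.exists_map_fixedModVertical (hΨ : IsSliceChart A (G := G) E p Ψ S y)
    {K : Subgroup G} (hp : p ∈ orbitTypeSet M K) {x : M} (hx : x ∈ Ψ.source)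
    (hxK : x ∈ orbitTypeSet M K) :
    ∃ D : E ≃L[ℝ] E, HasMFDerivAt 𝓘(ℝ, E) 𝓘(ℝ, E) Ψ x (D : E →L[ℝ] E) ∧
      HasMFDerivAt 𝓘(ℝ, E) 𝓘(ℝ, E) Ψ.symm (Ψ x) (D.symm : E →L[ℝ] E) ∧
      ∀ v, v ∈ fixedModVertical A G E x ↔ D v ∈ fixedModVertical A G E p := by
  obtain ⟨D, hD, hD'⟩ := OpenPartialHomeomorph.exists_hasMFDerivAt_equiv hΨ.contMDiffOn
    hΨ.contMDiffOn_symm hx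
  obtain ⟨Ψ', S', y', hΨ'⟩ := exists_isSliceChart A (G := G) E x
  obtain ⟨D₁, hD₁, hD₁'⟩ := OpenPartialHomeomorph.exists_hasMFDerivAt_equiv hΨ'.contMDiffOn
    hΨ'.contMDiffOn_symm hΨ'.mem_source
  have hD₁id : (D₁ : E →L[ℝ] E) = ContinuousLinearMap.id ℝ E :=
    hasMFDerivAt_unique hD₁ hΨ'.hasMFDerivAt
  have hD₁v : ∀ v, D₁ v = v := fun v => DFunLike.congr_fun hD₁id v
  refine ⟨D, hD, hD', fun v => ?_⟩
  -- If two charts around `x` both turn the orbit type set into a subspace, a straight line in the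
  -- first subspace stays in the orbit type set, so its velocity in the second chart lies in the
  -- second subspace. Apply this both ways to slice charts at `x` and `p`.
  have key : ∀ (w : E) (Φ Φ' : OpenPartialHomeomorph M E) (d d' : E ≃L[ℝ] E) (q q' : M),
      x ∈ Φ.source → x ∈ Φ'.source → w ∈ fixedModVertical A G E q →
      HasMFDerivAt 𝓘(ℝ, E) 𝓘(ℝ, E) Φ.symm (Φ x) (d : E →L[ℝ] E) →
      HasMFDerivAt 𝓘(ℝ, E) 𝓘(ℝ, E) Φ' x (d' : E →L[ℝ] E) →
      (∀ z ∈ Φ.source, (z ∈ orbitTypeSet M K ↔ Φ z ∈ fixedModVertical A G E q)) →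
      (∀ z ∈ Φ'.source, (z ∈ orbitTypeSet M K ↔ Φ' z ∈ fixedModVertical A G E q')) →
      d' (d w) ∈ fixedModVertical A G E q' := by
    intro w Φ Φ' d d' q q' hxΦ hxΦ' hw hd hd' hΦ hΦ'
    have h1 : HasFDerivAt (fun t : ℝ => Φ x + t • w)
        ((ContinuousLinearMap.id ℝ ℝ).smulRight w) 0 :=
      (((ContinuousLinearMap.id ℝ ℝ).smulRight w).hasFDerivAt).const_add _
    have h2 := hasMFDerivAt_comp_of_eq hd h1.hasMFDerivAt (by simp)
    have h3 := hasMFDerivAt_comp_of_eq hd' h2 (by simpa using Φ.left_inv hxΦ)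
    have h4 := mem_of_hasMFDerivAt_of_eventually_mem (S := fixedModVertical A G E q') h3 ?_ 1
    · have h8 : d' (d ((1 : ℝ) • w)) ∈ fixedModVertical A G E q' := h4
      rwa [one_smul] at h8
    have h5 : ContinuousAt (fun t : ℝ => Φ x + t • w) 0 := by fun_prop
    have h6 : ∀ᶠ t in 𝓝 (0 : ℝ), Φ x + t • w ∈ Φ.target :=
      h5.eventually_mem (Φ.open_target.mem_nhds (by simpa using Φ.map_source hxΦ))
    have h7 : ∀ᶠ t in 𝓝 (0 : ℝ), Φ.symm (Φ x + t • w) ∈ Φ'.source :=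
      h2.continuousAt.eventually_mem (Φ'.open_source.mem_nhds
        (by simpa [Φ.left_inv hxΦ] using hxΦ'))
    filter_upwards [h6, h7] with t ht ht'
    refine (hΦ' _ ht').1 ((hΦ _ (Φ.map_target ht)).2 ?_)
    rw [Φ.right_inv ht]
    exact Submodule.add_mem _ ((hΦ x hxΦ).1 hxK) (Submodule.smul_mem _ _ hw)
  constructor
  · intro hv
    have := key v Ψ' Ψ D₁.symm D x p hΨ'.mem_source hx hv hD₁' hD
      (fun z hz => hΨ'.mem_orbitTypeSet_iff hxK hz) (fun z hz => hΨ.mem_orbitTypeSet_iff hp hz)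
    rwa [show D₁.symm v = v from D₁.injective (by rw [D₁.apply_symm_apply, hD₁v])] at this
  · intro hv
    have := key (D v) Ψ Ψ' D.symm D₁ p x hx hΨ'.mem_source hv hD' hD₁
      (fun z hz => hΨ.mem_orbitTypeSet_iff hp hz) (fun z hz => hΨ'.mem_orbitTypeSet_iff hxK hz)
    rwa [D.symm_apply_apply, hD₁v] at this

theorem IsSliceChart.finrank_fixedModVertical_eq (hΨ : IsSliceChart A (G := G) E p Ψ S y)
    {K : Subgroup G} (hp : p ∈ orbitTypeSet M K) {x : M} (hx : x ∈ Ψ.source)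
    (hxK : x ∈ orbitTypeSet M K) :
    Module.finrank ℝ (fixedModVertical A G E x) = Module.finrank ℝ (fixedModVertical A G E p) := by
  obtain ⟨D, -, -, hD⟩ := hΨ.exists_map_fixedModVertical hp hx hxK
  refine LinearEquiv.finrank_eq (LinearEquiv.ofSubmodules D.toLinearEquiv _ _ ?_)
  ext v
  constructor
  · rintro ⟨w, hw, rfl⟩
    exact (hD w).1 hw
  · intro hv
    refine ⟨D.symm v, (hD _).2 (by simpa using hv), by simp⟩

end Slice

/-- Linear coordinates on a finite-dimensional space adapted to a subspace. -/
theorem exists_equiv_prod_of_submodule {F F' E : Type*} [NormedAddCommGroup F]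
    [NormedSpace ℝ F] [FiniteDimensional ℝ F] [NormedAddCommGroup F'] [NormedSpace ℝ F']
    [FiniteDimensional ℝ F'] [NormedAddCommGroup E] [NormedSpace ℝ E] [FiniteDimensional ℝ E]
    (T : Submodule ℝ E) (hF : Module.finrank ℝ T = Module.finrank ℝ F)
    (hF' : Module.finrank ℝ F + Module.finrank ℝ F' = Module.finrank ℝ E) :
    ∃ e : (F × F') ≃L[ℝ] E, ∀ v, v ∈ T ↔ e ((e.symm v).1, 0) = v := by
  obtain ⟨T', hT'⟩ := T.exists_isCompl
  have h1 := Submodule.finrank_add_eq_of_isCompl hT'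
  let e₁ : F ≃ₗ[ℝ] T := LinearEquiv.ofFinrankEq _ _ hF.symm
  let e₂ : F' ≃ₗ[ℝ] T' := LinearEquiv.ofFinrankEq _ _ (by omega)
  let e := ((e₁.prodCongr e₂).trans (Submodule.prodEquivOfIsCompl T T' hT')).toContinuousLinearEquiv
  have he : ∀ u w, e (u, w) = (e₁ u : E) + (e₂ w : E) := fun u w => rfl
  refine ⟨e, fun v => ⟨fun hv => ?_, fun hv => ?_⟩⟩
  · have h2 : e (e₁.symm ⟨v, hv⟩, 0) = v := by simp [he]
    nth_rewrite 1 [← h2]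
    rw [e.symm_apply_apply, h2]
  · rw [← hv, he]
    simp

/-! ### Submanifold structure from charts in which a subset is linear -/

section Submanifold

variable {E : Type*} [NormedAddCommGroup E] [NormedSpace ℝ E]
  {M : Type*} [TopologicalSpace M] [ChartedSpace E M]
  {F F' : Type*} [NormedAddCommGroup F] [NormedSpace ℝ F]
  [NormedAddCommGroup F'] [NormedSpace ℝ F']
  {N : Type*} [TopologicalSpace N]

/-- The chart of a subspace of `M` obtained from a chart of `M` in which it is linear. -/
theorem exists_sliceRestriction [Nonempty N] {ι : N → M} (hι : IsEmbedding ι) (Ψ : OpenPartialHomeomorph M E)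
    (e : (F × F') ≃L[ℝ] E)
    (hΨ : ∀ x ∈ Ψ.source, x ∈ Set.range ι ↔ e ((e.symm (Ψ x)).1, 0) = Ψ x) :
    ∃ φ : OpenPartialHomeomorph N F, φ.source = ι ⁻¹' Ψ.source ∧
      (∀ q, φ q = (e.symm (Ψ (ι q))).1) ∧ (∀ u ∈ φ.target, e (u, 0) ∈ Ψ.target) ∧
      ∀ u ∈ φ.target, ι (φ.symm u) = Ψ.symm (e (u, 0)) := by
  -- `Function.invFun` gives a true preimage here: by `hΨ`, a point with coordinate `e (u, 0)` lies
  -- in the range of `ι`.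
  have hinv : ∀ u, e (u, 0) ∈ Ψ.target →
      ι (Function.invFun ι (Ψ.symm (e (u, 0)))) = Ψ.symm (e (u, 0)) := fun u hu =>
    Function.invFun_eq ((hΨ _ (Ψ.map_target hu)).2 (by rw [Ψ.right_inv hu]; simp))
  have hmem : ∀ q, ι q ∈ Ψ.source → e ((e.symm (Ψ (ι q))).1, 0) = Ψ (ι q) :=
    fun q hq => (hΨ _ hq).1 ⟨q, rfl⟩
  refine ⟨{ toFun := fun q => (e.symm (Ψ (ι q))).1
            invFun := fun u => Function.invFun ι (Ψ.symm (e (u, 0)))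
            source := ι ⁻¹' Ψ.source
            target := (fun u : F => e (u, 0)) ⁻¹' Ψ.target
            map_source' := fun q hq => ?_
            map_target' := fun u hu => ?_
            left_inv' := fun q hq => ?_
            right_inv' := fun u hu => ?_
            open_source := Ψ.open_source.preimage hι.continuous
            open_target := Ψ.open_target.preimage (by fun_prop)
            continuousOn_toFun := ?_
            continuousOn_invFun := ?_ }, rfl, fun q => rfl, fun u hu => hu, hinv⟩
  · change e ((e.symm (Ψ (ι q))).1, 0) ∈ Ψ.target
    rw [hmem q hq]
    exact Ψ.map_source hq
  · rw [Set.mem_preimage, hinv u hu]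
    exact Ψ.map_target hu
  · refine hι.injective ?_
    rw [hinv _ (by rw [hmem q hq]; exact Ψ.map_source hq), hmem q hq, Ψ.left_inv hq]
  · rw [hinv u hu, Ψ.right_inv hu]
    simp
  · exact (continuous_fst.comp e.symm.continuous).comp_continuousOn
      (Ψ.continuousOn.comp hι.continuous.continuousOn fun q hq => hq)
  · rw [hι.isInducing.continuousOn_iff]
    refine (Ψ.continuousOn_symm.comp (f := fun u : F => e (u, 0))
      (by fun_prop) fun u hu => hu).congr fun u hu => hinv u hu

variable [IsManifold 𝓘(ℝ, E) ∞ M]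

/-- A subspace of a manifold that is linear in suitable charts is an embedded submanifold. -/
theorem exists_chartedSpace_of_sliceCharts {ι : N → M} (hι : IsEmbedding ι)
    (h : ∀ q : N, ∃ (Ψ : OpenPartialHomeomorph M E) (e : (F × F') ≃L[ℝ] E), ι q ∈ Ψ.source ∧
      ContMDiffOn 𝓘(ℝ, E) 𝓘(ℝ, E) ∞ Ψ Ψ.source ∧
      ContMDiffOn 𝓘(ℝ, E) 𝓘(ℝ, E) ∞ Ψ.symm Ψ.target ∧
      ∀ x ∈ Ψ.source, x ∈ Set.range ι ↔ e ((e.symm (Ψ x)).1, 0) = Ψ x) :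
    ∃ _ : ChartedSpace F N, IsManifold 𝓘(ℝ, F) ∞ N ∧
      IsSmoothEmbedding 𝓘(ℝ, F) 𝓘(ℝ, E) ∞ ι := by
  choose Ψ e hmem hs hs' hΨ using h
  choose φ hsrc hφ htgt hφs using fun q =>
    have : Nonempty N := ⟨q⟩
    exists_sliceRestriction hι (Ψ q) (e q) (hΨ q)
  let _ : ChartedSpace F N :=
    { atlas := Set.range φ
      chartAt := φ
      mem_chart_source := fun q => by rw [hsrc]; exact hmem q
      chart_mem_atlas := fun q => ⟨q, rfl⟩ }
  have hM : IsManifold 𝓘(ℝ, F) ∞ N := by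
    refine isManifold_of_contDiffOn _ _ _ ?_
    rintro _ _ ⟨q, rfl⟩ ⟨q', rfl⟩
    rw [← contMDiffOn_iff_contDiffOn]
    have h1 : ContMDiff 𝓘(ℝ, F) 𝓘(ℝ, E) ∞ (fun u : F => e q (u, 0)) :=
      ((e q).contDiff.comp (contDiff_id.prodMk contDiff_const)).contMDiff
    have h2 : ContMDiff 𝓘(ℝ, E) 𝓘(ℝ, F) ∞ (fun v : E => ((e q').symm v).1) :=
      (contDiff_fst.comp (e q').symm.contDiff).contMDiff
    have h3 := (h2.contMDiffOn (s := Set.univ)).comp ((hs q').comp ((hs' q).comp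
      (h1.contMDiffOn (s := (φ q).target ∩ (φ q).symm ⁻¹' (φ q').source)) fun u hu => htgt q u hu.1)
      (fun u hu => ?_)) (fun _ _ => trivial)
    · refine (h3.congr (fun u hu => ?_)).mono (fun u hu => ?_)
      · change φ q' ((φ q).symm u) = _
        rw [hφ, hφs q u hu.1]
        rfl
      · simpa using hu
    · have h4 := hu.2
      rw [hsrc, Set.mem_preimage, Set.mem_preimage, hφs q u hu.1] at h4
      exact h4
  refine ⟨inferInstance, hM, IsImmersionOfComplement.isImmersion (F := F') fun q => ?_, hι⟩
  refine IsImmersionAtOfComplement.mk_of_continuousAt hι.continuous.continuousAt (e q) (φ q) (Ψ q)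
    (by rw [hsrc]; exact hmem q) (hmem q)
    (IsManifold.subset_maximalAtlas ⟨q, rfl⟩)
    ((IsManifold.mem_maximalAtlas_iff_contMDiffOn _).2 ⟨hs q, hs' q⟩) ?_
  intro u hu
  have hu' : u ∈ (φ q).target := by simpa using hu
  change Ψ q (ι ((φ q).symm u)) = e q (u, 0)
  rw [hφs q u hu', (Ψ q).right_inv (htgt q u hu')]

end Submanifold

/-! ### Strata are embedded submanifolds -/

section Stratum

universe u

variable {A : Type*} [NormedAddCommGroup A] [NormedSpace ℝ A] [FiniteDimensional ℝ A]
  {G : Type*} [TopologicalSpace G] [ChartedSpace A G] [Group G] [LieGroup 𝓘(ℝ, A) ∞ G]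
  {E : Type u} [NormedAddCommGroup E] [NormedSpace ℝ E] [FiniteDimensional ℝ E]
  {M : Type*} [TopologicalSpace M] [ChartedSpace E M] [MulAction G M]
  [ContMDiffSMul 𝓘(ℝ, A) 𝓘(ℝ, E) ∞ G M]

theorem IsSliceChart.restrOpen {p : M} {Ψ : OpenPartialHomeomorph M E} {S : Set M} {y : M → E}
    (hΨ : IsSliceChart A (G := G) E p Ψ S y) {U : Set M} (hU : IsOpen U) (hp : p ∈ U) :
    IsSliceChart A (G := G) E p (Ψ.restrOpen U hU) S y where
  mem_source := ⟨hΨ.mem_source, hp⟩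
  map_self := hΨ.map_self
  contMDiffOn := hΨ.contMDiffOn.mono Set.inter_subset_left
  contMDiffOn_symm := hΨ.contMDiffOn_symm.mono Set.inter_subset_left
  hasMFDerivAt := hΨ.hasMFDerivAt
  exists_smul := fun x hx => hΨ.exists_smul x hx.1
  mem_stabilizer := hΨ.mem_stabilizer
  map_smul := hΨ.map_smul
  smul_eq_of_map_eq := hΨ.smul_eq_of_map_eq
  disjoint := hΨ.disjoint

variable [IsManifold 𝓘(ℝ, E) ∞ M] [ProperSMul G M]

variable (A E) in
-- Over a ball, the orbit type set corresponds to a subspace intersected with the ball. This set is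
-- convex, so all points of the orbit type set near `p` lie in the component of `p`.
theorem exists_isSliceChart_component {K : Subgroup G} {p m₀ : M}
    (hp : p ∈ connectedComponentIn (orbitTypeSet M K) m₀) :
    ∃ (Ψ : OpenPartialHomeomorph M E) (S : Set M) (y : M → E),
      IsSliceChart A (G := G) E p Ψ S y ∧ ∀ x ∈ Ψ.source,
        x ∈ connectedComponentIn (orbitTypeSet M K) m₀ ↔ Ψ x ∈ fixedModVertical A G E p := by
  obtain ⟨Ψ, S, y, hΨ⟩ := exists_isSliceChart A (G := G) E p
  have hpK := connectedComponentIn_subset _ _ hp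
  have h0 : (0 : E) ∈ Ψ.target := hΨ.map_self ▸ Ψ.map_source hΨ.mem_source
  obtain ⟨r, hr, hball⟩ := Metric.isOpen_iff.1 Ψ.open_target 0 h0
  have hU := Ψ.isOpen_inter_preimage (Metric.isOpen_ball (x := (0 : E)) (ε := r))
  refine ⟨Ψ.restrOpen _ hU, S, y, hΨ.restrOpen hU ⟨hΨ.mem_source, ?_⟩, ?_⟩
  · rw [Set.mem_preimage, hΨ.map_self]
    exact Metric.mem_ball_self hr
  rintro x ⟨hx, -, hxr⟩
  change _ ↔ Ψ x ∈ _
  rw [← hΨ.mem_orbitTypeSet_iff hpK hx]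
  refine ⟨fun h => connectedComponentIn_subset _ _ h, fun h => ?_⟩
  rw [connectedComponentIn_eq hp]
  have hconv : Convex ℝ ((fixedModVertical A G E p : Set E) ∩ Metric.ball 0 r) :=
    (Submodule.convex _).inter (convex_ball _ _)
  have hconn : IsPreconnected (Ψ.symm '' ((fixedModVertical A G E p : Set E) ∩ Metric.ball 0 r)) :=
    hconv.isPreconnected.image _ (Ψ.continuousOn_symm.mono fun v hv => hball hv.2)
  refine hconn.subset_connectedComponentIn
    ⟨0, ⟨Submodule.zero_mem _, Metric.mem_ball_self hr⟩, ?_⟩ ?_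
    ⟨Ψ x, ⟨(hΨ.mem_orbitTypeSet_iff hpK hx).1 h, hxr⟩, Ψ.left_inv hx⟩
  · rw [← hΨ.map_self, Ψ.left_inv hΨ.mem_source]
  · rintro _ ⟨v, ⟨hv, hvr⟩, rfl⟩
    rw [hΨ.mem_orbitTypeSet_iff hpK (Ψ.map_target (hball hvr)), Ψ.right_inv (hball hvr)]
    exact hv

variable (A E) in
theorem finrank_fixedModVertical_eq_of_mem_component {K : Subgroup G} {p q m₀ : M}
    (hp : p ∈ connectedComponentIn (orbitTypeSet M K) m₀)
    (hq : q ∈ connectedComponentIn (orbitTypeSet M K) m₀) :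
    Module.finrank ℝ (fixedModVertical A G E p) = Module.finrank ℝ (fixedModVertical A G E q) := by
  refine isPreconnected_connectedComponentIn.constant
    (f := fun x => Module.finrank ℝ (fixedModVertical A G E x)) (fun x hx => ?_) hp hq
  obtain ⟨Ψ, S, y, hΨ⟩ := exists_isSliceChart A (G := G) E x
  refine tendsto_const_nhds.congr' ?_
  filter_upwards [self_mem_nhdsWithin, mem_nhdsWithin_of_mem_nhds
    (Ψ.open_source.mem_nhds hΨ.mem_source)] with z hz hzΨ
  exact (hΨ.finrank_fixedModVertical_eq (connectedComponentIn_subset _ _ hx) hzΨ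
    (connectedComponentIn_subset _ _ hz)).symm

/-- A component of an orbit type set is an embedded submanifold. -/
theorem exists_chartedSpace_of_range_eq_component (A : Type*) [NormedAddCommGroup A]
    [NormedSpace ℝ A] [FiniteDimensional ℝ A] {G : Type*} [TopologicalSpace G] [ChartedSpace A G]
    [Group G] [LieGroup 𝓘(ℝ, A) ∞ G] (E : Type u) [NormedAddCommGroup E] [NormedSpace ℝ E]
    [FiniteDimensional ℝ E] {M : Type*} [TopologicalSpace M] [ChartedSpace E M] [MulAction G M]
    [ContMDiffSMul 𝓘(ℝ, A) 𝓘(ℝ, E) ∞ G M] [IsManifold 𝓘(ℝ, E) ∞ M] [ProperSMul G M] {K : Subgroup G} {m₀ : M} {N : Type*}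
    [TopologicalSpace N] {ι : N → M} (hι : IsEmbedding ι)
    (hrange : Set.range ι = connectedComponentIn (orbitTypeSet M K) m₀) :
    ∃ (k : ℕ) (_ : ChartedSpace (EuclideanSpace ℝ (Fin k)) N), IsManifold (𝓡 k) ∞ N ∧
      IsSmoothEmbedding (𝓡 k) 𝓘(ℝ, E) ∞ ι := by
  -- Makes the truncated subtraction below the actual codimension.
  have hle : Module.finrank ℝ (fixedModVertical A G E m₀) ≤ Module.finrank ℝ E :=
    Submodule.finrank_le _
  refine ⟨Module.finrank ℝ (fixedModVertical A G E m₀), exists_chartedSpace_of_sliceCharts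
    (F' := EuclideanSpace ℝ (Fin (Module.finrank ℝ E -
      Module.finrank ℝ (fixedModVertical A G E m₀)))) hι fun q => ?_⟩
  have hq : ι q ∈ connectedComponentIn (orbitTypeSet M K) m₀ := hrange ▸ ⟨q, rfl⟩
  have hm₀ : m₀ ∈ connectedComponentIn (orbitTypeSet M K) m₀ :=
    mem_connectedComponentIn (by
      by_contra h
      rw [connectedComponentIn_eq_empty h] at hq
      exact hq)
  obtain ⟨Ψ, S, y, hΨ, hmem⟩ := exists_isSliceChart_component A (G := G) E hq
  obtain ⟨e, he⟩ := exists_equiv_prod_of_submodule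
    (F := EuclideanSpace ℝ (Fin (Module.finrank ℝ (fixedModVertical A G E m₀))))
    (F' := EuclideanSpace ℝ (Fin (Module.finrank ℝ E -
      Module.finrank ℝ (fixedModVertical A G E m₀)))) (fixedModVertical A G E (ι q))
    (by rw [finrank_euclideanSpace_fin, finrank_fixedModVertical_eq_of_mem_component A E hq hm₀])
    (by rw [finrank_euclideanSpace_fin, finrank_euclideanSpace_fin]; omega)
  refine ⟨Ψ, e, hΨ.mem_source, hΨ.contMDiffOn, hΨ.contMDiffOn_symm, fun x hx => ?_⟩
  rw [hrange, hmem x hx, he]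

end Stratum

/-! ### Calculus of smooth sections along a map -/

section Sections

variable {E : Type*} [NormedAddCommGroup E] [NormedSpace ℝ E]
  {M : Type*} [TopologicalSpace M] [ChartedSpace E M] [IsManifold 𝓘(ℝ, E) ∞ M]
  {F : Type*} [NormedAddCommGroup F] [NormedSpace ℝ F]
  {N : Type*} [TopologicalSpace N] [ChartedSpace F N]

/-- The differential of a function, as a one-form. -/
noncomputable def differential (f : M → ℝ) (x : M) : CotangentSpace 𝓘(ℝ, E) x :=
  mfderiv 𝓘(ℝ, E) 𝓘(ℝ, ℝ) f x

theorem smoothFormOn_differential {f : M → ℝ} {U : Set M} (hU : IsOpen U)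
    (hf : ContMDiffOn 𝓘(ℝ, E) 𝓘(ℝ, ℝ) ∞ f U) :
    SmoothFormOn 𝓘(ℝ, E) 𝓘(ℝ, E) (fun x : M => x) (differential f) U := by
  intro x₀ hx₀
  refine ContMDiffAt.contMDiffWithinAt ?_
  rw [contMDiffAt_hom_bundle]
  refine ⟨contMDiffAt_id, ?_⟩
  have h := (hf.contMDiffAt (hU.mem_nhds hx₀)).mfderiv_const (m := ∞) (by simp)
  refine h.congr_of_eventuallyEq (Filter.Eventually.of_forall fun x => ?_)
  ext v
  simp only [inTangentCoordinates, ContinuousLinearMap.inCoordinates, differential]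
  simp
  rfl

theorem contMDiffOn_form_apply {ι : N → M} {α : ∀ q, CotangentSpace 𝓘(ℝ, E) (ι q)}
    {X : ∀ q, TangentSpace 𝓘(ℝ, E) (ι q)} {U : Set N}
    (hα : SmoothFormOn 𝓘(ℝ, E) 𝓘(ℝ, F) ι α U) (hX : SmoothFieldOn 𝓘(ℝ, E) 𝓘(ℝ, F) ι X U) :
    ContMDiffOn 𝓘(ℝ, F) 𝓘(ℝ, ℝ) ∞ (fun q => (α q (X q) : ℝ)) U := by
  intro q hq
  have h := ContMDiffWithinAt.clm_bundle_apply (F₁ := E) (F₂ := ℝ)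
    (E₁ := fun m : M => TangentSpace 𝓘(ℝ, E) m) (E₂ := Bundle.Trivial M ℝ) (hα q hq) (hX q hq)
  have h2 := (contMDiffWithinAt_totalSpace.1 h).2
  exact h2

theorem smoothFormOn_sum_smul {κ : Type*} [Fintype κ] {ι : N → M}
    {σ : κ → ∀ q, CotangentSpace 𝓘(ℝ, E) (ι q)} {c : κ → N → ℝ} {U : Set N}
    (hι : ContMDiffOn 𝓘(ℝ, F) 𝓘(ℝ, E) ∞ ι U)
    (hσ : ∀ i, SmoothFormOn 𝓘(ℝ, E) 𝓘(ℝ, F) ι (σ i) U)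
    (hc : ∀ i, ContMDiffOn 𝓘(ℝ, F) 𝓘(ℝ, ℝ) ∞ (c i) U) :
    SmoothFormOn 𝓘(ℝ, E) 𝓘(ℝ, F) ι (fun q => ∑ i, c i q • σ i q) U := by
  intro q hq
  rw [contMDiffWithinAt_hom_bundle]
  refine ⟨hι q hq, ?_⟩
  have h1 := fun i => ((contMDiffWithinAt_hom_bundle _).1 (hσ i q hq)).2
  have h2 := ContMDiffWithinAt.sum (t := Finset.univ) fun i _ => ContMDiffWithinAt.smul (hc i q hq) (h1 i)
  refine h2.congr_of_mem (fun x hx => ?_) hq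
  ext v
  simp [ContinuousLinearMap.inCoordinates]

theorem smoothFieldOn_add_sum_smul {κ : Type*} [Fintype κ] {ι : N → M}
    {X : ∀ q, TangentSpace 𝓘(ℝ, E) (ι q)}
    {Y : κ → ∀ q, TangentSpace 𝓘(ℝ, E) (ι q)} {c : κ → N → ℝ} {U : Set N}
    (hι : ContMDiffOn 𝓘(ℝ, F) 𝓘(ℝ, E) ∞ ι U) (hX : SmoothFieldOn 𝓘(ℝ, E) 𝓘(ℝ, F) ι X U)
    (hY : ∀ i, SmoothFieldOn 𝓘(ℝ, E) 𝓘(ℝ, F) ι (Y i) U)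
    (hc : ∀ i, ContMDiffOn 𝓘(ℝ, F) 𝓘(ℝ, ℝ) ∞ (c i) U) :
    SmoothFieldOn 𝓘(ℝ, E) 𝓘(ℝ, F) ι (fun q => X q + ∑ i, c i q • Y i q) U := by
  intro q hq
  rw [contMDiffWithinAt_totalSpace]
  refine ⟨hι q hq, ?_⟩
  have h0 := (contMDiffWithinAt_totalSpace.1 (hX q hq)).2
  have h1 := fun i => (contMDiffWithinAt_totalSpace.1 (hY i q hq)).2
  have h2 := h0.add (ContMDiffWithinAt.sum (t := Finset.univ)
    fun i _ => ContMDiffWithinAt.smul (hc i q hq) (h1 i))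
  let e := trivializationAt E (TangentSpace 𝓘(ℝ, E) : M → Type _) (ι q)
  have key : ∀ x, ι x ∈ e.baseSet → (e ⟨ι x, X x + ∑ i, c i x • Y i x⟩).2 =
      (e ⟨ι x, X x⟩).2 + ∑ i, c i x • (e ⟨ι x, Y i x⟩).2 := by
    intro x hx
    have h3 : ∀ v, (e ⟨ι x, v⟩).2 = e.continuousLinearMapAt ℝ (ι x) v := fun v =>
      (congrFun (e.coe_linearMapAt_of_mem (R := ℝ) hx) v).symm
    simp only [h3, map_add, map_sum, map_smul]
  have hmem : ι q ∈ e.baseSet := mem_baseSet_trivializationAt _ _ _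
  refine h2.congr_of_eventuallyEq ?_ (key q hmem)
  filter_upwards [(hι q hq).continuousWithinAt.preimage_mem_nhdsWithin
    (e.open_baseSet.mem_nhds hmem)] with x hx using key x hx

theorem SmoothFormOn.comp_map {α : ∀ x : M, CotangentSpace 𝓘(ℝ, E) x} {U : Set M}
    (hα : SmoothFormOn 𝓘(ℝ, E) 𝓘(ℝ, E) (fun x : M => x) α U) {ι : N → M}
    (hι : ContMDiff 𝓘(ℝ, F) 𝓘(ℝ, E) ∞ ι) :
    SmoothFormOn 𝓘(ℝ, E) 𝓘(ℝ, F) ι (fun q => α (ι q)) (ι ⁻¹' U) :=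
  ContMDiffOn.comp hα hι.contMDiffOn fun _ hq => hq

theorem SmoothFieldOn.comp_map {X : ∀ x : M, TangentSpace 𝓘(ℝ, E) x} {U : Set M}
    (hX : SmoothFieldOn 𝓘(ℝ, E) 𝓘(ℝ, E) (fun x : M => x) X U) {ι : N → M}
    (hι : ContMDiff 𝓘(ℝ, F) 𝓘(ℝ, E) ∞ ι) :
    SmoothFieldOn 𝓘(ℝ, E) 𝓘(ℝ, F) ι (fun q => X (ι q)) (ι ⁻¹' U) :=
  ContMDiffOn.comp hX hι.contMDiffOn fun _ hq => hq

theorem exists_smoothField_eq [FiniteDimensional ℝ E] (x : M) (v : TangentSpace 𝓘(ℝ, E) x) :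
    ∃ (U : Set M) (X : ∀ y : M, TangentSpace 𝓘(ℝ, E) y), IsOpen U ∧ x ∈ U ∧
      SmoothFieldOn 𝓘(ℝ, E) 𝓘(ℝ, E) (fun y : M => y) X U ∧ X x = v := by
  let e := trivializationAt E (TangentSpace 𝓘(ℝ, E) : M → Type _) x
  refine ⟨e.baseSet, fun y => e.symm y (e ⟨x, v⟩).2, e.open_baseSet,
    mem_baseSet_trivializationAt _ _ x, ?_, ?_⟩
  · intro y hy
    refine ContMDiffAt.contMDiffWithinAt ?_
    refine (e.contMDiffAt_section_iff hy).2 ?_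
    refine (contMDiffAt_const (c := (e ⟨x, v⟩).2)).congr_of_eventuallyEq ?_
    filter_upwards [e.open_baseSet.mem_nhds hy] with z hz
    rw [e.apply_mk_symm hz]
  · exact e.symm_apply_apply_mk (mem_baseSet_trivializationAt _ _ x) v

end Sections

/-! ### Smoothness of fundamental vector fields -/

section Fundamental

variable {A : Type*} [NormedAddCommGroup A] [NormedSpace ℝ A]
  {G : Type*} [TopologicalSpace G] [ChartedSpace A G] [Group G] [LieGroup 𝓘(ℝ, A) ∞ G]
  {E : Type*} [NormedAddCommGroup E] [NormedSpace ℝ E]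
  {M : Type*} [TopologicalSpace M] [ChartedSpace E M] [MulAction G M]
  [ContMDiffSMul 𝓘(ℝ, A) 𝓘(ℝ, E) ∞ G M] [IsManifold 𝓘(ℝ, E) ∞ M]

/-- Fundamental vector fields are smooth. -/
theorem smoothFieldOn_fundamentalField (ξ : GroupLieAlgebra 𝓘(ℝ, A) G) :
    SmoothFieldOn 𝓘(ℝ, E) 𝓘(ℝ, E) (fun x : M => x)
      (fun x => fundamentalField 𝓘(ℝ, A) G 𝓘(ℝ, E) x ξ) Set.univ := by
  have hsm : ContMDiff (𝓘(ℝ, A).prod 𝓘(ℝ, E)) 𝓘(ℝ, E) ∞ (fun z : G × M => z.1 • z.2) :=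
    contMDiff_smul
  have : IsManifold 𝓘(ℝ, A) ∞ G := inferInstance
  have s₁ : ContMDiff 𝓘(ℝ, E) (𝓘(ℝ, A).prod 𝓘(ℝ, A)) ∞
      (fun _ : M => (TotalSpace.mk' A (1 : G) ξ : TangentBundle 𝓘(ℝ, A) G)) := contMDiff_const
  have s₂ : ContMDiff 𝓘(ℝ, E) (𝓘(ℝ, E).prod 𝓘(ℝ, E)) ∞
      (fun x : M => (TotalSpace.mk' E x 0 : TangentBundle 𝓘(ℝ, E) M)) := contMDiff_zeroSection _ _
  have s₃ : ContMDiff ((𝓘(ℝ, A).prod 𝓘(ℝ, A)).prod (𝓘(ℝ, E).prod 𝓘(ℝ, E))) _ ∞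
      (equivTangentBundleProd 𝓘(ℝ, A) G 𝓘(ℝ, E) M).symm := contMDiff_equivTangentBundleProd_symm
  have s₄ := hsm.contMDiff_tangentMap (m := ∞) (by simp)
  -- The field is the tangent map of the action applied to the smooth section (ξ, 0) over (1, x).
  have s := (s₄.comp s₃).comp (s₁.prodMk s₂)
  refine (s.congr fun x => ?_).contMDiffOn
  refine (TotalSpace.ext (by simp) ?_)
  simp only [Function.comp_apply, tangentMap]
  rw [mfderiv_prod_eq_add_apply (hsm.mdifferentiableAt (by simp))]
  exact heq_of_eq (show infAct A G E x ξ = infAct A G E x ξ + smulDeriv A E (1 : G) x 0 by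
    rw [map_zero, add_zero])

end Fundamental

/-! ### Immersions and restricted actions -/

section Embedding

variable {E : Type*} [NormedAddCommGroup E] [NormedSpace ℝ E]
  {M : Type*} [TopologicalSpace M] [ChartedSpace E M] [IsManifold 𝓘(ℝ, E) ∞ M]
  {F : Type*} [NormedAddCommGroup F] [NormedSpace ℝ F]
  {N : Type*} [TopologicalSpace N] [ChartedSpace F N] [IsManifold 𝓘(ℝ, F) ∞ N] {ι : N → M}

/-- The derivative of an immersion has a left inverse. -/
theorem exists_leftInverse_of_isImmersion (hι : IsImmersion 𝓘(ℝ, F) 𝓘(ℝ, E) ∞ ι) (q : N) :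
    ∃ (d : F →L[ℝ] E) (l : E →L[ℝ] F), HasMFDerivAt 𝓘(ℝ, F) 𝓘(ℝ, E) ι q d ∧ ∀ v, l (d v) = v := by
  have h := (hι.isImmersionAt q).isImmersionAtOfComplement_complement
  set φ := h.domChart
  set ψ := h.codChart
  set e := h.equiv
  have hq : q ∈ φ.source := h.mem_domChart_source
  have hιq : ι q ∈ ψ.source := h.mem_codChart_source
  have hψ : ∀ x ∈ φ.source, ψ (ι x) = e (φ x, 0) := fun x hx => by
    have hx' : φ x ∈ (φ.extend 𝓘(ℝ, F)).target := by simpa using φ.map_source hx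
    have h1 : ψ (ι (φ.symm (φ x))) = e (φ x, 0) := h.writtenInCharts hx'
    rwa [φ.left_inv hx] at h1
  have h1 : ContMDiffAt 𝓘(ℝ, E) 𝓘(ℝ, E) ∞ ψ (ι q) :=
    contMDiffAt_of_mem_maximalAtlas h.codChart_mem_maximalAtlas hιq
  have h2 : ContMDiff 𝓘(ℝ, E) 𝓘(ℝ, F) ∞ (fun v : E => (e.symm v).1) :=
    (contDiff_fst.comp e.symm.contDiff).contMDiff
  have h3 : ContMDiffAt 𝓘(ℝ, F) 𝓘(ℝ, F) ∞ φ.symm ((e.symm (ψ (ι q))).1) := by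
    rw [hψ q hq]
    simpa using contMDiffAt_symm_of_mem_maximalAtlas h.domChart_mem_maximalAtlas
      (φ.map_source hq)
  -- Reading the first component in the codomain chart and returning through the domain chart is a
  -- smooth local left inverse of `ι`.
  have h4 := h3.comp (ι q) ((h2 _).comp (ι q) h1)
  have h5 := (h4.mdifferentiableAt (by simp)).hasMFDerivAt
  have h6 := ((hι.contMDiff q).mdifferentiableAt (by simp)).hasMFDerivAt
  refine ⟨_, _, h6, DFunLike.congr_fun (hasMFDerivAt_unique (hasMFDerivAt_comp_of_eq h5 h6 rfl)
    ((hasMFDerivAt_id q).congr_of_eventuallyEq ?_))⟩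
  filter_upwards [φ.open_source.mem_nhds hq] with x hx
  simp [hψ x hx, φ.left_inv hx]

variable {A : Type*} [NormedAddCommGroup A] [NormedSpace ℝ A]
  {G : Type*} [TopologicalSpace G] [ChartedSpace A G] [Group G]
  [MulAction G M] [ContMDiffSMul 𝓘(ℝ, A) 𝓘(ℝ, E) ∞ G M] [MulAction G N]

/-- A smooth action restricts to a smooth action on an invariant embedded submanifold. -/
theorem contMDiffSMul_of_isSmoothEmbedding (hι : IsSmoothEmbedding 𝓘(ℝ, F) 𝓘(ℝ, E) ∞ ι)
    (hG : ∀ (g : G) q, ι (g • q) = g • ι q) : ContMDiffSMul 𝓘(ℝ, A) 𝓘(ℝ, F) ∞ G N := by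
  have h1 : ContMDiff (𝓘(ℝ, A).prod 𝓘(ℝ, F)) 𝓘(ℝ, E) ∞ (ι ∘ fun z : G × N => z.1 • z.2) := by
    refine (contMDiff_fst.smul (I := 𝓘(ℝ, A)) (hι.contMDiff.comp contMDiff_snd)).congr fun z => ?_
    exact hG z.1 z.2
  refine ⟨fun z => ?_⟩
  rw [ContMDiffAt.iff_comp_isImmersionAt (hι.isImmersion.isImmersionAt _)]
  exact ⟨hι.isEmbedding.isInducing.continuousAt_iff.2 (h1 z).continuousAt, h1 z⟩

end Embedding

/-! ### The fibres of the invariant annihilator -/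

section Invariant

variable {A : Type*} [NormedAddCommGroup A] [NormedSpace ℝ A]
  {G : Type*} [TopologicalSpace G] [ChartedSpace A G] [Group G] [LieGroup 𝓘(ℝ, A) ∞ G]
  {E : Type*} [NormedAddCommGroup E] [NormedSpace ℝ E]
  {M : Type*} [TopologicalSpace M] [ChartedSpace E M] [MulAction G M]
  [ContMDiffSMul 𝓘(ℝ, A) 𝓘(ℝ, E) ∞ G M]

theorem apply_infAct_eq_zero_of_invariant {f : M → ℝ} {x : M} {a : E →L[ℝ] ℝ}
    (hf : HasMFDerivAt 𝓘(ℝ, E) 𝓘(ℝ, ℝ) f x a) (hfG : ∀ g : G, f (g • x) = f x) (ξ : A) :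
    a (infAct A G E x ξ) = 0 := by
  have h1 := hasMFDerivAt_comp_of_eq hf (hasMFDerivAt_orbitMap_one (A := A) (G := G) x)
    (one_smul G x)
  have h2 : HasMFDerivAt 𝓘(ℝ, A) 𝓘(ℝ, ℝ) (fun g : G => f (g • x)) 1 (0 : A →L[ℝ] ℝ) :=
    (hasMFDerivAt_const (f x) 1).congr_of_eventuallyEq (Filter.Eventually.of_forall hfG)
  exact DFunLike.congr_fun (hasMFDerivAt_unique h1 h2) ξ

theorem apply_smulDeriv_of_invariant {f : M → ℝ} {x : M} {g : G} {a b : E →L[ℝ] ℝ}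
    (hf : HasMFDerivAt 𝓘(ℝ, E) 𝓘(ℝ, ℝ) f x a) (hf' : HasMFDerivAt 𝓘(ℝ, E) 𝓘(ℝ, ℝ) f (g • x) b)
    (hfG : ∀ᶠ y in 𝓝 x, f (g • y) = f y) (v : E) : b (smulDeriv A E g x v) = a v := by
  have h1 := hasMFDerivAt_comp_of_eq hf' (hasMFDerivAt_smulMap (A := A) (E := E) g x) rfl
  exact DFunLike.congr_fun (hasMFDerivAt_unique h1 (hf.congr_of_eventuallyEq hfG)) v

variable (A G E) in
/-- The covectors at `p` that vanish on the orbit through `p` and are invariant under the isotropy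
group of `p`. -/
noncomputable def basicCovectors (p : M) : Submodule ℝ (E →L[ℝ] ℝ) where
  carrier := {a | (∀ v ∈ (infAct A G E p).range, a v = 0) ∧
    ∀ h ∈ MulAction.stabilizer G p, ∀ v, a (smulDeriv A E h p v) = a v}
  zero_mem' := ⟨fun _ _ => rfl, fun _ _ _ => rfl⟩
  add_mem' := fun {a b} ha hb => ⟨fun v hv => by simp [ha.1 v hv, hb.1 v hv],
    fun h hh v => by simp [ha.2 h hh v, hb.2 h hh v]⟩
  smul_mem' := fun c a ha => ⟨fun v hv => by simp [ha.1 v hv],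
    fun h hh v => by simp [ha.2 h hh v]⟩

variable [IsManifold 𝓘(ℝ, E) ∞ M]

/-- Fundamental fields are smooth sections of 𝒱 through every vertical vector, so smooth
annihilation implies pointwise annihilation. -/
theorem apply_infAct_eq_zero_of_mem_smoothAnnihilator {p : M} {a : CotangentSpace 𝓘(ℝ, E) p}
    (ha : a ∈ smoothAnnihilator 𝓘(ℝ, E) (fun y : M => verticalSpace 𝓘(ℝ, A) G 𝓘(ℝ, E) y) p)
    (ξ : A) : a (infAct A G E p ξ) = 0 := by
  obtain ⟨U, hU, hpU, α, -, hα, rfl⟩ := ha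
  exact hα Set.univ _ isOpen_univ (smoothFieldOn_fundamentalField ξ) (fun x _ => ⟨ξ, rfl⟩) p
    ⟨hpU, trivial⟩

/-- The differential of an invariant function is a section of the annihilator of the vertical
distribution. -/
theorem differential_mem_smoothAnnihilator {f : M → ℝ} {U : Set M} (hU : IsOpen U)
    (hf : ContMDiffOn 𝓘(ℝ, E) 𝓘(ℝ, ℝ) ∞ f U)
    (hfG : ∀ (g : G), ∀ x ∈ U, f (g • x) = f x) {x : M} (hx : x ∈ U) :
    differential f x ∈
      smoothAnnihilator 𝓘(ℝ, E) (fun y : M => verticalSpace 𝓘(ℝ, A) G 𝓘(ℝ, E) y) x := by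
  refine ⟨U, hU, hx, differential f, smoothFormOn_differential hU hf, ?_, rfl⟩
  intro W X _ _ hX z hz
  obtain ⟨ξ, hξ⟩ := hX z hz.2
  rw [← hξ]
  exact apply_infAct_eq_zero_of_invariant (A := A) (G := G)
    ((hf.contMDiffAt (hU.mem_nhds hz.1)).mdifferentiableAt (by simp)).hasMFDerivAt
    (fun g => hfG g z hz.1) ξ

theorem differential_mem_invariantVerticalAnnihilator {f : M → ℝ} {U : Set M} (hU : IsOpen U)
    (hUG : ∀ (g : G), ∀ x ∈ U, g • x ∈ U) (hf : ContMDiffOn 𝓘(ℝ, E) 𝓘(ℝ, ℝ) ∞ f U)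
    (hfG : ∀ (g : G), ∀ x ∈ U, f (g • x) = f x) {x : M} (hx : x ∈ U) :
    differential f x ∈ invariantVerticalAnnihilator 𝓘(ℝ, A) G 𝓘(ℝ, E) x := by
  refine ⟨U, hU, hx, hUG, differential f, smoothFormOn_differential hU hf,
    fun z hz => differential_mem_smoothAnnihilator hU hf hfG hz, fun g z hz => ?_, rfl⟩
  have hd : ∀ y ∈ U, HasMFDerivAt 𝓘(ℝ, E) 𝓘(ℝ, ℝ) f y (differential f y) := fun y hy =>
    ((hf.contMDiffAt (hU.mem_nhds hy)).mdifferentiableAt (by simp)).hasMFDerivAt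
  exact ContinuousLinearMap.ext fun v => apply_smulDeriv_of_invariant (A := A) (hd z hz)
    (hd _ (hUG g z hz)) (Filter.mem_of_superset (hU.mem_nhds hz) fun y hy => hfG g y hy) v

/-- Invariant forms impose only the evident pointwise conditions on their values, because
differentials of invariant functions already realize every basic covector. This reduces the fibres
to linear algebra of the isotropy representation. -/
theorem mem_invariantVerticalAnnihilator_iff [FiniteDimensional ℝ A] [FiniteDimensional ℝ E]
    [ProperSMul G M] {p : M} {a : E →L[ℝ] ℝ} :
    (show CotangentSpace 𝓘(ℝ, E) p from a) ∈ invariantVerticalAnnihilator 𝓘(ℝ, A) G 𝓘(ℝ, E) p ↔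
      a ∈ basicCovectors A G E p := by
  constructor
  · rintro ⟨U, hU, hpU, hUG, α, hα, hαV, hαG, h⟩
    replace h : α p = a := h
    subst h
    refine ⟨?_, fun h hh v => ?_⟩
    · rintro _ ⟨ξ, rfl⟩
      exact apply_infAct_eq_zero_of_mem_smoothAnnihilator (hαV p hpU) ξ
    · have h1 : (α (h • p) : E →L[ℝ] ℝ) (smulDeriv A E h p v) = (α p : E →L[ℝ] ℝ) v :=
        DFunLike.congr_fun (hαG h p hpU) v
      have h2 : ∀ x, x = p → (α x : E →L[ℝ] ℝ) = (α p : E →L[ℝ] ℝ) := by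
        rintro x rfl
        rfl
      rwa [h2 _ hh] at h1
  · rintro ⟨haV, haH⟩
    obtain ⟨U, f, hU, hpU, hUG, hf, hfG, hfa⟩ := exists_invariant_function A E haV haH
    have h1 := differential_mem_invariantVerticalAnnihilator (A := A) hU hUG hf hfG hpU
    rwa [show differential f p = a from hfa.mfderiv] at h1

end Invariant

/-! ### Dual vectors, smooth matrices and dual fields -/

section LinearAlgebra

/-- Linearly independent functionals on a finite-dimensional space have dual vectors. -/
theorem exists_dual_vectors {E : Type*} [AddCommGroup E] [Module ℝ E] {r : ℕ}
    {a : Fin r → E →ₗ[ℝ] ℝ} (ha : LinearIndependent ℝ a) :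
    ∃ v : Fin r → E, ∀ i j, a i (v j) = if i = j then 1 else 0 := by
  have hsurj : LinearMap.range (LinearMap.pi a) = ⊤ := by
    by_contra h
    obtain ⟨c, hc, hle⟩ := Submodule.exists_le_ker_of_lt_top _ (lt_top_iff_ne_top.2 h)
    have h1 : ∑ i, c (Pi.single i 1) • a i = 0 := by
      ext x
      have h2 : c (LinearMap.pi a x) = 0 := hle ⟨x, rfl⟩
      rw [← LinearMap.sum_single_apply (fun _ => ℝ) (LinearMap.pi a x), map_sum] at h2
      rw [LinearMap.sum_apply, LinearMap.zero_apply, ← h2]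
      refine Finset.sum_congr rfl fun i _ => ?_
      rw [LinearMap.smul_apply, smul_eq_mul, mul_comm, ← smul_eq_mul, ← map_smul, ← Pi.single_smul,
        smul_eq_mul, mul_one]
      rfl
    refine hc (LinearMap.pi_ext' fun i => LinearMap.ext_ring ?_)
    exact Fintype.linearIndependent_iff.1 ha _ h1 i
  choose v hv using fun j => LinearMap.range_eq_top.1 hsurj (Pi.single j (1 : ℝ))
  refine ⟨v, fun i j => ?_⟩
  have := congrFun (hv j) i
  simpa [Pi.single_apply] using this

end LinearAlgebra

section SmoothMatrix

variable {F : Type*} [NormedAddCommGroup F] [NormedSpace ℝ F]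
  {N : Type*} [TopologicalSpace N] [ChartedSpace F N]

theorem contMDiffOn_det {r : ℕ} {B : N → Matrix (Fin r) (Fin r) ℝ} {U : Set N}
    (hB : ∀ i j, ContMDiffOn 𝓘(ℝ, F) 𝓘(ℝ, ℝ) ∞ (fun x => B x i j) U) :
    ContMDiffOn 𝓘(ℝ, F) 𝓘(ℝ, ℝ) ∞ (fun x => (B x).det) U := by
  simp only [Matrix.det_apply']
  intro x hx
  refine ContMDiffWithinAt.sum fun σ _ => ContMDiffWithinAt.mul contMDiffWithinAt_const ?_
  exact ContMDiffWithinAt.prod fun i _ => hB _ _ x hx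

theorem contMDiffOn_matrix_inv {r : ℕ} {B : N → Matrix (Fin r) (Fin r) ℝ} {U : Set N}
    (hB : ∀ i j, ContMDiffOn 𝓘(ℝ, F) 𝓘(ℝ, ℝ) ∞ (fun x => B x i j) U)
    (hdet : ∀ x ∈ U, (B x).det ≠ 0) (i j : Fin r) :
    ContMDiffOn 𝓘(ℝ, F) 𝓘(ℝ, ℝ) ∞ (fun x => (B x)⁻¹ i j) U := by
  have h1 : ContMDiffOn 𝓘(ℝ, F) 𝓘(ℝ, ℝ) ∞ (fun x => (B x).adjugate i j) U := by
    simp only [Matrix.adjugate_apply]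
    refine contMDiffOn_det fun k l => ?_
    simp only [Matrix.updateRow_apply]
    split_ifs
    · exact contMDiffOn_const
    · exact hB k l
  refine ((contMDiffOn_det hB).inv₀ hdet |>.mul h1).congr fun x hx => ?_
  simp [Matrix.inv_def]

end SmoothMatrix

section DualFields

variable {E : Type*} [NormedAddCommGroup E] [NormedSpace ℝ E] [FiniteDimensional ℝ E]
  {M : Type*} [TopologicalSpace M] [ChartedSpace E M] [IsManifold 𝓘(ℝ, E) ∞ M]
  {F : Type*} [NormedAddCommGroup F] [NormedSpace ℝ F]
  {N : Type*} [TopologicalSpace N] [ChartedSpace F N]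

/-- One-forms along a map that are linearly independent at a point have dual vector fields near
that point. -/
theorem exists_dual_fields {ι : N → M} (hι : ContMDiff 𝓘(ℝ, F) 𝓘(ℝ, E) ∞ ι) {r : ℕ}
    {σ : Fin r → ∀ q, CotangentSpace 𝓘(ℝ, E) (ι q)} {U : Set N} (hU : IsOpen U)
    (hσ : ∀ i, SmoothFormOn 𝓘(ℝ, E) 𝓘(ℝ, F) ι (σ i) U) {q : N} (hq : q ∈ U)
    (hli : LinearIndependent ℝ fun i => σ i q) :
    ∃ (W : Set N) (Z : Fin r → ∀ q, TangentSpace 𝓘(ℝ, E) (ι q)), IsOpen W ∧ q ∈ W ∧ W ⊆ U ∧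
      (∀ i, SmoothFieldOn 𝓘(ℝ, E) 𝓘(ℝ, F) ι (Z i) W) ∧
      ∀ x ∈ W, ∀ i j, σ i x (Z j x) = if i = j then (1 : ℝ) else 0 := by
  let s : Fin r → E →L[ℝ] ℝ := fun i => σ i q
  have hs : LinearIndependent ℝ s := hli
  have hli' : LinearIndependent ℝ fun i => (s i : E →ₗ[ℝ] ℝ) :=
    hs.map' (ContinuousLinearMap.coeLM ℝ) (LinearMap.ker_eq_bot.2
      ContinuousLinearMap.coe_injective)
  obtain ⟨v, hv⟩ := exists_dual_vectors hli'
  choose V Y hV hqV hY hYv using fun j => exists_smoothField_eq (M := M) (ι q) (v j)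
  let U₁ : Set N := U ∩ ⋂ j, ι ⁻¹' V j
  have hU₁ : IsOpen U₁ := hU.inter (isOpen_iInter_of_finite fun j =>
    (hV j).preimage hι.continuous)
  have hY' : ∀ j, SmoothFieldOn 𝓘(ℝ, E) 𝓘(ℝ, F) ι (fun x => Y j (ι x)) U₁ := fun j =>
    ((hY j).comp_map hι).mono fun x hx => Set.mem_iInter.1 hx.2 j
  -- `B` is the identity at `q` and stays invertible nearby; its inverse corrects the fields `Y` to
  -- be dual to `σ` at every point.
  let B : N → Matrix (Fin r) (Fin r) ℝ := fun x => Matrix.of fun i j => σ i x (Y j (ι x))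
  have hB : ∀ i j, ContMDiffOn 𝓘(ℝ, F) 𝓘(ℝ, ℝ) ∞ (fun x => B x i j) U₁ := fun i j =>
    contMDiffOn_form_apply ((hσ i).mono Set.inter_subset_left) (hY' j)
  have hBq : B q = 1 := by
    ext i j
    rw [Matrix.one_apply, ← hv i j]
    change s i (Y j (ι q)) = s i (v j)
    rw [hYv]
  have hdet := contMDiffOn_det hB
  let W : Set N := U₁ ∩ (fun x => (B x).det) ⁻¹' {0}ᶜ
  have hW : IsOpen W := hdet.continuousOn.isOpen_inter_preimage hU₁ isOpen_compl_singleton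
  have hWU₁ : W ⊆ U₁ := Set.inter_subset_left
  have hι' := hι.contMDiffOn (s := W)
  refine ⟨W, fun k x => 0 + ∑ j, (B x)⁻¹ j k • Y j (ι x), hW, ⟨⟨hq, Set.mem_iInter.2 hqV⟩, ?_⟩,
    fun x hx => hx.1.1, fun k => ?_, ?_⟩
  · simp [hBq]
  · refine smoothFieldOn_add_sum_smul hι' ?_ (fun j => (hY' j).mono hWU₁)
      (fun j => contMDiffOn_matrix_inv (fun i j => (hB i j).mono hWU₁) (fun x hx => hx.2) j k)
    exact ((contMDiff_zeroSection ℝ (fun m : M => TangentSpace 𝓘(ℝ, E) m)).comp hι).contMDiffOn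
  · intro x hx i k
    have h1 : (B x * (B x)⁻¹) i k = (1 : Matrix (Fin r) (Fin r) ℝ) i k := by
      rw [Matrix.mul_nonsing_inv _ (isUnit_iff_ne_zero.2 hx.2)]
    rw [Matrix.one_apply, Matrix.mul_apply] at h1
    rw [← h1]
    dsimp only
    rw [zero_add]
    refine (map_sum (σ i x) _ _).trans (Finset.sum_congr rfl fun j _ => ?_)
    refine (map_smul (σ i x) _ _).trans ?_
    exact mul_comm _ _

end DualFields

theorem exists_linearIndependent_of_finrank_eq {V : Type*} [AddCommGroup V] [Module ℝ V]
    [FiniteDimensional ℝ V] (S : Submodule ℝ V) {r : ℕ} (hr : Module.finrank ℝ S = r) :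
    ∃ a : Fin r → V, (∀ i, a i ∈ S) ∧ LinearIndependent ℝ a := by
  have h : LinearIndependent ℝ (S.subtype ∘ Module.finBasisOfFinrankEq ℝ S hr) :=
    (Module.finBasisOfFinrankEq ℝ S hr).linearIndependent.map' _ (Submodule.ker_subtype _)
  exact ⟨_, fun i => (Module.finBasisOfFinrankEq ℝ S hr i).2, h⟩

/-! ### Basic covectors and the tangent space of the stratum -/

section Covectors

universe u

variable {A : Type*} [NormedAddCommGroup A] [NormedSpace ℝ A] [FiniteDimensional ℝ A]
  {G : Type*} [TopologicalSpace G] [ChartedSpace A G] [Group G] [LieGroup 𝓘(ℝ, A) ∞ G]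
  {E : Type u} [NormedAddCommGroup E] [NormedSpace ℝ E] [FiniteDimensional ℝ E]
  {M : Type*} [TopologicalSpace M] [ChartedSpace E M] [MulAction G M]
  [ContMDiffSMul 𝓘(ℝ, A) 𝓘(ℝ, E) ∞ G M] [IsManifold 𝓘(ℝ, E) ∞ M] [ProperSMul G M]

variable (A) in
-- Take b ∘ avg: on `fixedModVertical` averaging changes a vector only by a vertical one, which `b`
-- kills.
theorem exists_basicCovector_eqOn {p : M} {b : E →L[ℝ] ℝ}
    (hb : ∀ v ∈ (infAct A G E p).range, b v = 0) :
    ∃ a ∈ basicCovectors A G E p, ∀ v ∈ fixedModVertical A G E p, a v = b v := by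
  obtain ⟨avg, -, h2, h3⟩ := exists_average_stabilizer (A := A) (E := E)
    (isCompact_stabilizer (G := G) p)
  refine ⟨b.comp avg, ⟨fun v hv => ?_, fun h hh v => ?_⟩, fun v hv => ?_⟩
  · have h4 := h3 _ v fun h hh => range_infAct_le_fixedModVertical p hv h hh
    exact hb _ (by simpa using Submodule.add_mem _ h4 hv)
  · simp [h2 h hh v]
  · have h4 := hb _ (h3 _ v hv)
    rwa [map_sub, sub_eq_zero] at h4

/-- An invariant covector satisfies a v = a (avg v), and averages are fixed by the isotropy group.
-/
theorem eq_zero_of_mem_basicCovectors {p : M} {a : E →L[ℝ] ℝ} (ha : a ∈ basicCovectors A G E p)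
    (h : ∀ v ∈ fixedModVertical A G E p, a v = 0) : a = 0 := by
  obtain ⟨avg, h1, -, h3⟩ := exists_average_stabilizer (A := A) (E := E)
    (isCompact_stabilizer (G := G) p)
  ext v
  have h4 : avg v - v ∈ a.ker := h3 _ v fun k hk => by
    rw [LinearMap.mem_ker]
    exact (map_sub a _ _).trans (by rw [ha.2 k hk, sub_self])
  have h5 : a (avg v) - a v = 0 := (map_sub a _ _).symm.trans h4
  rw [h (avg v) fun k hk => by rw [h1 k hk, sub_self]; exact Submodule.zero_mem _] at h5
  simpa using h5

variable (A G E) in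
-- By the two preceding lemmas, restriction identifies the basic covectors with the annihilator of V
-- in the dual of T.
theorem finrank_basicCovectors_add (p : M) :
    Module.finrank ℝ (infAct A G E p).range + Module.finrank ℝ (basicCovectors A G E p) =
      Module.finrank ℝ (fixedModVertical A G E p) := by
  let T := fixedModVertical A G E p
  let V : Submodule ℝ T := (infAct A G E p).range.comap T.subtype
  let L : (E →L[ℝ] ℝ) →ₗ[ℝ] Module.Dual ℝ T :=
    (Module.Dual.transpose T.subtype).comp (ContinuousLinearMap.coeLM ℝ)
  have hL : ∀ a v, L a v = a v := fun a v => rfl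
  have h1 : LinearMap.range (L.domRestrict (basicCovectors A G E p)) = V.dualAnnihilator := by
    refine le_antisymm ?_ fun b hb => ?_
    · rintro _ ⟨⟨a, ha⟩, rfl⟩
      rw [Submodule.mem_dualAnnihilator]
      exact fun v hv => ha.1 v hv
    · obtain ⟨b', hb'⟩ := LinearMap.exists_extend b
      obtain ⟨a, ha, hab⟩ := exists_basicCovector_eqOn A (G := G) (p := p)
        (b := LinearMap.toContinuousLinearMap b') fun v hv => by
          have := (Submodule.mem_dualAnnihilator _).1 hb
            ⟨v, range_infAct_le_fixedModVertical p hv⟩ hv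
          rw [← hb'] at this
          exact this
      refine ⟨⟨a, ha⟩, LinearMap.ext fun v => ?_⟩
      change a v = b v
      rw [hab v v.2, ← hb']
      rfl
  have h2 : Function.Injective (L.domRestrict (basicCovectors A G E p)) := by
    rw [injective_iff_map_eq_zero]
    rintro ⟨a, ha⟩ h
    exact Subtype.ext (eq_zero_of_mem_basicCovectors ha fun v hv =>
      DFunLike.congr_fun h (⟨v, hv⟩ : T))
  have h3 := LinearMap.finrank_range_of_inj h2
  have h4 : Module.finrank ℝ V = Module.finrank ℝ (infAct A G E p).range :=
    (Submodule.comapSubtypeEquivOfLe (range_infAct_le_fixedModVertical p)).finrank_eq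
  rw [← h3, h1, ← h4]
  exact Subspace.finrank_add_finrank_dualAnnihilator_eq V

variable (A E) in
-- The rank is dim T - dim V: conjugate isotropy groups fix the second term, and slice charts with
-- connectedness the first.
theorem finrank_basicCovectors_eq_of_mem_component {K : Subgroup G} {p q m₀ : M}
    (hp : p ∈ connectedComponentIn (orbitTypeSet M K) m₀)
    (hq : q ∈ connectedComponentIn (orbitTypeSet M K) m₀) :
    Module.finrank ℝ (basicCovectors A G E p) = Module.finrank ℝ (basicCovectors A G E q) := by
  obtain ⟨a, ha⟩ := connectedComponentIn_subset _ _ hp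
  obtain ⟨b, hb⟩ := connectedComponentIn_subset _ _ hq
  have h1 := finrank_range_infAct_eq_of_conj A E (p := p) (q := q) (k := b * a⁻¹) (by
    rw [hb, ha, Subgroup.map_map]
    congr 1
    ext x
    simp [mul_assoc])
  have h2 := finrank_fixedModVertical_eq_of_mem_component A E hp hq
  have h3 := finrank_basicCovectors_add A G E p
  have h4 := finrank_basicCovectors_add A G E q
  omega

variable (A G E) in
/-- Invariant functions whose differentials form a basis of the invariant covectors at a point. -/
theorem exists_invariant_functions (p : M) {r : ℕ}
    (hr : Module.finrank ℝ (basicCovectors A G E p) = r) :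
    ∃ (W : Set M) (f : Fin r → M → ℝ), IsOpen W ∧ p ∈ W ∧ (∀ (g : G), ∀ x ∈ W, g • x ∈ W) ∧
      (∀ i, ContMDiffOn 𝓘(ℝ, E) 𝓘(ℝ, ℝ) ∞ (f i) W) ∧
      (∀ i (g : G), ∀ x ∈ W, f i (g • x) = f i x) ∧
      LinearIndependent ℝ fun i => (differential (f i) p : CotangentSpace 𝓘(ℝ, E) p) := by
  obtain ⟨b, hb, h1⟩ := exists_linearIndependent_of_finrank_eq (basicCovectors A G E p) hr
  choose U f hU hpU hUG hf hfG hfa using fun i =>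
    exists_invariant_function A E (hb i).1 (hb i).2
  refine ⟨⋂ i, U i, f, isOpen_iInter_of_finite hU, Set.mem_iInter.2 hpU, fun g x hx =>
    Set.mem_iInter.2 fun i => hUG i g x (Set.mem_iInter.1 hx i), fun i =>
    (hf i).mono (Set.iInter_subset _ i), fun i g x hx => hfG i g x (Set.mem_iInter.1 hx i), ?_⟩
  have h2 : (fun i => (differential (f i) p : E →L[ℝ] ℝ)) = b :=
    funext fun i => (hfa i).mfderiv
  have h3 : LinearIndependent ℝ fun i => (differential (f i) p : E →L[ℝ] ℝ) := h2 ▸ h1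
  exact h3

end Covectors

/-! ### Tangent spaces of a stratum and pullback of covectors -/

section Stratum

universe u

variable {A : Type*} [NormedAddCommGroup A] [NormedSpace ℝ A] [FiniteDimensional ℝ A]
  {G : Type*} [TopologicalSpace G] [ChartedSpace A G] [Group G] [LieGroup 𝓘(ℝ, A) ∞ G]
  {E : Type u} [NormedAddCommGroup E] [NormedSpace ℝ E] [FiniteDimensional ℝ E]
  {M : Type*} [TopologicalSpace M] [ChartedSpace E M] [MulAction G M]
  [ContMDiffSMul 𝓘(ℝ, A) 𝓘(ℝ, E) ∞ G M] [IsManifold 𝓘(ℝ, E) ∞ M] [ProperSMul G M]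
  {F : Type*} [NormedAddCommGroup F] [NormedSpace ℝ F]
  {N : Type*} [TopologicalSpace N] [ChartedSpace F N] [IsManifold 𝓘(ℝ, F) ∞ N] {ι : N → M}

variable (A) in
/-- The tangent space of a stratum. -/
theorem range_eq_fixedModVertical_of_hasMFDerivAt {K : Subgroup G} {m₀ : M}
    (hι : IsSmoothEmbedding 𝓘(ℝ, F) 𝓘(ℝ, E) ∞ ι)
    (hrange : Set.range ι = connectedComponentIn (orbitTypeSet M K) m₀) {q : N} {d : F →L[ℝ] E}
    (hd : HasMFDerivAt 𝓘(ℝ, F) 𝓘(ℝ, E) ι q d) :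
    d.range = fixedModVertical A G E (ι q) := by
  have hq : ι q ∈ connectedComponentIn (orbitTypeSet M K) m₀ := hrange ▸ ⟨q, rfl⟩
  obtain ⟨Ψ, S, y, hΨ, hmem⟩ := exists_isSliceChart_component A (G := G) E hq
  refine le_antisymm ?_ fun v hv => ?_
  · rintro _ ⟨w, rfl⟩
    refine mem_of_hasMFDerivAt_of_eventually_mem (f := Ψ ∘ ι)
      (hasMFDerivAt_comp_of_eq hΨ.hasMFDerivAt hd rfl) ?_ w
    filter_upwards [hd.continuousAt.preimage_mem_nhds (Ψ.open_source.mem_nhds hΨ.mem_source)]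
      with x hx
    exact (hmem _ hx).1 (hrange ▸ ⟨x, rfl⟩)
  · obtain ⟨D, hD, hD'⟩ := OpenPartialHomeomorph.exists_hasMFDerivAt_equiv hΨ.contMDiffOn
      hΨ.contMDiffOn_symm hΨ.mem_source
    have hDid : (D : E →L[ℝ] E) = ContinuousLinearMap.id ℝ E :=
      hasMFDerivAt_unique hD hΨ.hasMFDerivAt
    have hDv : D.symm v = v := by
      rw [D.symm_apply_eq]
      exact (DFunLike.congr_fun hDid v).symm
    have h0 : (0 : E) ∈ Ψ.target := hΨ.map_self ▸ Ψ.map_source hΨ.mem_source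
    have hev : ∀ᶠ t : ℝ in 𝓝 0, t • v ∈ Ψ.target :=
      (show ContinuousAt (fun t : ℝ => t • v) 0 by fun_prop).eventually_mem
        (Ψ.open_target.mem_nhds (by simpa using h0))
    have hlift : ∀ t : ℝ, t • v ∈ Ψ.target → ∃ x, ι x = Ψ.symm (t • v) := fun t ht => by
      have := (hmem _ (Ψ.map_target ht)).2 (by
        rw [Ψ.right_inv ht]
        exact Submodule.smul_mem _ _ hv)
      rwa [← hrange] at this
    have : Nonempty N := ⟨q⟩
    -- A line in the slice chart inside `fixedModVertical` lies in the stratum and lifts to `N`. The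
    -- lift is continuous because `ι` is an embedding, and smooth because `ι` is an immersion.
    let c : ℝ → N := fun t => Function.invFun ι (Ψ.symm (t • v))
    have hc : ∀ t : ℝ, t • v ∈ Ψ.target → ι (c t) = Ψ.symm (t • v) := fun t ht =>
      Function.invFun_eq (hlift t ht)
    have hΨ0 : Ψ.symm 0 = ι q := by rw [← hΨ.map_self, Ψ.left_inv hΨ.mem_source]
    have hc0 : c 0 = q := hι.isEmbedding.injective (by
      rw [hc 0 (by simpa using h0), zero_smul, hΨ0])
    have h1 : ContMDiffAt 𝓘(ℝ, ℝ) 𝓘(ℝ, E) ∞ (ι ∘ c) 0 := by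
      have h2 : ContMDiffAt 𝓘(ℝ, E) 𝓘(ℝ, E) ∞ Ψ.symm ((0 : ℝ) • v) :=
        hΨ.contMDiffOn_symm.contMDiffAt (Ψ.open_target.mem_nhds (by simpa using h0))
      have h3 : ContMDiff 𝓘(ℝ, ℝ) 𝓘(ℝ, E) ∞ (fun t : ℝ => t • v) :=
        (contDiff_id.smul contDiff_const).contMDiff
      exact (h2.comp (0 : ℝ) (h3 0)).congr_of_eventuallyEq (hev.mono hc)
    have h2 : ContMDiffAt 𝓘(ℝ, ℝ) 𝓘(ℝ, F) ∞ c 0 := by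
      rw [ContMDiffAt.iff_comp_isImmersionAt (hι.isImmersion.isImmersionAt _)]
      exact ⟨hι.isEmbedding.isInducing.continuousAt_iff.2 h1.continuousAt, h1⟩
    have h3 := hasMFDerivAt_comp_of_eq hd (h2.mdifferentiableAt (by simp)).hasMFDerivAt hc0
    have h4 : HasFDerivAt (fun t : ℝ => t • v) ((ContinuousLinearMap.id ℝ ℝ).smulRight v) 0 :=
      ((ContinuousLinearMap.id ℝ ℝ).smulRight v).hasFDerivAt
    have h5 := hasMFDerivAt_comp_of_eq hD' h4.hasMFDerivAt (by simp [hΨ.map_self])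
    have h6 := hasMFDerivAt_unique h3 (h5.congr_of_eventuallyEq (hev.mono hc))
    set c' : ℝ →L[ℝ] F := mfderiv 𝓘(ℝ, ℝ) 𝓘(ℝ, F) c 0
    have h7 : d (c' 1) = D.symm ((1 : ℝ) • v) := DFunLike.congr_fun h6 (1 : ℝ)
    rw [one_smul, hDv] at h7
    exact ⟨c' 1, h7⟩

variable [MulAction G N] [ContMDiffSMul 𝓘(ℝ, A) 𝓘(ℝ, F) ∞ G N]

theorem apply_infAct_of_equivariant (hG : ∀ (g : G) q, ι (g • q) = g • ι q) {q : N} {d : F →L[ℝ] E}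
    (hd : HasMFDerivAt 𝓘(ℝ, F) 𝓘(ℝ, E) ι q d) (ξ : A) :
    d (infAct A G F q ξ) = infAct A G E (ι q) ξ := by
  have h1 := hasMFDerivAt_comp_of_eq hd (hasMFDerivAt_orbitMap_one (A := A) (G := G) q)
    (one_smul G q)
  have h2 : (fun g : G => ι (g • q)) = fun g => g • ι q := funext fun g => hG g q
  have h3 : HasMFDerivAt 𝓘(ℝ, A) 𝓘(ℝ, E) (fun g : G => ι (g • q)) 1 (infAct A G E (ι q)) := by
    rw [h2]
    exact hasMFDerivAt_orbitMap_one _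
  exact DFunLike.congr_fun (hasMFDerivAt_unique h1 h3) ξ

/-- The pullback to a stratum of the differential of a function. -/
theorem pullbackCovector_differential {f : M → ℝ} {q : N}
    (hι : MDifferentiableAt 𝓘(ℝ, F) 𝓘(ℝ, E) ι q)
    (hf : MDifferentiableAt 𝓘(ℝ, E) 𝓘(ℝ, ℝ) f (ι q)) :
    pullbackCovector 𝓘(ℝ, E) 𝓘(ℝ, F) ι q (differential f (ι q)) = differential (f ∘ ι) q :=
  (mfderiv_comp q hf hι).symm

theorem pullbackCovector_apply_of_hasMFDerivAt {q : N} {d : F →L[ℝ] E}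
    (hd : HasMFDerivAt 𝓘(ℝ, F) 𝓘(ℝ, E) ι q d) (a : CotangentSpace 𝓘(ℝ, E) (ι q)) (v : F) :
    pullbackCovector 𝓘(ℝ, E) 𝓘(ℝ, F) ι q a v = a (d v) := by
  have h : mfderiv 𝓘(ℝ, F) 𝓘(ℝ, E) ι q = d := hd.mfderiv
  change a (mfderiv 𝓘(ℝ, F) 𝓘(ℝ, E) ι q v) = _
  rw [h]
  rfl

/-- Pullback maps the invariant annihilator onto the annihilator of the vertical distribution of
the stratum. -/
theorem map_invariantVerticalAnnihilator {K : Subgroup G} {m₀ : M}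
    (hι : IsSmoothEmbedding 𝓘(ℝ, F) 𝓘(ℝ, E) ∞ ι)
    (hrange : Set.range ι = connectedComponentIn (orbitTypeSet M K) m₀)
    (hG : ∀ (g : G) q, ι (g • q) = g • ι q) (q : N) :
    (invariantVerticalAnnihilator 𝓘(ℝ, A) G 𝓘(ℝ, E) (ι q)).map
        (pullbackCovector 𝓘(ℝ, E) 𝓘(ℝ, F) ι q) =
      smoothAnnihilator 𝓘(ℝ, F) (fun x : N => verticalSpace 𝓘(ℝ, A) G 𝓘(ℝ, F) x) q := by
  obtain ⟨d, l, hd, hl⟩ := exists_leftInverse_of_isImmersion hι.isImmersion q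
  have hT := range_eq_fixedModVertical_of_hasMFDerivAt A hι hrange hd
  have key : ∀ a ∈ basicCovectors A G E (ι q),
      pullbackCovector 𝓘(ℝ, E) 𝓘(ℝ, F) ι q (show CotangentSpace 𝓘(ℝ, E) (ι q) from a) ∈
        smoothAnnihilator 𝓘(ℝ, F) (fun x : N => verticalSpace 𝓘(ℝ, A) G 𝓘(ℝ, F) x) q := by
    rintro a ⟨haV, haH⟩
    obtain ⟨U, f, hU, hpU, hUG, hf, hfG, hfa⟩ := exists_invariant_function A E haV haH
    have h1 : (show CotangentSpace 𝓘(ℝ, E) (ι q) from a) = differential f (ι q) :=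
      hfa.mfderiv.symm
    rw [h1, pullbackCovector_differential hd.mdifferentiableAt hfa.mdifferentiableAt]
    refine differential_mem_smoothAnnihilator (U := ι ⁻¹' U)
      (hU.preimage hι.isEmbedding.continuous)
      (hf.comp hι.contMDiff.contMDiffOn fun _ hx => hx) (fun g x hx => ?_) hpU
    simp only [Function.comp_apply, hG]
    exact hfG g _ hx
  refine le_antisymm ?_ fun b hb => ?_
  · rintro _ ⟨a, ha, rfl⟩
    exact key a (mem_invariantVerticalAnnihilator_iff.1 ha)
  · let b' : F →L[ℝ] ℝ := b
    -- `b' ∘ l` extends `b` from the stratum to the ambient tangent space and, by equivariance of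
    -- `ι`, kills vertical vectors; averaging then makes it basic without changing it on the image
    -- of `d`.
    have hbV : ∀ v ∈ (infAct A G E (ι q)).range, (b'.comp l) v = 0 := by
      rintro _ ⟨ξ, rfl⟩
      change b' (l (infAct A G E (ι q) ξ)) = 0
      rw [← apply_infAct_of_equivariant hG hd, hl]
      exact apply_infAct_eq_zero_of_mem_smoothAnnihilator hb ξ
    obtain ⟨a, ha, hab⟩ := exists_basicCovector_eqOn A hbV
    refine ⟨a, mem_invariantVerticalAnnihilator_iff.2 ha, ContinuousLinearMap.ext fun v => ?_⟩
    refine (pullbackCovector_apply_of_hasMFDerivAt hd _ v).trans ?_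
    refine (hab (d v) (hT ▸ ⟨v, rfl⟩)).trans ?_
    exact congrArg b' (hl v)

variable (A) in
theorem injOn_pullbackCovector {K : Subgroup G} {m₀ : M}
    (hι : IsSmoothEmbedding 𝓘(ℝ, F) 𝓘(ℝ, E) ∞ ι)
    (hrange : Set.range ι = connectedComponentIn (orbitTypeSet M K) m₀) (q : N) :
    Set.InjOn (pullbackCovector 𝓘(ℝ, E) 𝓘(ℝ, F) ι q)
      (invariantVerticalAnnihilator 𝓘(ℝ, A) G 𝓘(ℝ, E) (ι q)) := by
  obtain ⟨d, l, hd, hl⟩ := exists_leftInverse_of_isImmersion hι.isImmersion q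
  have hT := range_eq_fixedModVertical_of_hasMFDerivAt A hι hrange hd
  intro a ha b hb hab
  rw [← sub_eq_zero] at hab ⊢
  rw [← map_sub] at hab
  refine eq_zero_of_mem_basicCovectors (A := A) (G := G) (E := E) (p := ι q)
    (mem_invariantVerticalAnnihilator_iff.1 (Submodule.sub_mem _ ha hb)) ?_
  rw [← hT]
  rintro _ ⟨v, rfl⟩
  exact (pullbackCovector_apply_of_hasMFDerivAt hd (a - b) v).symm.trans
    (DFunLike.congr_fun hab v)

end Stratum

/-! ### Local frames and the bundle isomorphism -/

section Stratum

universe u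

variable {A : Type*} [NormedAddCommGroup A] [NormedSpace ℝ A] [FiniteDimensional ℝ A]
  {G : Type*} [TopologicalSpace G] [ChartedSpace A G] [Group G] [LieGroup 𝓘(ℝ, A) ∞ G]
  {E : Type u} [NormedAddCommGroup E] [NormedSpace ℝ E] [FiniteDimensional ℝ E]
  {M : Type*} [TopologicalSpace M] [ChartedSpace E M] [MulAction G M]
  [ContMDiffSMul 𝓘(ℝ, A) 𝓘(ℝ, E) ∞ G M] [IsManifold 𝓘(ℝ, E) ∞ M] [ProperSMul G M]
  {F : Type*} [NormedAddCommGroup F] [NormedSpace ℝ F]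
  {N : Type*} [TopologicalSpace N] [ChartedSpace F N] {ι : N → M}

variable (A) in
/-- A local frame, with dual vector fields, of the invariant annihilator along a map into a set on
which its rank is constant. -/
theorem exists_invariant_frame (hι : ContMDiff 𝓘(ℝ, F) 𝓘(ℝ, E) ∞ ι) {r : ℕ}
    (hr : ∀ q, Module.finrank ℝ (basicCovectors A G E (ι q)) = r) (q : N) :
    ∃ (W : Set M) (f : Fin r → M → ℝ) (U : Set N)
      (Z : Fin r → ∀ q, TangentSpace 𝓘(ℝ, E) (ι q)), IsOpen W ∧
      (∀ (g : G), ∀ x ∈ W, g • x ∈ W) ∧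
      (∀ i, ContMDiffOn 𝓘(ℝ, E) 𝓘(ℝ, ℝ) ∞ (f i) W) ∧
      (∀ i (g : G), ∀ x ∈ W, f i (g • x) = f i x) ∧
      IsOpen U ∧ q ∈ U ∧ U ⊆ ι ⁻¹' W ∧
      (∀ i, SmoothFieldOn 𝓘(ℝ, E) 𝓘(ℝ, F) ι (Z i) U) ∧
      (∀ x ∈ U, ∀ i j, differential (f i) (ι x) (Z j x) = if i = j then (1 : ℝ) else 0) ∧
      ∀ x ∈ U, (LinearIndependent ℝ fun i =>
          (differential (f i) (ι x) : CotangentSpace 𝓘(ℝ, E) (ι x))) ∧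
        Submodule.span ℝ (Set.range fun i =>
          (differential (f i) (ι x) : CotangentSpace 𝓘(ℝ, E) (ι x))) =
          invariantVerticalAnnihilator 𝓘(ℝ, A) G 𝓘(ℝ, E) (ι x) := by
  obtain ⟨W, f, hW, hqW, hWG, hf, hfG, hli⟩ := exists_invariant_functions A G E (ι q) (hr q)
  obtain ⟨U, Z, hU, hqU, hUW, hZ, hdual⟩ := exists_dual_fields hι
    (σ := fun i x => differential (f i) (ι x)) (hW.preimage hι.continuous)
    (fun i => (smoothFormOn_differential hW (hf i)).comp_map hι) hqW hli
  refine ⟨W, f, U, Z, hW, hWG, hf, hfG, hU, hqU, hUW, hZ, hdual, fun x hx => ?_⟩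
  have hlix : LinearIndependent ℝ fun i =>
      (differential (f i) (ι x) : CotangentSpace 𝓘(ℝ, E) (ι x)) := by
    rw [Fintype.linearIndependent_iff]
    intro c hc j
    have h1 : ∑ i, c i * differential (f i) (ι x) (Z j x) = 0 := by
      have h2 := DFunLike.congr_fun hc (Z j x)
      simpa using h2
    simpa [hdual x hx] using h1
  refine ⟨hlix, ?_⟩
  let s : Fin r → E →L[ℝ] ℝ := fun i => differential (f i) (ι x)
  have hs : LinearIndependent ℝ s := hlix
  have h1 : Submodule.span ℝ (Set.range s) = basicCovectors A G E (ι x) := by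
    -- Constancy of the rank enters here: independent sections that formed a basis at `q` still span
    -- at `x`.
    refine Submodule.eq_of_le_of_finrank_eq ?_ ?_
    · rw [Submodule.span_le]
      rintro _ ⟨i, rfl⟩
      exact mem_invariantVerticalAnnihilator_iff.1
        (differential_mem_invariantVerticalAnnihilator hW hWG (hf i) (hfG i) (hUW hx))
    · rw [finrank_span_eq_card hs, hr, Fintype.card_fin]
  ext a
  have h2 : a ∈ Submodule.span ℝ (Set.range s) ↔ a ∈ basicCovectors A G E (ι x) := by rw [h1]
  exact h2.trans mem_invariantVerticalAnnihilator_iff.symm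

variable [FiniteDimensional ℝ F] [IsManifold 𝓘(ℝ, F) ∞ N] [MulAction G N]
  [ContMDiffSMul 𝓘(ℝ, A) 𝓘(ℝ, F) ∞ G N]

variable (A) in
/-- Pullback is an isomorphism from the invariant annihilator over a stratum to the annihilator of
the vertical distribution of the stratum. -/
theorem isPullbackBundleIso_stratum {K : Subgroup G} {m₀ : M}
    (hι : IsSmoothEmbedding 𝓘(ℝ, F) 𝓘(ℝ, E) ∞ ι)
    (hrange : Set.range ι = connectedComponentIn (orbitTypeSet M K) m₀)
    (hG : ∀ (g : G) q, ι (g • q) = g • ι q) {r : ℕ}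
    (hr : ∀ q, Module.finrank ℝ (basicCovectors A G E (ι q)) = r) :
    IsPullbackBundleIso 𝓘(ℝ, E) 𝓘(ℝ, F) ι
      (fun q => invariantVerticalAnnihilator 𝓘(ℝ, A) G 𝓘(ℝ, E) (ι q))
      (fun q => smoothAnnihilator 𝓘(ℝ, F)
        (fun x : N => verticalSpace 𝓘(ℝ, A) G 𝓘(ℝ, F) x) q) := by
  have hιs := hι.contMDiff
  have key : ∀ {W : Set M} {f : Fin r → M → ℝ} {U : Set N}, IsOpen W →
      (∀ i, ContMDiffOn 𝓘(ℝ, E) 𝓘(ℝ, ℝ) ∞ (f i) W) → U ⊆ ι ⁻¹' W →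
      (∀ i, SmoothFormOn 𝓘(ℝ, F) 𝓘(ℝ, F) (fun x : N => x) (differential (f i ∘ ι)) U) ∧
      ∀ x ∈ U, ∀ i, pullbackCovector 𝓘(ℝ, E) 𝓘(ℝ, F) ι x (differential (f i) (ι x)) =
        differential (f i ∘ ι) x := by
    intro W f U hW hf hUW
    refine ⟨fun i => (smoothFormOn_differential (hW.preimage hιs.continuous)
      ((hf i).comp hιs.contMDiffOn fun _ hx => hx)).mono hUW, fun x hx i => ?_⟩
    exact pullbackCovector_differential ((hιs x).mdifferentiableAt (by simp))
      (((hf i).contMDiffAt (hW.mem_nhds (hUW hx))).mdifferentiableAt (by simp))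
  have hframe : ∀ {f : Fin r → M → ℝ} {x : N}, (LinearIndependent ℝ fun i =>
          (differential (f i) (ι x) : CotangentSpace 𝓘(ℝ, E) (ι x))) →
      Submodule.span ℝ (Set.range fun i =>
          (differential (f i) (ι x) : CotangentSpace 𝓘(ℝ, E) (ι x))) =
          invariantVerticalAnnihilator 𝓘(ℝ, A) G 𝓘(ℝ, E) (ι x) →
      (∀ i, pullbackCovector 𝓘(ℝ, E) 𝓘(ℝ, F) ι x (differential (f i) (ι x)) =
        differential (f i ∘ ι) x) →
      (LinearIndependent ℝ fun i =>
          (differential (f i ∘ ι) x : CotangentSpace 𝓘(ℝ, F) x)) ∧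
        Submodule.span ℝ (Set.range fun i =>
          (differential (f i ∘ ι) x : CotangentSpace 𝓘(ℝ, F) x)) =
          smoothAnnihilator 𝓘(ℝ, F) (fun x : N => verticalSpace 𝓘(ℝ, A) G 𝓘(ℝ, F) x) x := by
    intro f x hli hspan hpb
    have h1 : (fun i => (differential (f i ∘ ι) x : CotangentSpace 𝓘(ℝ, F) x)) =
        pullbackCovector 𝓘(ℝ, E) 𝓘(ℝ, F) ι x ∘ fun i => differential (f i) (ι x) :=
      funext fun i => (hpb i).symm
    rw [h1]
    refine ⟨hli.map_injOn _ ?_, ?_⟩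
    · rw [hspan]
      exact injOn_pullbackCovector A hι hrange x
    · rw [Set.range_comp, ← Submodule.map_span, hspan,
        map_invariantVerticalAnnihilator hι hrange hG]
  refine ⟨⟨r, fun q => ?_⟩, ⟨r, fun q => ?_⟩, fun q => ⟨?_, ?_, ?_⟩, fun U σ hU hσ => ?_⟩
  · obtain ⟨W, f, U, Z, hW, hWG, hf, hfG, hU, hqU, hUW, hZ, hdual, hspan⟩ :=
      exists_invariant_frame A hιs hr q
    exact ⟨U, hU, hqU, fun i x => differential (f i) (ι x), fun i =>
      ((smoothFormOn_differential hW (hf i)).comp_map hιs).mono hUW, hspan⟩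
  · obtain ⟨W, f, U, Z, hW, hWG, hf, hfG, hU, hqU, hUW, hZ, hdual, hspan⟩ :=
      exists_invariant_frame A hιs hr q
    obtain ⟨h1, h2⟩ := key hW hf hUW
    exact ⟨U, hU, hqU, fun i => differential (f i ∘ ι), h1, fun x hx =>
      hframe (hspan x hx).1 (hspan x hx).2 (h2 x hx)⟩
  · exact fun a ha => (map_invariantVerticalAnnihilator hι hrange hG q).le ⟨a, ha, rfl⟩
  · exact injOn_pullbackCovector A hι hrange q
  · exact fun b hb => (map_invariantVerticalAnnihilator hι hrange hG q).ge hb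
  have hcoeff : ∀ {f : Fin r → M → ℝ} {x : N}, x ∈ U →
      Submodule.span ℝ (Set.range fun i =>
          (differential (f i) (ι x) : CotangentSpace 𝓘(ℝ, E) (ι x))) =
          invariantVerticalAnnihilator 𝓘(ℝ, A) G 𝓘(ℝ, E) (ι x) →
      ∃ c : Fin r → ℝ, σ x = ∑ i, c i • (differential (f i) (ι x) :
        CotangentSpace 𝓘(ℝ, E) (ι x)) := by
    intro f x hx hspan
    have h1 : σ x ∈ invariantVerticalAnnihilator 𝓘(ℝ, A) G 𝓘(ℝ, E) (ι x) := hσ x hx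
    rw [← hspan, Submodule.mem_span_range_iff_exists_fun] at h1
    obtain ⟨c, hc⟩ := h1
    exact ⟨c, hc.symm⟩
  constructor
  · intro hs
    refine contMDiffOn_of_locally_contMDiffOn fun q hq => ?_
    obtain ⟨W, f, U', Z, hW, hWG, hf, hfG, hU', hqU', hUW, hZ, hdual, hspan⟩ :=
      exists_invariant_frame A hιs hr q
    obtain ⟨h1, h2⟩ := key hW hf hUW
    refine ⟨U', hU', hqU', ?_⟩
    -- The frame coefficients of `σ` are its smooth values on the dual fields `Z`; the pullback is
    -- the same combination of the pulled-back frame.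
    have h3 := smoothFormOn_sum_smul (contMDiffOn_id (s := U ∩ U'))
      (fun i => (h1 i).mono Set.inter_subset_right)
      (fun i => contMDiffOn_form_apply (hs.mono Set.inter_subset_left)
        ((hZ i).mono Set.inter_subset_right))
    refine ContMDiffOn.congr h3 fun x hx => ?_
    obtain ⟨c, hc⟩ := hcoeff hx.1 (hspan x hx.2).2
    have hcj : ∀ j, σ x (Z j x) = c j := fun j => by
      rw [hc]
      have : ∑ i, c i * differential (f i) (ι x) (Z j x) = c j := by simp [hdual x hx.2]
      simpa using this
    simp only [hcj]
    rw [hc, map_sum]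
    simp only [map_smul, h2 x hx.2]
    rfl
  · intro hs
    refine contMDiffOn_of_locally_contMDiffOn fun q hq => ?_
    obtain ⟨W, f, U', Z, hW, hWG, hf, hfG, hU', hqU', hUW, hZ, hdual, hspan⟩ :=
      exists_invariant_frame A hιs hr q
    obtain ⟨h1, h2⟩ := key hW hf hUW
    -- Only the pullback is known to be smooth now, so the coefficients are read off with fields on
    -- `N` dual to the pulled-back frame.
    obtain ⟨V, Y, hV, hqV, hVU', hY, hYdual⟩ := exists_dual_fields (M := N) (N := N)
      (ι := fun x : N => x) contMDiff_id hU' h1 hqU'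
      (hframe (hspan q hqU').1 (hspan q hqU').2 (h2 q hqU')).1
    refine ⟨V, hV, hqV, ?_⟩
    have h3 := smoothFormOn_sum_smul (hιs.contMDiffOn (s := U ∩ V))
      (fun i => ((smoothFormOn_differential hW (hf i)).comp_map hιs).mono
        fun x hx => hUW (hVU' hx.2))
      (fun i => contMDiffOn_form_apply (hs.mono Set.inter_subset_left)
        ((hY i).mono Set.inter_subset_right))
    refine ContMDiffOn.congr h3 fun x hx => ?_
    obtain ⟨c, hc⟩ := hcoeff hx.1 (hspan x (hVU' hx.2)).2
    have hpb : pullbackCovector 𝓘(ℝ, E) 𝓘(ℝ, F) ι x (σ x) =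
        ∑ i, c i • differential (f i ∘ ι) x := by
      rw [hc, map_sum]
      simp only [map_smul, h2 x (hVU' hx.2)]
    have hcj : ∀ j, pullbackCovector 𝓘(ℝ, E) 𝓘(ℝ, F) ι x (σ x) (Y j x) = c j := fun j => by
      rw [hpb]
      have : ∑ i, c i * differential (f i ∘ ι) x (Y j x) = c j := by simp [hYdual x hx.2]
      simpa using this
    simp only [hcj]
    rw [hc]

end Stratum

/-- The Riesz representation of functionals on a subspace by a positive definite form. -/
theorem exists_mem_forall_eq_of_posDef {E : Type*} [NormedAddCommGroup E] [NormedSpace ℝ E]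
    [FiniteDimensional ℝ E] {B : E →L[ℝ] E →L[ℝ] ℝ} (hB : ∀ v, v ≠ 0 → 0 < B v v)
    (T : Submodule ℝ E) (a : E →L[ℝ] ℝ) : ∃ t ∈ T, ∀ s ∈ T, B s t = a s := by
  let φ : T →ₗ[ℝ] Module.Dual ℝ T :=
    LinearMap.mk₂ ℝ (fun t s : T => B s t) (by intros; simp) (by intros; simp) (by intros; simp)
      (by intros; simp)
  have h1 : Function.Injective φ := by
    rw [injective_iff_map_eq_zero]
    intro t ht
    by_contra h
    have h2 := hB t fun h3 => h (Subtype.ext h3)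
    have h3 : B t t = 0 := DFunLike.congr_fun ht t
    exact h2.ne' h3
  have h2 := (LinearMap.injective_iff_surjective_of_finrank_eq_finrank
    (Subspace.dual_finrank_eq (K := ℝ) (V := T)).symm).1 h1
  obtain ⟨t, ht⟩ := h2 ((a : E →ₗ[ℝ] ℝ).comp T.subtype)
  exact ⟨t, t.2, fun s hs => DFunLike.congr_fun ht (⟨s, hs⟩ : T)⟩

/-! ### The annihilator in the ambient tangent bundle -/

section Stratum

universe u

variable {A : Type*} [NormedAddCommGroup A] [NormedSpace ℝ A] [FiniteDimensional ℝ A]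
  {G : Type*} [TopologicalSpace G] [ChartedSpace A G] [Group G] [LieGroup 𝓘(ℝ, A) ∞ G]
  {E : Type u} [NormedAddCommGroup E] [NormedSpace ℝ E] [FiniteDimensional ℝ E]
  {M : Type*} [TopologicalSpace M] [ChartedSpace E M] [MulAction G M]
  [ContMDiffSMul 𝓘(ℝ, A) 𝓘(ℝ, E) ∞ G M] [IsManifold 𝓘(ℝ, E) ∞ M] [ProperSMul G M]
  {F : Type*} [NormedAddCommGroup F] [NormedSpace ℝ F]
  {N : Type*} [TopologicalSpace N] [ChartedSpace F N] {ι : N → M}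

variable (A) in
/-- The smooth annihilator of the invariant annihilator is its pointwise annihilator. -/
theorem mem_smoothCoannihilator_iff (hι : ContMDiff 𝓘(ℝ, F) 𝓘(ℝ, E) ∞ ι) {r : ℕ}
    (hr : ∀ q, Module.finrank ℝ (basicCovectors A G E (ι q)) = r) {q : N} {v : E} :
    (show TangentSpace 𝓘(ℝ, E) (ι q) from v) ∈ smoothCoannihilator 𝓘(ℝ, E) 𝓘(ℝ, F) ι
      (fun x => invariantVerticalAnnihilator 𝓘(ℝ, A) G 𝓘(ℝ, E) (ι x)) q ↔
    ∀ a ∈ basicCovectors A G E (ι q), a v = 0 := by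
  obtain ⟨W, f, U, Z, hW, hWG, hf, hfG, hU, hqU, hUW, hZ, hdual, hspan⟩ :=
    exists_invariant_frame A hι hr q
  have hσ : ∀ i, SmoothFormOn 𝓘(ℝ, E) 𝓘(ℝ, F) ι (fun x => differential (f i) (ι x)) U :=
    fun i => ((smoothFormOn_differential hW (hf i)).comp_map hι).mono hUW
  have hσC : ∀ i, ∀ x ∈ U, differential (f i) (ι x) ∈
      invariantVerticalAnnihilator 𝓘(ℝ, A) G 𝓘(ℝ, E) (ι x) := fun i x hx => by
    rw [← (hspan x hx).2]
    exact Submodule.subset_span ⟨i, rfl⟩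
  have hkill : ∀ x ∈ U, ∀ w : TangentSpace 𝓘(ℝ, E) (ι x),
      (∀ i, differential (f i) (ι x) w = (0 : ℝ)) →
      ∀ a ∈ invariantVerticalAnnihilator 𝓘(ℝ, A) G 𝓘(ℝ, E) (ι x), a w = (0 : ℝ) := by
    intro x hx w hw a ha
    rw [← (hspan x hx).2] at ha
    induction ha using Submodule.span_induction with
    | mem a ha =>
      obtain ⟨i, rfl⟩ := ha
      exact hw i
    | zero => rfl
    | add a b _ _ ha hb => exact (congrArg₂ (· + ·) ha hb).trans (add_zero _)
    | smul c a _ ha => exact (congrArg (c • ·) ha).trans (smul_zero _)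
  constructor
  · rintro ⟨V, hV, hqV, X, hX, hXC, hXv⟩ a ha
    refine hkill q hqU v (fun i => ?_) a (mem_invariantVerticalAnnihilator_iff.2 ha)
    have h1 := hXC U (fun x => differential (f i) (ι x)) hU (hσ i) (hσC i) q ⟨hqV, hqU⟩
    rw [hXv] at h1
    exact h1
  · intro hv
    obtain ⟨V, Y, hV, hqV, hY, hYv⟩ := exists_smoothField_eq (M := M) (ι q) v
    -- Adding Σ c i • Z i makes every frame covector vanish on the extension `Y`. At `q` nothing
    -- changes, since `v` is already annihilated there.
    let c : Fin r → N → ℝ := fun i x => -differential (f i) (ι x) (Y (ι x))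
    have hYι : SmoothFieldOn 𝓘(ℝ, E) 𝓘(ℝ, F) ι (fun x => Y (ι x)) (U ∩ ι ⁻¹' V) :=
      (hY.comp_map hι).mono Set.inter_subset_right
    have hc : ∀ i, ContMDiffOn 𝓘(ℝ, F) 𝓘(ℝ, ℝ) ∞ (c i) (U ∩ ι ⁻¹' V) := fun i =>
      (contMDiffOn_form_apply ((hσ i).mono Set.inter_subset_left) hYι).neg
    refine ⟨U ∩ ι ⁻¹' V, hU.inter (hV.preimage hι.continuous), ⟨hqU, hqV⟩,
      fun x => Y (ι x) + ∑ i, c i x • Z i x,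
      smoothFieldOn_add_sum_smul hι.contMDiffOn hYι
        (fun i => (hZ i).mono Set.inter_subset_left) hc, ?_, ?_⟩
    · intro V' α _ _ hα x hx
      refine hkill x hx.1.1 _ (fun i => ?_) _ (hα x hx.2)
      have h1 : differential (f i) (ι x) (Y (ι x) + ∑ j, c j x • Z j x) =
          differential (f i) (ι x) (Y (ι x)) +
            ∑ j, c j x * differential (f i) (ι x) (Z j x) := by
        simp
      rw [h1]
      simp [hdual x hx.1.1, c]
    · have h1 : ∀ i, c i q = 0 := fun i => by
        have h2 := hv _ (mem_invariantVerticalAnnihilator_iff.1 (hσC i q hqU))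
        simp only [c, hYv, neg_eq_zero]
        exact h2
      simp only [h1, zero_smul, Finset.sum_const_zero, add_zero]
      exact hYv

variable [IsManifold 𝓘(ℝ, F) ∞ N]

variable (A) in
/-- Along a stratum, the annihilator of the invariant annihilator is the sum of the vertical space
and the normal space. -/
theorem smoothCoannihilator_eq_sup {K : Subgroup G} {m₀ : M}
    (hι : IsSmoothEmbedding 𝓘(ℝ, F) 𝓘(ℝ, E) ∞ ι)
    (hrange : Set.range ι = connectedComponentIn (orbitTypeSet M K) m₀) {r : ℕ}
    (hr : ∀ q, Module.finrank ℝ (basicCovectors A G E (ι q)) = r)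
    (ρ : ContMDiffRiemannianMetric 𝓘(ℝ, E) ∞ E (fun m : M => TangentSpace 𝓘(ℝ, E) m))
    (hρ : IsInvariantMetric G 𝓘(ℝ, E) ρ) (q : N) :
    Disjoint (verticalSpace 𝓘(ℝ, A) G 𝓘(ℝ, E) (ι q)) (normalSpace 𝓘(ℝ, E) 𝓘(ℝ, F) ρ ι q) ∧
    smoothCoannihilator 𝓘(ℝ, E) 𝓘(ℝ, F) ι
        (fun x => invariantVerticalAnnihilator 𝓘(ℝ, A) G 𝓘(ℝ, E) (ι x)) q =
      ((verticalSpace 𝓘(ℝ, A) G 𝓘(ℝ, E) (ι q) ⊔ normalSpace 𝓘(ℝ, E) 𝓘(ℝ, F) ρ ι q :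
        Submodule ℝ (TangentSpace 𝓘(ℝ, E) (ι q))) : Set (TangentSpace 𝓘(ℝ, E) (ι q))) := by
  obtain ⟨d, l, hd, hl⟩ := exists_leftInverse_of_isImmersion hι.isImmersion q
  have hT := range_eq_fixedModVertical_of_hasMFDerivAt A hι hrange hd
  let B : E →L[ℝ] E →L[ℝ] ℝ := ρ.inner (ι q)
  have hB : ∀ v : E, v ≠ 0 → 0 < B v v := fun v hv => ρ.pos (ι q) v hv
  have hsymm : ∀ v w : E, B v w = B w v := fun v w => ρ.symm (ι q) v w
  have hBH : ∀ h ∈ MulAction.stabilizer G (ι q), ∀ v w : E,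
      B (smulDeriv A E h (ι q) v) (smulDeriv A E h (ι q) w) = B v w := by
    intro h hh v w
    have h1 : (ρ.inner (h • ι q) : E →L[ℝ] E →L[ℝ] ℝ) (smulDeriv A E h (ι q) v)
      (smulDeriv A E h (ι q) w) = B v w := hρ h (ι q) v w
    have h2 : ∀ x, x = ι q → (ρ.inner x : E →L[ℝ] E →L[ℝ] ℝ) = B := by
      rintro x rfl
      rfl
    rwa [h2 _ hh] at h1
  have hnormal : ∀ v : E, v ∈ normalSpace 𝓘(ℝ, E) 𝓘(ℝ, F) ρ ι q ↔
      ∀ t ∈ fixedModVertical A G E (ι q), B t v = 0 := by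
    intro v
    have hd' : (mfderiv 𝓘(ℝ, F) 𝓘(ℝ, E) ι q : F →L[ℝ] E) = d := hd.mfderiv
    have h1 : v ∈ normalSpace 𝓘(ℝ, E) 𝓘(ℝ, F) ρ ι q ↔
      ∀ w : F, B ((mfderiv 𝓘(ℝ, F) 𝓘(ℝ, E) ι q : F →L[ℝ] E) w) v = 0 := Iff.rfl
    rw [h1, hd', ← hT]
    exact ⟨fun h => by rintro _ ⟨w, rfl⟩; exact h w, fun h w => h _ ⟨w, rfl⟩⟩
  have hV : ∀ v : E, v ∈ verticalSpace 𝓘(ℝ, A) G 𝓘(ℝ, E) (ι q) ↔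
      v ∈ (infAct A G E (ι q)).range := fun v => Iff.rfl
  -- The vector representing an invariant covector in an invariant inner product is fixed by the
  -- isotropy group, so it lies in `fixedModVertical` and is orthogonal to the normal space.
  have hker : ∀ a ∈ basicCovectors A G E (ι q), ∀ v : E,
      v ∈ normalSpace 𝓘(ℝ, E) 𝓘(ℝ, F) ρ ι q → a v = 0 := by
    intro a ha v hv
    obtain ⟨w, -, hw⟩ := exists_mem_forall_eq_of_posDef hB ⊤ a
    have hwT : w ∈ fixedModVertical A G E (ι q) := by
      intro h hh
      set R := smulDeriv A E h (ι q)
      have h1 : ∀ s : E, B s (R w - w) = 0 := fun s => by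
        have h2 : B s (R w) = a (R.symm s) := by
          have h3 : B (R (R.symm s)) (R w) = B (R.symm s) w := hBH h hh _ _
          rw [← hw _ trivial, ← h3, R.apply_symm_apply]
        rw [map_sub, h2, hw s trivial, ← ha.2 h hh, R.apply_symm_apply, sub_self]
      have h3 : R w - w = 0 := by
        by_contra h4
        exact (hB _ h4).ne' (h1 _)
      rw [h3]
      exact Submodule.zero_mem _
    rw [← hw v trivial, hsymm]
    exact (hnormal v).1 hv w hwT
  constructor
  · rw [Submodule.disjoint_def]
    intro v hv hv'
    by_contra h
    exact (hB v h).ne' ((hnormal v).1 hv' v (range_infAct_le_fixedModVertical _ ((hV v).1 hv)))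
  refine Set.ext fun v : E => ?_
  refine (mem_smoothCoannihilator_iff A hι.contMDiff hr).trans (Iff.trans ?_ Submodule.mem_sup.symm)
  constructor
  · intro hv
    -- `t` is the orthogonal projection of `v` to the tangent space of the stratum.
    obtain ⟨t, ht, htv⟩ := exists_mem_forall_eq_of_posDef hB (fixedModVertical A G E (ι q))
      (B.flip v)
    have hn : (v - t : E) ∈ normalSpace 𝓘(ℝ, E) 𝓘(ℝ, F) ρ ι q :=
      (hnormal _).2 fun s hs => by
        have h1 : B s t = B s v := htv s hs
        have h2 : B s (v - t : E) = B s v - B s t := map_sub _ _ _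
        rw [h2, h1, sub_self]
    refine ⟨t, ?_, (v - t : E), hn, add_sub_cancel _ _⟩
    refine (hV t).2 ?_
    -- If `t` were not vertical, some basic covector would be nonzero on it; but that covector kills
    -- both `v` and the normal part `v - t`.
    by_contra htV
    obtain ⟨b, hbt, hbV⟩ := Submodule.exists_le_ker_of_notMem htV
    obtain ⟨a, ha, hab⟩ := exists_basicCovector_eqOn A (G := G)
      (b := LinearMap.toContinuousLinearMap b) (p := ι q) fun w hw => hbV hw
    have h1 : a (v - t : E) = a v - a t := map_sub _ _ _
    rw [hker a ha _ hn, hv a ha, zero_sub, eq_comm, neg_eq_zero, hab t ht] at h1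
    exact hbt h1
  · rintro ⟨u, hu, n, hn, rfl⟩ a ha
    have h1 : a (u + n : E) = a u + a n := map_add _ _ _
    rw [show a u = 0 from ha.1 u ((hV u).1 hu), show a n = 0 from hker a ha n hn, add_zero] at h1
    exact h1

end Stratum

/-! ### The theorem for a stratum -/

theorem lemma5p9 {n d : ℕ}
    {M : Type*} [TopologicalSpace M] [T2Space M] [ParacompactSpace M]
    [ChartedSpace (EuclideanSpace ℝ (Fin n)) M] [IsManifold (𝓡 n) ∞ M]
    {G : Type*} [TopologicalSpace G] [ChartedSpace (EuclideanSpace ℝ (Fin d)) G] [Group G]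
    [LieGroup (𝓡 d) ∞ G] [ConnectedSpace G]
    [MulAction G M] [ContMDiffSMul (𝓡 d) (𝓡 n) ∞ G M] [ProperSMul G M]
    (K : Subgroup G) (m₀ : M) (hm₀ : m₀ ∈ orbitTypeSet M K)
    (P : SubMulAction G M) (hP : P = orbitTypeStratum K m₀) :
    (∃ (k : ℕ) (_ : ChartedSpace (EuclideanSpace ℝ (Fin k)) P),
      IsManifold (𝓡 k) ∞ P ∧ IsSmoothEmbedding (𝓡 k) (𝓡 n) ∞ (Subtype.val : P → M)) ∧
    ∀ (k : ℕ) [ChartedSpace (EuclideanSpace ℝ (Fin k)) P] [IsManifold (𝓡 k) ∞ P],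
      IsSmoothEmbedding (𝓡 k) (𝓡 n) ∞ (Subtype.val : P → M) →
      (∀ p : P,
        (invariantVerticalAnnihilator (𝓡 d) G (𝓡 n) (p : M)).map
            (pullbackCovector (𝓡 n) (𝓡 k) (Subtype.val : P → M) p)
          = smoothAnnihilator (𝓡 k) (fun q : P => verticalSpace (𝓡 d) G (𝓡 k) q) p) ∧
      IsPullbackBundleIso (𝓡 n) (𝓡 k) (Subtype.val : P → M)
        (fun p : P => invariantVerticalAnnihilator (𝓡 d) G (𝓡 n) (p : M))
        (fun p : P => smoothAnnihilator (𝓡 k) (fun q : P => verticalSpace (𝓡 d) G (𝓡 k) q) p) ∧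
      ∀ ρ : ContMDiffRiemannianMetric (𝓡 n) ∞ (EuclideanSpace ℝ (Fin n))
          (fun m : M => TangentSpace (𝓡 n) m),
        IsInvariantMetric G (𝓡 n) ρ →
        ∀ p : P,
          Disjoint (verticalSpace (𝓡 d) G (𝓡 n) (p : M))
            (normalSpace (𝓡 n) (𝓡 k) ρ (Subtype.val : P → M) p) ∧
          smoothCoannihilator (𝓡 n) (𝓡 k) (Subtype.val : P → M)
              (fun q : P => invariantVerticalAnnihilator (𝓡 d) G (𝓡 n) (q : M)) p
            = ((verticalSpace (𝓡 d) G (𝓡 n) (p : M) ⊔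
                normalSpace (𝓡 n) (𝓡 k) ρ (Subtype.val : P → M) p :
                Submodule ℝ (TangentSpace (𝓡 n) (p : M))) : Set (TangentSpace (𝓡 n) (p : M))) := by
  subst hP
  have hrange : Set.range (Subtype.val : orbitTypeStratum K m₀ → M) =
      connectedComponentIn (orbitTypeSet M K) m₀ := Subtype.range_coe
  refine ⟨exists_chartedSpace_of_range_eq_component (EuclideanSpace ℝ (Fin d))
    (EuclideanSpace ℝ (Fin n)) IsEmbedding.subtypeVal hrange, ?_⟩
  intro k _ _ hι
  have hG : ∀ (g : G) (q : orbitTypeStratum K m₀), ((g • q : orbitTypeStratum K m₀) : M) =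
      g • (q : M) := fun _ _ => rfl
  -- Smoothness of the induced action follows from the embedding, for whichever smooth structure on
  -- the stratum is given.
  have : ContMDiffSMul (𝓡 d) (𝓡 k) ∞ G (orbitTypeStratum K m₀) :=
    contMDiffSMul_of_isSmoothEmbedding hι hG
  have hr : ∀ q : orbitTypeStratum K m₀, Module.finrank ℝ (basicCovectors
      (EuclideanSpace ℝ (Fin d)) G (EuclideanSpace ℝ (Fin n)) (q : M)) = Module.finrank ℝ
        (basicCovectors (EuclideanSpace ℝ (Fin d)) G (EuclideanSpace ℝ (Fin n)) m₀) := fun q =>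
    finrank_basicCovectors_eq_of_mem_component _ _ q.2 (mem_connectedComponentIn hm₀)
  exact ⟨map_invariantVerticalAnnihilator hι hrange hG,
    isPullbackBundleIso_stratum _ hι hrange hG hr,
    fun ρ hρ p => smoothCoannihilator_eq_sup _ hι hrange hr ρ hρ p⟩
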